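/- Let $N\ge 1$, let $\Omega\subset\mathbb R^N$ be a (possibly unbounded) domain with smooth boundary, unit outward normal $\nu$ and surface measure $\sigma$, let $T>0$, $Q_T=(0,T)\times\Omega$, $\Gamma_T=(0,T)\times\partial\Omega$. For $i=1,2$ consider, for $U=(u^1,\dots,u^m)$, the problem $$(P)_i\quad\begin{cases}\partial_t u^k-\sum_{p,q=1}^N\partial_{x_q}\big(a^k_{pq}(t,x)\,\partial_{x_p}u^k\big)+\beta_i^k(t,x,u^k)-F_i^k(t,x,U)\ni 0 & \text{in }Q_T,\\ -\sum_{p,q=1}^N a^k_{pq}(t,x)\,\nu_q\,\partial_{x_p}u^k\in\gamma_i^k(t,x,u^k)&\text{on }\Gamma_T,\\ u^k(0,x)=a_i^k(x)&\text{in }\Omega,\end{cases}\qquad k=1,\dots,m.$$ Here $a^k_{pq}\in L^\infty(Q_T)$, the restriction of $a^k_{pq}$ to $\Gamma_T$ is in $L^\infty(\Gamma_T)$ and is the boundary value of $a^k_{pq}$, and for some $\lambda^k\ge 0$ one has $\lambda^k|\xi|^2\le\sum_{p,q}a^k_{pq}(t,x)\xi_p\xi_q$ for all $\xi\in\mathbb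 R^N$ and a.e. $(t,x)\in Q_T$; the graphs $\beta_i^k(t,x,\cdot)$ (for a.e. $(t,x)\in Q_T$) and $\gamma_i^k(t,x,\cdot)$ (for a.e. $(t,x)\in\Gamma_T$) are monotone in $\mathbb R\times\mathbb R$; and $F_i^k:Q_T\times\mathbb R^m\to 2^{\mathbb R}$. "The function $h$ on $\partial\Omega$ is the boundary value of the function $v$ on $\Omega$" means that $h\in L^2_{loc}(\partial\Omega)$ and that for all $R>0$ $$\frac1\varepsilon\int_{\{y\in\Omega:\ \mathrm{dist}(y,\partial\Omega)<\varepsilon,\ |y|<R\}}|v(y)-h(\pi(y))|^2\,dy\to0\quad(\varepsilon\downarrow0),$$ where $\pi(y)$ is the nearest boundary point; for $v\in H^1(\Omega)$ this is the usual trace. For functions of $(t,x)$, boundary values are taken for a.e. $t$. "A.e. $(t,x)$" means: for a.e. $t$, for a.e. $x$. A sub-solution of $(P)_i$ on $[0,T]$ is a $U=(u^1,\dots,u^m)$ such that for every $k$ $$u^k\in C([0,T];L^2(\Omega))\cap L^\infty(0,T;L^\infty(\Omega))\cap W^{1,2}_{loc}((0,T];L^2(\Omega))\cap L^2_{loc}((0,T];H^2(\Omega)),$$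 for a.e. $t$ the weak divergence $\sum_{p,q}\partial_{x_q}(a^k_{pq}\partial_{x_p}u^k)$ is a locally integrable function on $\Omega$, and there are $f^k,b^k\in L^2_{loc}((0,T];L^2(\Omega))$ and $g^k\in L^2_{loc}((0,T];L^2(\partial\Omega))$ with $f^k(t,x)\in F_i^k(t,x,U(t,x))$, $b^k(t,x)\in\beta_i^k(t,x,u^k(t,x))$ and $\partial_tu^k-\sum_{p,q}\partial_{x_q}(a^k_{pq}\partial_{x_p}u^k)+b^k-f^k\le0$ a.e. in $Q_T$; $g^k(t,x)\in\gamma_i^k(t,x,u^k(t,x))$ and $-\sum_{p,q}a^k_{pq}\nu_q\partial_{x_p}u^k\ge g^k$ a.e. on $\Gamma_T$ (with the boundary values of $u^k$ and $\partial_{x_p}u^k$); and $u^k(0,\cdot)=a_i^k$ a.e. in $\Omega$. A super-solution is defined in the same way, with both inequalities reversed. Let $U_1=(u_1^1,\dots,u_1^m)$ be a sub-solution of $(P)_1$ and $U_2=(u_2^1,\dots,u_2^m)$ a super-solution of $(P)_2$ on $[0,T]$ (the coefficients $a^k_{pq}$ being the same in both problems). Write $D(\beta)=\{r:\beta(r)\neq\emptyset\}$,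 and assume that for each $k\in\{1,\dots,m\}$: (A1) $a_1^k\le a_2^k$ a.e. in $\Omega$. (A2) Either (i) $\beta_1^k(t,x,\cdot)=\beta_2^k(t,x,\cdot)$ for a.e. $(t,x)\in Q_T$; or (ii) for a.e. $(t,x)\in Q_T$, $\sup\beta_2^k(t,x,r_2)\le\inf\beta_1^k(t,x,r_1)$ for all $r_1\in D(\beta_1^k(t,x,\cdot))$, $r_2\in D(\beta_2^k(t,x,\cdot))$ with $r_1>r_2$. (A3) Either (i) $\gamma_1^k(t,x,\cdot)=\gamma_2^k(t,x,\cdot)$ for a.e. $(t,x)\in\Gamma_T$; or (ii) for a.e. $(t,x)\in\Gamma_T$, $\sup\gamma_2^k(t,x,r_2)\le\inf\gamma_1^k(t,x,r_1)$ for all $r_1\in D(\gamma_1^k(t,x,\cdot))$, $r_2\in D(\gamma_2^k(t,x,\cdot))$ with $r_1>r_2$; or (iii) for a.e. $(t,x)\in\Gamma_T$, $r_1\le r_2$ for all $r_1\in D(\gamma_1^k(t,x,\cdot))$, $r_2\in D(\gamma_2^k(t,x,\cdot))$. (A4) (i) For a.e. $(t,x)\in Q_T$ and all $U\in\mathbb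 R^m$, $-\infty<\sup F_1^k(t,x,U)\le\inf F_2^k(t,x,U)<+\infty$; and (ii) for $F^k=F_1^k$ or for $F^k=F_2^k$ the following holds: for a.e. $(t,x)\in Q_T$, $F^k(t,x,\cdot)$ is single-valued, it is differentiable at almost all $U\in\mathbb R^m$ with $\partial F^k/\partial u_j(t,x,U)\ge0$ for all $j\ne k$, and for each $M>0$ there is $L_M$, independent of $(t,x)$, such that for a.e. $(t,x)\in Q_T$ the function $F^k(t,x,\cdot)$ is Lipschitz continuous with constant $L_M$ on $\{|U|\le M\}$. Then $u_1^k(t,x)\le u_2^k(t,x)$ for all $k\in\{1,\dots,m\}$, all $t\in[0,T]$ and a.e. $x\in\Omega$. -/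

import Mathlib

open MeasureTheory Filter Topology Set
open scoped NNReal ContDiff

noncomputable section

namespace ParabolicSystem

/-- The space `ℝⁿ` with its Euclidean norm. -/
abbrev Euc (n : ℕ) : Type := EuclideanSpace ℝ (Fin n)

/-! ### The domain, its surface measure and its normal -/

/-- `ρ` is a smooth defining function of `Ω` near the point `x`: close to `x` the set `Ω` is
`{ρ < 0}`, and `∇ρ(x) ≠ 0`. -/
def IsDefiningFunctionAt {N : ℕ} (Ω : Set (Euc N)) (x : Euc N) (ρ : Euc N → ℝ) : Prop :=
  ContDiff ℝ ∞ ρ ∧ ρ x = 0 ∧ gradient ρ x ≠ 0 ∧ ∃ V ∈ 𝓝 x, Ω ∩ V = {y | ρ y < 0} ∩ V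

/-- A (possibly unbounded) domain in `ℝᴺ` with smooth boundary: near every boundary point it is
the sublevel set `{ρ < 0}` of a smooth function with non-vanishing gradient. -/
def IsSmoothDomain {N : ℕ} (Ω : Set (Euc N)) : Prop :=
  IsOpen Ω ∧ IsConnected Ω ∧ ∀ x ∈ frontier Ω, ∃ ρ, IsDefiningFunctionAt Ω x ρ

/-- `n = ∇ρ(x) / |∇ρ(x)|` for a local defining function `ρ` of `Ω` at `x`. -/
def IsOuterNormalAt {N : ℕ} (Ω : Set (Euc N)) (x n : Euc N) : Prop :=
  ∃ ρ, IsDefiningFunctionAt Ω x ρ ∧ n = ‖gradient ρ x‖⁻¹ • gradient ρ x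

open Classical in
/-- The unit outward normal `ν(x)` at a boundary point `x` of a smooth domain
(`0` where there is none). -/
def outerNormal {N : ℕ} (Ω : Set (Euc N)) (x : Euc N) : Euc N :=
  if h : ∃ n, IsOuterNormalAt Ω x n then h.choose else 0

/-- Lebesgue measure on `Ω`. -/
def bulkMeasure {N : ℕ} (Ω : Set (Euc N)) : Measure (Euc N) := volume.restrict Ω

/-- The surface measure `σ` on `∂Ω`: the `(N - 1)`-dimensional Hausdorff measure, in the Euclidean
normalization, restricted to `∂Ω`. -/
def surfaceMeasure {N : ℕ} (Ω : Set (Euc N)) : Measure (Euc N) :=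
  (Measure.euclideanHausdorffMeasure (N - 1)).restrict (frontier Ω)

/-- `P t x` for a.e. `t ∈ (0, T)` and `μ`-a.e. `x`. With `μ = bulkMeasure Ω` this is
"a.e. in `Q_T = (0, T) × Ω`", with `μ = surfaceMeasure Ω` it is
"a.e. on `Γ_T = (0, T) × ∂Ω`". -/
def AEOn {N : ℕ} (T : ℝ) (μ : Measure (Euc N)) (P : ℝ → Euc N → Prop) : Prop :=
  ∀ᵐ t ∂(volume.restrict (Ioo (0 : ℝ) T)), ∀ᵐ x ∂μ, P t x

/-! ### Boundary values -/

open Classical in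
/-- A nearest point of `∂Ω` to `y`. If `∂Ω` is not empty such a point exists, and it is unique
for a.e. `y`. -/
def nearestBoundaryPoint {N : ℕ} (Ω : Set (Euc N)) (y : Euc N) : Euc N :=
  if h : ∃ x ∈ frontier Ω, dist y x = Metric.infDist y (frontier Ω) then h.choose else y

/-- The function `v` on `Ω` has the boundary value (trace) `h` on `∂Ω`. Write `π(y)` for the
nearest boundary point. On bounded sets, `v` converges to `h ∘ π` in quadratic mean over the
boundary layer of width `ε`:
`ε⁻¹ ∫_{y ∈ Ω, dist(y, ∂Ω) < ε, |y| < R} |v(y) - h(π(y))|² dy → 0` as `ε ↓ 0`, for all `R`,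
and `h` is locally square integrable on `∂Ω`.
On a smooth domain every `v ∈ H¹(Ω)` has exactly one such boundary value, its usual Sobolev
trace; a bounded `v` that extends continuously to the closure of `Ω` has as boundary value the
restriction of its extension. The notion makes sense without any differentiability of `v`, as is
needed for bounded measurable coefficients. -/
def HasBoundaryValue {N : ℕ} (Ω : Set (Euc N)) (v h : Euc N → ℝ) : Prop :=
  AEStronglyMeasurable h (surfaceMeasure Ω) ∧
  (∀ R : ℝ, 0 < R → ∫⁻ x in Metric.ball 0 R, ‖h x‖ₑ ^ 2 ∂(surfaceMeasure Ω) < ⊤) ∧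
  ∀ R : ℝ, 0 < R →
    Tendsto (fun ε : ℝ => (ENNReal.ofReal ε)⁻¹ *
      ∫⁻ y in Ω ∩ Metric.thickening ε (frontier Ω) ∩ Metric.ball 0 R,
        ‖v y - h (nearestBoundaryPoint Ω y)‖ₑ ^ 2) (𝓝[>] 0) (𝓝 0)

/-! ### Weak derivatives -/

/-- Test functions: `C_c^∞(Ω)`. -/
def IsTestFunction {N : ℕ} (Ω : Set (Euc N)) (φ : Euc N → ℝ) : Prop :=
  ContDiff ℝ ∞ φ ∧ HasCompactSupport φ ∧ tsupport φ ⊆ Ω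

/-- The partial derivative `∂φ/∂x_i` of a differentiable function. -/
def partialDeriv {n : ℕ} (i : Fin n) (φ : Euc n → ℝ) (x : Euc n) : ℝ :=
  fderiv ℝ φ x (EuclideanSpace.single i 1)

/-- `w` is the weak partial derivative `∂v/∂x_i` in `Ω`. -/
def HasWeakPartial {N : ℕ} (Ω : Set (Euc N)) (i : Fin N) (v w : Euc N → ℝ) : Prop :=
  ∀ φ, IsTestFunction Ω φ →
    ∫ x in Ω, v x * partialDeriv i φ x = - ∫ x in Ω, w x * φ x

/-- The locally integrable function `D` is the weak divergence `∑_j ∂A_j/∂x_j` in `Ω`. -/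
def HasWeakDivergence {N : ℕ} (Ω : Set (Euc N)) (A : Fin N → Euc N → ℝ) (D : Euc N → ℝ) : Prop :=
  LocallyIntegrableOn D Ω ∧ ∀ φ, IsTestFunction Ω φ →
    ∫ x in Ω, ∑ j, A j x * partialDeriv j φ x = - ∫ x in Ω, D x * φ x

/-! ### Functions of time with values in `L²` -/

/-- `f ∈ L²_loc((0, T]; L²(μ))`. -/
def IsL2Loc {N : ℕ} {μ : Measure (Euc N)} (T : ℝ) (f : ℝ → Lp ℝ 2 μ) : Prop :=
  ∀ δ ∈ Ioo 0 T, MemLp f 2 (volume.restrict (Ioc δ T))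

/-- `u ∈ W^{1,2}_loc((0, T]; L²(μ))` with time derivative `v`: `u` is the primitive of
`v ∈ L²_loc((0, T]; L²(μ))`. -/
def HasTimeDerivative {N : ℕ} {μ : Measure (Euc N)} (T : ℝ) (u v : ℝ → Lp ℝ 2 μ) : Prop :=
  IsL2Loc T u ∧ IsL2Loc T v ∧ ∀ s t, 0 < s → s ≤ t → t ≤ T → u t - u s = ∫ r in s..t, v r

/-- `u ∈ L²_loc((0, T]; H²(Ω))`, with first order weak derivatives `∂u/∂x_i = Du i`. -/
def HasGradientInH1 {N : ℕ} {Ω : Set (Euc N)} (T : ℝ) (u : ℝ → Lp ℝ 2 (bulkMeasure Ω))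
    (Du : Fin N → ℝ → Lp ℝ 2 (bulkMeasure Ω)) : Prop :=
  IsL2Loc T u ∧ (∀ i, IsL2Loc T (Du i)) ∧
  (∀ i, ∀ᵐ t ∂(volume.restrict (Ioo (0 : ℝ) T)), HasWeakPartial Ω i (u t) (Du i t)) ∧
  ∃ D2u : Fin N → Fin N → ℝ → Lp ℝ 2 (bulkMeasure Ω), ∀ i j, IsL2Loc T (D2u i j) ∧
    ∀ᵐ t ∂(volume.restrict (Ioo (0 : ℝ) T)), HasWeakPartial Ω j (Du i t) (D2u i j t)

/-! ### Coefficients, graphs, reaction terms -/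

/-- The conditions on the coefficients `a = (a_ij)`, functions on `(0, T) × closure Ω`:
`a_ij ∈ L^∞(Q_T)`; the restriction of `a_ij` to `Γ_T` is in `L^∞(Γ_T)`, and is the boundary
value of `a_ij`; and `λ |ξ|² ≤ ∑ a_ij ξ_i ξ_j` for some `λ ≥ 0`. -/
structure IsCoefficient {N : ℕ} (Ω : Set (Euc N)) (T : ℝ)
    (a : Fin N → Fin N → ℝ → Euc N → ℝ) : Prop where
  bounded : ∀ i j, MemLp (fun p : ℝ × Euc N => a i j p.1 p.2) ⊤
    ((volume.restrict (Ioo (0 : ℝ) T)).prod (bulkMeasure Ω))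
  bounded_boundary : ∀ i j, ∃ C : ℝ, AEOn T (surfaceMeasure Ω) fun t x => |a i j t x| ≤ C
  boundary_value : ∀ i j, ∀ᵐ t ∂(volume.restrict (Ioo (0 : ℝ) T)),
    HasBoundaryValue Ω (a i j t) (a i j t)
  elliptic : ∃ lam : ℝ, 0 ≤ lam ∧ AEOn T (bulkMeasure Ω) fun t x =>
    ∀ ξ : Euc N, lam * ‖ξ‖ ^ 2 ≤ ∑ i, ∑ j, a i j t x * ξ i * ξ j

/-- A multi-valued map `ℝ → 2^ℝ` is a monotone graph. -/
def IsMonotoneGraph (γ : ℝ → Set ℝ) : Prop :=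
  ∀ r₁ r₂, ∀ z₁ ∈ γ r₁, ∀ z₂ ∈ γ r₂, 0 ≤ (z₁ - z₂) * (r₁ - r₂)

/-- The effective domain `D(γ)`. -/
def graphDomain (γ : ℝ → Set ℝ) : Set ℝ := {r | (γ r).Nonempty}

/-- The supremum in `[-∞, +∞]` of a set of reals. -/
def eSup (S : Set ℝ) : EReal := sSup (Real.toEReal '' S)

/-- The infimum in `[-∞, +∞]` of a set of reals. -/
def eInf (S : Set ℝ) : EReal := sInf (Real.toEReal '' S)

/-- `sup γ₂(r₂) ≤ inf γ₁(r₁)` for all `r₁ ∈ D(γ₁)`, `r₂ ∈ D(γ₂)` with `r₁ > r₂`. -/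
def GraphsOrdered (γ₁ γ₂ : ℝ → Set ℝ) : Prop :=
  ∀ r₁ ∈ graphDomain γ₁, ∀ r₂ ∈ graphDomain γ₂, r₁ > r₂ → eSup (γ₂ r₂) ≤ eInf (γ₁ r₁)

/-- `r₁ ≤ r₂` for all `r₁ ∈ D(γ₁)` and `r₂ ∈ D(γ₂)`. -/
def DomainsOrdered (γ₁ γ₂ : ℝ → Set ℝ) : Prop :=
  ∀ r₁ ∈ graphDomain γ₁, ∀ r₂ ∈ graphDomain γ₂, r₁ ≤ r₂

/-- The `k`-th reaction term `F` is single-valued, `F(t, x, U) = {φ(t, x, U)}`, and satisfies the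
structure condition: `φ` is differentiable in `U` for almost all `U`, with `∂φ/∂u_j ≥ 0` for
`j ≠ k` (quasi-monotonicity), and it is Lipschitz continuous in `U` on each ball `|U| ≤ M`, with
a constant `L_M` that is independent of `(t, x)`. -/
def SingleValuedSC {N m : ℕ} (Ω : Set (Euc N)) (T : ℝ) (k : Fin m)
    (F : ℝ → Euc N → Euc m → Set ℝ) : Prop :=
  ∃ φ : ℝ → Euc N → Euc m → ℝ,
    (AEOn T (bulkMeasure Ω) fun t x => ∀ U, F t x U = {φ t x U}) ∧
    (AEOn T (bulkMeasure Ω) fun t x => ∀ᵐ U : Euc m,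
      DifferentiableAt ℝ (φ t x) U ∧ ∀ j, j ≠ k → 0 ≤ partialDeriv j (φ t x) U) ∧
    ∀ M : ℝ, 0 < M → ∃ L : ℝ≥0, AEOn T (bulkMeasure Ω) fun t x =>
      LipschitzOnWith L (φ t x) (Metric.closedBall 0 M)

/-! ### Sub- and super-solutions -/

/-- The system (P): coefficients `a^k_ij(t, x)`, graphs `β^k(t, x, ·)` and `γ^k(t, x, ·)`, reaction
terms `F^k(t, x, ·)` and initial data `a^k(x)`. -/
structure Problem (N m : ℕ) where
  coeff : Fin m → Fin N → Fin N → ℝ → Euc N → ℝ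
  β : Fin m → ℝ → Euc N → ℝ → Set ℝ
  γ : Fin m → ℝ → Euc N → ℝ → Set ℝ
  F : Fin m → ℝ → Euc N → Euc m → Set ℝ
  init : Fin m → Euc N → ℝ

/-- The standing assumptions on (P). -/
structure Problem.IsAdmissible {N m : ℕ} (P : Problem N m) (Ω : Set (Euc N)) (T : ℝ) : Prop where
  coeff : ∀ k, IsCoefficient Ω T (P.coeff k)
  β_mono : ∀ k, AEOn T (bulkMeasure Ω) fun t x => IsMonotoneGraph (P.β k t x)
  γ_mono : ∀ k, AEOn T (surfaceMeasure Ω) fun t x => IsMonotoneGraph (P.γ k t x)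

/-- Candidate solutions `U = (u^1, …, u^m)`: each `u^k` is a function of time with values
in `L²(Ω)`. -/
abbrev Field {N : ℕ} (Ω : Set (Euc N)) (m : ℕ) : Type := Fin m → ℝ → Lp ℝ 2 (bulkMeasure Ω)

/-- The vector `U(t, x)`. -/
def Field.val {N m : ℕ} {Ω : Set (Euc N)} (U : Field Ω m) (t : ℝ) (x : Euc N) : Euc m :=
  WithLp.toLp 2 fun k => U k t x

/-- The functions that come with the `k`-th component of a sub- or super-solution:
`ut = ∂u^k/∂t`, `Du i = ∂u^k/∂x_i`, `dv = ∑ ∂_j (a_ij ∂_i u^k)`, the sections `f`, `b`, `g`, and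
the boundary values `tr` of `u^k` and `trD i` of `∂u^k/∂x_i`. -/
structure ComponentData {N : ℕ} (Ω : Set (Euc N)) where
  ut : ℝ → Lp ℝ 2 (bulkMeasure Ω)
  Du : Fin N → ℝ → Lp ℝ 2 (bulkMeasure Ω)
  dv : ℝ → Euc N → ℝ
  f : ℝ → Lp ℝ 2 (bulkMeasure Ω)
  b : ℝ → Lp ℝ 2 (bulkMeasure Ω)
  g : ℝ → Lp ℝ 2 (surfaceMeasure Ω)
  tr : ℝ → Euc N → ℝ
  trD : Fin N → ℝ → Euc N → ℝ

/-- `∂u^k/∂t - ∑ ∂_j (a_ij ∂_i u^k) + b^k - f^k`. -/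
def ComponentData.residual {N : ℕ} {Ω : Set (Euc N)} (d : ComponentData Ω) (t : ℝ) (x : Euc N) :
    ℝ :=
  d.ut t x - d.dv t x + d.b t x - d.f t x

/-- The conormal derivative `∑ a_ij ν_j ∂_i u^k` on `∂Ω`. -/
def ComponentData.conormal {N : ℕ} {Ω : Set (Euc N)} (d : ComponentData Ω)
    (a : Fin N → Fin N → ℝ → Euc N → ℝ) (t : ℝ) (x : Euc N) : ℝ :=
  ∑ i, ∑ j, a i j t x * outerNormal Ω x j * d.trD i t x

/-- What sub- and super-solutions have in common: the regularity
`u^k ∈ C([0,T]; L²(Ω)) ∩ L^∞(0,T; L^∞(Ω)) ∩ W^{1,2}_loc((0,T]; L²(Ω)) ∩ L²_loc((0,T]; H²(Ω))`,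
the meaning of the functions in `d`, the inclusions for the sections, and the initial
condition. -/
structure IsComponent {N m : ℕ} (P : Problem N m) (Ω : Set (Euc N)) (T : ℝ) (U : Field Ω m)
    (k : Fin m) (d : ComponentData Ω) : Prop where
  continuous : ContinuousOn (U k) (Icc 0 T)
  bounded : ∃ M : ℝ, AEOn T (bulkMeasure Ω) fun t x => |U k t x| ≤ M
  time : HasTimeDerivative T (U k) d.ut
  space : HasGradientInH1 T (U k) d.Du
  divergence : ∀ᵐ t ∂(volume.restrict (Ioo (0 : ℝ) T)),
    HasWeakDivergence Ω (fun j x => ∑ i, P.coeff k i j t x * d.Du i t x) (d.dv t)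
  trace : ∀ᵐ t ∂(volume.restrict (Ioo (0 : ℝ) T)), HasBoundaryValue Ω (U k t) (d.tr t)
  trace_grad : ∀ i, ∀ᵐ t ∂(volume.restrict (Ioo (0 : ℝ) T)),
    HasBoundaryValue Ω (d.Du i t) (d.trD i t)
  f_loc : IsL2Loc T d.f
  b_loc : IsL2Loc T d.b
  g_loc : IsL2Loc T d.g
  f_mem : AEOn T (bulkMeasure Ω) fun t x => d.f t x ∈ P.F k t x (U.val t x)
  b_mem : AEOn T (bulkMeasure Ω) fun t x => d.b t x ∈ P.β k t x (U k t x)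
  g_mem : AEOn T (surfaceMeasure Ω) fun t x => d.g t x ∈ P.γ k t x (d.tr t x)
  initial : ∀ᵐ x ∂(bulkMeasure Ω), U k 0 x = P.init k x

/-- `U` is a sub-solution of (P) on `[0, T]`. -/
def IsSubSolution {N m : ℕ} (P : Problem N m) (Ω : Set (Euc N)) (T : ℝ) (U : Field Ω m) : Prop :=
  ∀ k, ∃ d : ComponentData Ω, IsComponent P Ω T U k d ∧
    (AEOn T (bulkMeasure Ω) fun t x => d.residual t x ≤ 0) ∧
    AEOn T (surfaceMeasure Ω) fun t x => -d.conormal (P.coeff k) t x ≥ d.g t x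

/-- `U` is a super-solution of (P) on `[0, T]`. -/
def IsSuperSolution {N m : ℕ} (P : Problem N m) (Ω : Set (Euc N)) (T : ℝ) (U : Field Ω m) : Prop :=
  ∀ k, ∃ d : ComponentData Ω, IsComponent P Ω T U k d ∧
    (AEOn T (bulkMeasure Ω) fun t x => d.residual t x ≥ 0) ∧
    AEOn T (surfaceMeasure Ω) fun t x => -d.conormal (P.coeff k) t x ≤ d.g t x

end ParabolicSystem

end

open ParabolicSystem

noncomputable section

namespace ParabolicSystem

open scoped ENNReal

/-! ### The nearest boundary point -/

/-! Put w^k = u_1^k - u_2^k, subtract the two differential inequalities and test with the positive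
part of w^k. The gradient term is non-negative because the form ∑ a_pq ξ_p ξ_q is (λ = 0 suffices).
The β term has the right sign by monotonicity or by (A2), and the boundary term by (A3). What
remains is ½ d/dt ‖(w^k)⁺‖² ≤ ∫ (f_1 - f_2) (w^k)⁺. Let φ be the single-valued one of the two
reaction terms; the ordering (A4)(i) gives f_1 - f_2 ≤ φ(U_1) - φ(U_2). Raising U_1 to the
componentwise maximum of U_1 and U_2 leaves the k-th component unchanged where w^k ≥ 0 and does not
decrease φ, so the local Lipschitz bound yields f_1 - f_2 ≤ L ∑_j (w^j)⁺ there
(`sub_le_of_quasiMonotone`). Summation over k and Gronwall's lemma, with initial value 0 by (A1),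
give (w^k)⁺ = 0. Time regularity holds on (0, T] only, so the estimate is integrated from s > 0 and
continuity in L² permits s → 0.

The substance is the boundary term. The divergence is known only against test functions supported in
Ω, the coefficients are merely bounded and measurable, and boundary values are limits of averages
over thin layers, so Green's formula is not available. It is replaced by a limit. Let d be the
distance to the complement of Ω, and let ζ_ε be a smooth step in d/ε. The functions Ψ(w) χ ζ_ε, with
χ smooth of compact support and Ψ a smooth non-decreasing approximation of the positive part, are
admissible after mollification (`weak_inequality_comp`). The gradient of ζ_ε is of size 1/ε, lives
in the boundary layer and is a non-negative multiple of ∇d, which equals -ν(π(y)) almost everywhere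
(`gradient_infDist_compl_eq_neg_outerNormal`). Replacing Ψ(w), a and ∇w by their boundary values at
π(y) costs an error that tends to 0 in layer average (`tendsto_eLpNorm_flux`), and the resulting
product has a sign by the boundary condition (`boundary_term_ge`).

To transfer almost-everywhere statements from ∂Ω to the layer, the image of Lebesgue measure on the
layer under π must be bounded locally by C ε σ. Only this upper bound is needed, and it follows from
covering tubes by balls and comparing with Hausdorff measure (`volume_tube_le`,
`layerMeasure_le_locally`). Then ε → 0, χ → 1 and Ψ(s) → s⁺, in this order. -/

theorem frontier_subset_compl {X : Type*} [TopologicalSpace X] {s : Set X} (hs : IsOpen s) :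
    frontier s ⊆ sᶜ := by
  rw [hs.frontier_eq]
  exact fun x hx => hx.2

/-- A point of the complement nearest to an interior point lies on the frontier. The definitions use
the frontier, but the distance to the complement is better suited to cutoffs: it vanishes off Ω. -/
theorem infDist_compl_eq_infDist_frontier {N : ℕ} {Ω : Set (Euc N)} (hΩ : IsOpen Ω)
    (hne : Ω ≠ univ) {y : Euc N} (hy : y ∈ Ω) :
    Metric.infDist y Ωᶜ = Metric.infDist y (frontier Ω) := by
  obtain ⟨z, hz, hd⟩ := exists_mem_frontier_infDist_compl_eq_dist hy hne
  refine le_antisymm (Metric.infDist_le_infDist_of_subset (frontier_subset_compl hΩ) ⟨z, hz⟩) ?_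
  rw [hd]
  exact Metric.infDist_le_dist_of_mem hz

theorem nearestBoundaryPoint_spec {N : ℕ} {Ω : Set (Euc N)} (hne : (frontier Ω).Nonempty)
    (y : Euc N) : nearestBoundaryPoint Ω y ∈ frontier Ω ∧
      dist y (nearestBoundaryPoint Ω y) = Metric.infDist y (frontier Ω) := by
  have h : ∃ x ∈ frontier Ω, dist y x = Metric.infDist y (frontier Ω) := by
    obtain ⟨x, hx, h⟩ := isClosed_frontier.exists_infDist_eq_dist hne y
    exact ⟨x, hx, h.symm⟩
  unfold nearestBoundaryPoint
  rw [dif_pos h]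
  exact h.choose_spec

theorem IsDefiningFunctionAt.eventually_iff {N : ℕ} {Ω : Set (Euc N)} {x : Euc N} {ρ : Euc N → ℝ}
    (h : IsDefiningFunctionAt Ω x ρ) : ∀ᶠ z in 𝓝 x, z ∈ Ω ↔ ρ z < 0 := by
  obtain ⟨V, hV, hΩV⟩ := h.2.2.2
  filter_upwards [hV] with z hz
  have := Set.ext_iff.1 hΩV z
  simpa [hz] using this

theorem IsDefiningFunctionAt.hasGradientAt {N : ℕ} {Ω : Set (Euc N)} {x : Euc N} {ρ : Euc N → ℝ}
    (h : IsDefiningFunctionAt Ω x ρ) (z : Euc N) : HasGradientAt ρ (gradient ρ z) z :=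
  (h.1.differentiable (by simp)).differentiableAt.hasGradientAt

/-- A defining function at `x` is a defining function at all boundary points close to `x`. -/
theorem IsDefiningFunctionAt.eventually {N : ℕ} {Ω : Set (Euc N)} (hΩ : IsOpen Ω) {x : Euc N}
    {ρ : Euc N → ℝ} (h : IsDefiningFunctionAt Ω x ρ) :
    ∀ᶠ z in 𝓝 x, z ∈ frontier Ω → IsDefiningFunctionAt Ω z ρ := by
  have hcont : Continuous (gradient ρ) := by
    have h1 : Continuous (fderiv ℝ ρ) := h.1.continuous_fderiv (by simp)
    exact (InnerProductSpace.toDual ℝ (Euc N)).symm.continuous.comp h1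
  have h1 : ∀ᶠ z in 𝓝 x, gradient ρ z ≠ 0 := hcont.continuousAt.eventually_ne h.2.2.1
  obtain ⟨V, hV, hΩV⟩ := h.2.2.2
  filter_upwards [h1, eventually_mem_nhds_iff.2 hV, h.eventually_iff.eventually_nhds]
    with z hz hzV hev hzf
  refine ⟨h.1, ?_, hz, V, hzV, hΩV⟩
  -- ρ z > 0 would persist near z, although z is a limit of points of Ω, where ρ < 0; ρ z < 0 would
  -- put z into the open set Ω.
  apply le_antisymm
  · have hzc : z ∈ closure Ω := frontier_subset_closure hzf
    by_contra hpos
    push Not at hpos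
    have h2 : ∀ᶠ y in 𝓝 z, 0 < ρ y := h.1.continuous.continuousAt.eventually (lt_mem_nhds hpos)
    obtain ⟨y, hy, hy2⟩ := ((mem_closure_iff_frequently.1 hzc).and_eventually (h2.and hev)).exists
    exact absurd (hy2.2.1 hy) (not_lt.2 hy2.1.le)
  · have hzn : z ∉ Ω := frontier_subset_compl hΩ hzf
    rw [hev.self_of_nhds] at hzn
    exact not_lt.1 hzn

/-- Two non-zero vectors such that no vector has positive inner product with both are opposite. -/
theorem opposite_of_forall_inner {E : Type*} [NormedAddCommGroup E] [InnerProductSpace ℝ E]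
    {e g : E} (he : e ≠ 0) (hg : g ≠ 0)
    (h : ∀ v : E, 0 < inner ℝ v e → inner ℝ g v ≤ 0) : ‖g‖⁻¹ • g = -(‖e‖⁻¹ • e) := by
  have hen : 0 < ‖e‖ := norm_pos_iff.2 he
  have hgn : 0 < ‖g‖ := norm_pos_iff.2 hg
  set e' := ‖e‖⁻¹ • e with he'
  set g' := ‖g‖⁻¹ • g with hg'
  have he1 : ‖e'‖ = 1 := norm_smul_inv_norm he
  have hg1 : ‖g'‖ = 1 := norm_smul_inv_norm hg
  have hee : e = ‖e‖ • e' := by rw [he', smul_smul, mul_inv_cancel₀ hen.ne', one_smul]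
  have hgg : g = ‖g‖ • g' := by rw [hg', smul_smul, mul_inv_cancel₀ hgn.ne', one_smul]
  -- If two unit vectors are not opposite, their sum has positive inner product with both,
  -- contradicting `h`.
  have hc : inner ℝ g' e' ≤ -1 := by
    by_contra hlt
    push Not at hlt
    have h1 : 0 < inner ℝ (g' + e') e := by
      rw [hee, inner_smul_right, inner_add_left, real_inner_self_eq_norm_sq, he1]
      exact mul_pos hen (by linarith)
    have h2 := h _ h1
    rw [hgg, inner_smul_left, inner_add_right, real_inner_self_eq_norm_sq, hg1] at h2
    have : 0 < ‖g‖ * (1 ^ 2 + inner ℝ g' e') := mul_pos hgn (by linarith)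
    exact absurd h2 (not_le.2 this)
  have h3 : ‖g' + e'‖ ^ 2 ≤ 0 := by
    rw [norm_add_sq_real, he1, hg1]; linarith
  have h4 : ‖g' + e'‖ = 0 := by nlinarith [norm_nonneg (g' + e')]
  exact eq_neg_of_add_eq_zero_left (norm_eq_zero.1 h4)

theorem ball_infDist_compl_subset {N : ℕ} {Ω : Set (Euc N)} {y p : Euc N}
    (h : dist y p = Metric.infDist y Ωᶜ) : Metric.ball y (dist y p) ⊆ Ω := by
  rw [h]; exact Metric.ball_infDist_compl_subset

/-- The vector from a nearest boundary point to an interior point is normal to the boundary. -/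
theorem IsDefiningFunctionAt.unit_gradient_eq {N : ℕ} {Ω : Set (Euc N)} (hΩ : IsOpen Ω)
    {y p : Euc N} (hy : y ∈ Ω) (hp : p ∈ frontier Ω) (h : dist y p = Metric.infDist y Ωᶜ)
    {ρ : Euc N → ℝ} (hρ : IsDefiningFunctionAt Ω p ρ) :
    ‖gradient ρ p‖⁻¹ • gradient ρ p = -(‖y - p‖⁻¹ • (y - p)) := by
  have hne : y - p ≠ 0 := by
    intro h0
    rw [sub_eq_zero] at h0
    exact frontier_subset_compl hΩ hp (h0 ▸ hy)
  apply opposite_of_forall_inner hne hρ.2.2.1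
  intro v hv
  have hv0 : v ≠ 0 := by rintro rfl; simp at hv
  have hvn : 0 < ‖v‖ ^ 2 := by positivity
  have hsub := ball_infDist_compl_subset h
  -- The squared distance of p + s v to y is ‖y - p‖² - 2 s ⟨v, y - p⟩ + s² ‖v‖², so for small s > 0
  -- the point enters the ball about y that lies in Ω. There ρ < 0 = ρ(p), and the derivative of ρ
  -- in direction v is at most 0.
  have hmem : ∀ᶠ s in 𝓝[>] (0 : ℝ), p + s • v ∈ Ω := by
    have : ∀ᶠ s in 𝓝[>] (0 : ℝ), s < 2 * inner ℝ v (y - p) / ‖v‖ ^ 2 :=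
      nhdsWithin_le_nhds (Iio_mem_nhds (by positivity))
    filter_upwards [this, self_mem_nhdsWithin] with s hs hs0
    apply hsub
    rw [Metric.mem_ball, dist_comm, dist_eq_norm, dist_eq_norm]
    have hs0' : (0 : ℝ) < s := hs0
    rw [lt_div_iff₀ hvn] at hs
    have : ‖y - (p + s • v)‖ ^ 2 < ‖y - p‖ ^ 2 := by
      rw [show y - (p + s • v) = (y - p) - s • v by abel, norm_sub_sq_real, inner_smul_right,
        norm_smul, mul_pow, real_inner_comm, Real.norm_eq_abs, sq_abs]
      nlinarith
    exact lt_of_pow_lt_pow_left₀ 2 (norm_nonneg _) this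
  have htend : Tendsto (fun s : ℝ => p + s • v) (𝓝[>] 0) (𝓝 p) := by
    have : Continuous fun s : ℝ => p + s • v := by fun_prop
    simpa using (this.tendsto 0).mono_left nhdsWithin_le_nhds
  have hneg : ∀ᶠ s in 𝓝[>] (0 : ℝ), ρ (p + s • v) < 0 := by
    filter_upwards [hmem, htend.eventually hρ.eventually_iff] with s h1 h2
    exact h2.1 h1
  have hder : HasDerivAt (fun s : ℝ => ρ (p + s • v)) (inner ℝ (gradient ρ p) v) 0 := by
    have h1 := (hρ.hasGradientAt p).hasFDerivAt
    have h2 : HasDerivAt (fun s : ℝ => p + s • v) v 0 := by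
      simpa using ((hasDerivAt_id (0 : ℝ)).smul_const v).const_add p
    have h3 : HasFDerivAt ρ ((InnerProductSpace.toDual ℝ (Euc N)) (gradient ρ p))
        (p + (0 : ℝ) • v) := by simpa using h1
    exact (h3.comp_hasDerivAt (0 : ℝ) h2).congr_deriv (by rw [InnerProductSpace.toDual_apply_apply])
  have hslope := hder.hasDerivWithinAt (s := Ioi 0)
  rw [hasDerivWithinAt_iff_tendsto_slope' (by simp)] at hslope
  refine le_of_tendsto hslope ?_
  filter_upwards [hneg, self_mem_nhdsWithin] with s h1 h2
  have h2' : (0 : ℝ) < s := h2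
  rw [slope_def_field]
  simp only [zero_smul, add_zero, hρ.2.1, sub_zero]
  exact div_nonpos_of_nonpos_of_nonneg h1.le h2'.le

theorem exists_isOuterNormalAt {N : ℕ} {Ω : Set (Euc N)} (hΩ : IsSmoothDomain Ω) {p : Euc N}
    (hp : p ∈ frontier Ω) : IsOuterNormalAt Ω p (outerNormal Ω p) := by
  have h : ∃ n, IsOuterNormalAt Ω p n := by
    obtain ⟨ρ, hρ⟩ := hΩ.2.2 p hp
    exact ⟨_, ρ, hρ, rfl⟩
  unfold outerNormal
  rw [dif_pos h]
  exact h.choose_spec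

/-- If the distance to the complement is differentiable at `y ∈ Ω`, its gradient is the unit vector
pointing away from the nearest boundary point. -/
theorem gradient_infDist_compl {N : ℕ} {Ω : Set (Euc N)} (hΩ : IsOpen Ω)
    {y p : Euc N} (hy : y ∈ Ω) (hp : p ∈ frontier Ω) (h : dist y p = Metric.infDist y Ωᶜ)
    (hd : DifferentiableAt ℝ (fun z => Metric.infDist z Ωᶜ) y) :
    gradient (fun z => Metric.infDist z Ωᶜ) y = ‖y - p‖⁻¹ • (y - p) := by
  set g := gradient (fun z => Metric.infDist z Ωᶜ) y with hg
  have hpc : p ∈ Ωᶜ := frontier_subset_compl hΩ hp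
  have hne : y - p ≠ 0 := by
    intro h0
    rw [sub_eq_zero] at h0
    exact hpc (h0 ▸ hy)
  have hyp : 0 < ‖y - p‖ := norm_pos_iff.2 hne
  set e := ‖y - p‖⁻¹ • (y - p) with he
  have he1 : ‖e‖ = 1 := norm_smul_inv_norm hne
  have hye : y - p = ‖y - p‖ • e := by rw [he, smul_smul, mul_inv_cancel₀ hyp.ne', one_smul]
  have hgrad : HasGradientAt (fun z => Metric.infDist z Ωᶜ) g y := hd.hasGradientAt
  have hg1 : ‖g‖ ≤ 1 := by
    have h1 := norm_fderiv_le_of_lipschitz ℝ (x₀ := y) (Metric.lipschitz_infDist_pt Ωᶜ)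
    have h2 : ‖g‖ = ‖fderiv ℝ (fun z => Metric.infDist z Ωᶜ) y‖ := by
      rw [hg, gradient]; exact LinearIsometryEquiv.norm_map _ _
    rw [h2]; simpa using h1
  have hder : HasDerivAt (fun s : ℝ => Metric.infDist (y - s • e) Ωᶜ) (-inner ℝ g e) 0 := by
    have h2 : HasDerivAt (fun s : ℝ => y - s • e) (-e) 0 := by
      simpa using ((hasDerivAt_id (0 : ℝ)).smul_const e).const_sub y
    have h3 : HasFDerivAt (fun z => Metric.infDist z Ωᶜ) ((InnerProductSpace.toDual ℝ (Euc N)) g)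
        (y - (0 : ℝ) • e) := by simpa using hgrad.hasFDerivAt
    exact (h3.comp_hasDerivAt (0 : ℝ) h2).congr_deriv (by rw [InnerProductSpace.toDual_apply_apply, inner_neg_right])
  have hslope := hder.hasDerivWithinAt (s := Ioi 0)
  rw [hasDerivWithinAt_iff_tendsto_slope' (by simp)] at hslope
  -- Moving from y straight towards p lowers the distance at unit rate. Hence ⟨g, e⟩ ≥ 1, and since
  -- ‖g‖ ≤ 1 = ‖e‖ this is equality in Cauchy–Schwarz, so g = e.
  have hle : -inner ℝ g e ≤ -1 := by
    refine le_of_tendsto hslope ?_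
    have : ∀ᶠ s in 𝓝[>] (0 : ℝ), s < ‖y - p‖ := nhdsWithin_le_nhds (Iio_mem_nhds hyp)
    filter_upwards [this, self_mem_nhdsWithin] with s h1 h2
    have h2' : (0 : ℝ) < s := h2
    rw [slope_def_field]
    simp only [zero_smul, sub_zero]
    rw [div_le_iff₀ h2', ← h, dist_eq_norm]
    have h3 : Metric.infDist (y - s • e) Ωᶜ ≤ ‖y - p‖ - s := by
      refine (Metric.infDist_le_dist_of_mem hpc).trans ?_
      rw [dist_eq_norm, show y - s • e - p = (‖y - p‖ - s) • e by
        rw [sub_smul, ← hye]; abel, norm_smul, he1, mul_one, Real.norm_of_nonneg (by linarith)]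
    linarith
  have h3 : ‖g - e‖ ^ 2 ≤ 0 := by
    rw [norm_sub_sq_real, he1]
    nlinarith [norm_nonneg g]
  have h4 : ‖g - e‖ = 0 := by nlinarith [norm_nonneg (g - e)]
  exact sub_eq_zero.1 (norm_eq_zero.1 h4)

theorem dist_nearestBoundaryPoint {N : ℕ} {Ω : Set (Euc N)} (hΩ : IsOpen Ω) (hne : Ω ≠ univ)
    {y : Euc N} (hy : y ∈ Ω) : nearestBoundaryPoint Ω y ∈ frontier Ω ∧
      dist y (nearestBoundaryPoint Ω y) = Metric.infDist y Ωᶜ := by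
  obtain ⟨z, hz, -⟩ := exists_mem_frontier_infDist_compl_eq_dist hy hne
  rw [infDist_compl_eq_infDist_frontier hΩ hne hy]
  exact nearestBoundaryPoint_spec ⟨z, hz⟩ y

/-- `outerNormal` rests on an arbitrary choice of defining function. At a nearest point
`unit_gradient_eq` determines the unit gradient of every defining function, so independence of the
choice needs no separate argument. -/
theorem gradient_infDist_compl_eq_neg_outerNormal {N : ℕ} {Ω : Set (Euc N)}
    (hΩ : IsSmoothDomain Ω) (hne : Ω ≠ univ) {y : Euc N} (hy : y ∈ Ω)
    (hd : DifferentiableAt ℝ (fun z => Metric.infDist z Ωᶜ) y) :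
    gradient (fun z => Metric.infDist z Ωᶜ) y = -outerNormal Ω (nearestBoundaryPoint Ω y) := by
  obtain ⟨hp, h⟩ := dist_nearestBoundaryPoint hΩ.1 hne hy
  obtain ⟨ρ, hρ, hn⟩ := exists_isOuterNormalAt hΩ hp
  rw [hn, hρ.unit_gradient_eq hΩ.1 hy hp h, neg_neg, gradient_infDist_compl hΩ.1 hy hp h hd]

theorem partialDeriv_infDist_compl {N : ℕ} {Ω : Set (Euc N)}
    (hΩ : IsSmoothDomain Ω) (hne : Ω ≠ univ) {y : Euc N} (hy : y ∈ Ω)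
    (hd : DifferentiableAt ℝ (fun z => Metric.infDist z Ωᶜ) y) (j : Fin N) :
    partialDeriv j (fun z => Metric.infDist z Ωᶜ) y =
      -outerNormal Ω (nearestBoundaryPoint Ω y) j := by
  have h := gradient_infDist_compl_eq_neg_outerNormal hΩ hne hy hd
  have h2 := hd.hasGradientAt.hasFDerivAt.fderiv
  rw [partialDeriv, h2, h]
  simp [EuclideanSpace.inner_single_right]

theorem ae_differentiableAt_infDist {N : ℕ} (s : Set (Euc N)) :
    ∀ᵐ y : Euc N, DifferentiableAt ℝ (fun z => Metric.infDist z s) y :=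
  (Metric.lipschitz_infDist_pt s).ae_differentiableAt

/-- Where the distance is differentiable, its gradient determines the nearest point. By Rademacher's
theorem the chosen projection therefore agrees almost everywhere in Ω with a measurable formula. -/
theorem nearestBoundaryPoint_eq {N : ℕ} {Ω : Set (Euc N)} (hΩ : IsOpen Ω) (hne : Ω ≠ univ)
    {y : Euc N} (hy : y ∈ Ω) (hd : DifferentiableAt ℝ (fun z => Metric.infDist z Ωᶜ) y) :
    nearestBoundaryPoint Ω y = y - Metric.infDist y Ωᶜ •
      gradient (fun z => Metric.infDist z Ωᶜ) y := by
  obtain ⟨hp, h⟩ := dist_nearestBoundaryPoint hΩ hne hy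
  have hyp : ‖y - nearestBoundaryPoint Ω y‖ ≠ 0 := by
    rw [norm_ne_zero_iff]
    intro h0
    rw [sub_eq_zero] at h0
    exact frontier_subset_compl hΩ hp (h0 ▸ hy)
  rw [gradient_infDist_compl hΩ hy hp h hd, ← h, dist_eq_norm, smul_smul, mul_inv_cancel₀ hyp,
    one_smul, sub_sub_cancel]

theorem measurable_gradient {N : ℕ} (f : Euc N → ℝ) : Measurable (gradient f) :=
  (InnerProductSpace.toDual ℝ (Euc N)).symm.continuous.measurable.comp (measurable_fderiv ℝ f)

theorem aemeasurable_nearestBoundaryPoint {N : ℕ} {Ω : Set (Euc N)} (hΩ : IsOpen Ω)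
    (hne : Ω ≠ univ) : AEMeasurable (nearestBoundaryPoint Ω) (volume.restrict Ω) := by
  refine ⟨fun y => y - Metric.infDist y Ωᶜ • gradient (fun z => Metric.infDist z Ωᶜ) y, ?_, ?_⟩
  · exact measurable_id.sub (measurable_infDist.smul (measurable_gradient _))
  · filter_upwards [ae_restrict_of_ae (ae_differentiableAt_infDist Ωᶜ),
      ae_restrict_mem hΩ.measurableSet] with y h1 h2
    exact nearestBoundaryPoint_eq hΩ hne h2 h1

/-! ### Volume of boundary layers and surface measure -/

/-- The part of `Ω` at distance less than `ε` from the boundary. -/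
def boundaryLayer {N : ℕ} (Ω : Set (Euc N)) (ε : ℝ) : Set (Euc N) :=
  Ω ∩ Metric.thickening ε (frontier Ω)

/-- The volume of a tube of length `ε` over a set of diameter at most `δ`. -/
theorem volume_tube_le {N : ℕ} (hN : 1 ≤ N) (K : ℝ≥0) : ∃ C : ℝ, 0 ≤ C ∧
    ∀ (n : Euc N → Euc N) (s : Set (Euc N)), LipschitzOnWith K n s → (∀ x ∈ s, ‖n x‖ ≤ 1) →
    ∀ ε δ : ℝ, 0 < ε → ε ≤ 1 → 0 < δ → (∀ x ∈ s, ∀ y ∈ s, dist x y ≤ δ) →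
    volume {y : Euc N | ∃ x ∈ s, ∃ r, 0 ≤ r ∧ r < ε ∧ y = x - r • n x} ≤
      ENNReal.ofReal (C * (ε + δ) * δ ^ (N - 1)) := by
  set V := (volume (Metric.ball (0 : Euc N) 1)).toReal with hV
  have hV0 : 0 ≤ V := ENNReal.toReal_nonneg
  -- At most ε/δ + 1 balls of radius (2 + K) δ cover the tube; their total volume is at most (ε/δ +
  -- 1) ((2 + K) δ)^N V.
  refine ⟨(2 + K) ^ N * V, by positivity, ?_⟩
  intro n s hn hn1 ε δ hε hε1 hδ hs
  rcases s.eq_empty_or_nonempty with rfl | ⟨x₀, hx₀⟩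
  · simp
  set m := ⌊ε / δ⌋₊ with hm
  -- The centres are spaced by δ along one segment, the one issuing from x₀. The radius adds three
  -- errors: δ for the base point, K δ for the change of direction (r ≤ 1), and δ for rounding r
  -- down to a multiple of δ.
  have hsub : {y : Euc N | ∃ x ∈ s, ∃ r, 0 ≤ r ∧ r < ε ∧ y = x - r • n x} ⊆
      ⋃ j ∈ Finset.range (m + 1), Metric.closedBall (x₀ - (j * δ) • n x₀) ((2 + K) * δ) := by
    rintro y ⟨x, hx, r, hr0, hrε, rfl⟩
    simp only [mem_iUnion, Finset.mem_range, exists_prop]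
    refine ⟨⌊r / δ⌋₊, Nat.lt_succ_of_le (Nat.floor_mono (by gcongr)), ?_⟩
    set j := ⌊r / δ⌋₊
    have h1 : (j : ℝ) * δ ≤ r := by
      have := Nat.floor_le (a := r / δ) (by positivity)
      rwa [le_div_iff₀ hδ] at this
    have h2 : r < (j + 1 : ℝ) * δ := by
      have := Nat.lt_floor_add_one (r / δ)
      rwa [div_lt_iff₀ hδ] at this
    rw [Metric.mem_closedBall, dist_eq_norm]
    have e : x - r • n x - (x₀ - (j * δ) • n x₀) =
        (x - x₀) - r • (n x - n x₀) - (r - j * δ) • n x₀ := by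
      module
    have h3 : ‖x - x₀‖ ≤ δ := by rw [← dist_eq_norm]; exact hs x hx x₀ hx₀
    have h4 : ‖n x - n x₀‖ ≤ K * δ := by
      rw [← dist_eq_norm]
      exact (hn.dist_le_mul x hx x₀ hx₀).trans (by gcongr; rw [dist_eq_norm]; exact h3)
    rw [e]
    calc _ ≤ ‖x - x₀‖ + ‖r • (n x - n x₀)‖ + ‖(r - j * δ) • n x₀‖ :=
          (norm_sub_le _ _).trans (by gcongr; exact norm_sub_le _ _)
      _ ≤ δ + 1 * (K * δ) + δ * 1 := by
          rw [norm_smul, norm_smul, Real.norm_of_nonneg hr0, Real.norm_of_nonneg (by linarith)]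
          gcongr
          · linarith
          · linarith
          · exact hn1 x₀ hx₀
      _ = (2 + K) * δ := by ring
  have hvol : ∀ c : Euc N, volume (Metric.closedBall c ((2 + K) * δ)) =
      ENNReal.ofReal (((2 + K) * δ) ^ N * V) := by
    intro c
    rw [Measure.addHaar_closedBall _ _ (by positivity), finrank_euclideanSpace_fin,
      ENNReal.ofReal_mul (by positivity), hV,
      ENNReal.ofReal_toReal Metric.isBounded_ball.measure_lt_top.ne]
  calc _ ≤ volume (⋃ j ∈ Finset.range (m + 1),
        Metric.closedBall (x₀ - ((j : ℝ) * δ) • n x₀) ((2 + K) * δ)) := measure_mono hsub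
    _ ≤ ∑ j ∈ Finset.range (m + 1),
        volume (Metric.closedBall (x₀ - ((j : ℝ) * δ) • n x₀) ((2 + K) * δ)) :=
        measure_biUnion_finset_le _ _
    _ = ENNReal.ofReal ((m + 1) * (((2 + K) * δ) ^ N * V)) := by
        simp only [hvol, Finset.sum_const, Finset.card_range, nsmul_eq_mul]
        rw [← ENNReal.ofReal_natCast, ← ENNReal.ofReal_mul (by positivity), Nat.cast_succ]
    _ ≤ _ := by
        apply ENNReal.ofReal_le_ofReal
        have h1 : (m : ℝ) * δ ≤ ε := by
          have := Nat.floor_le (a := ε / δ) (by positivity)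
          rwa [le_div_iff₀ hδ] at this
        obtain ⟨k, rfl⟩ : ∃ k, N = k + 1 := ⟨N - 1, by omega⟩
        calc (m + 1) * (((2 + K) * δ) ^ (k + 1) * V)
            = (2 + K) ^ (k + 1) * V * (m * δ + δ) * δ ^ k := by rw [mul_pow]; ring
          _ ≤ (2 + K) ^ (k + 1) * V * (ε + δ) * δ ^ k := by gcongr
          _ = _ := by simp

theorem exists_lipschitzOnWith_unit_gradient {N : ℕ} {Ω : Set (Euc N)} {x : Euc N}
    {ρ : Euc N → ℝ} (h : IsDefiningFunctionAt Ω x ρ) :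
    ∃ K : ℝ≥0, ∃ t ∈ 𝓝 x, LipschitzOnWith K (fun z => ‖gradient ρ z‖⁻¹ • gradient ρ z) t := by
  refine ContDiffAt.exists_lipschitzOnWith (𝕂 := ℝ) ?_
  have h1 : ContDiff ℝ 1 (gradient ρ) := by
    have : ContDiff ℝ 1 (fderiv ℝ ρ) := h.1.fderiv_right (by norm_cast)
    exact (InnerProductSpace.toDual ℝ (Euc N)).symm.contDiff.comp this
  have h2 : ContDiffAt ℝ 1 (fun z => ‖gradient ρ z‖) x := h1.contDiffAt.norm ℝ h.2.2.1
  exact (h2.inv (norm_ne_zero_iff.2 h.2.2.1)).smul h1.contDiffAt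

theorem measurableSet_boundaryLayer {N : ℕ} {Ω : Set (Euc N)} (hΩ : IsOpen Ω) (ε : ℝ) :
    MeasurableSet (boundaryLayer Ω ε) :=
  hΩ.measurableSet.inter Metric.isOpen_thickening.measurableSet

theorem mem_boundaryLayer {N : ℕ} {Ω : Set (Euc N)} (hΩ : IsOpen Ω) (hne : Ω ≠ univ) {ε : ℝ}
    {y : Euc N} : y ∈ boundaryLayer Ω ε ↔ y ∈ Ω ∧ Metric.infDist y Ωᶜ < ε := by
  unfold boundaryLayer
  rw [mem_inter_iff]
  refine and_congr_right fun hy => ?_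
  obtain ⟨z, hz, -⟩ := exists_mem_frontier_infDist_compl_eq_dist hy hne
  rw [infDist_compl_eq_infDist_frontier hΩ hne hy, Metric.mem_thickening_iff_infDist_lt ⟨z, hz⟩]

/-- The image of Lebesgue measure on a boundary layer under the nearest point projection. -/
def layerMeasure {N : ℕ} (Ω : Set (Euc N)) (ε : ℝ) : Measure (Euc N) :=
  (volume.restrict (boundaryLayer Ω ε)).map (nearestBoundaryPoint Ω)

theorem aemeasurable_nearestBoundaryPoint_layer {N : ℕ} {Ω : Set (Euc N)} (hΩ : IsOpen Ω)
    (hne : Ω ≠ univ) (ε : ℝ) :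
    AEMeasurable (nearestBoundaryPoint Ω) (volume.restrict (boundaryLayer Ω ε)) :=
  (aemeasurable_nearestBoundaryPoint hΩ hne).mono_measure
    (Measure.restrict_mono inter_subset_left le_rfl)

/-- Points of the layer projecting into s lie in the tube of length ε over s in direction of the
inner normal. If s has diameter δ ≤ ε, its volume is at most C (ε + δ) δ^(N-1) ≤ 2 C ε δ^(N-1). A
measure bounded by the (N-1)-th power of the diameter on all small sets is dominated by Hausdorff
measure. -/
theorem layerMeasure_le_locally {N : ℕ} (hN : 1 ≤ N) {Ω : Set (Euc N)} (hΩ : IsSmoothDomain Ω)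
    (hne : Ω ≠ univ) {x : Euc N} (hx : x ∈ frontier Ω) : ∃ t ∈ 𝓝 x, ∃ C : ℝ≥0,
    ∀ ε ∈ Ioc (0 : ℝ) 1, (layerMeasure Ω ε).restrict t ≤
      (C * ENNReal.ofReal ε) • (μH[(N - 1 : ℕ)] : Measure (Euc N)) := by
  obtain ⟨ρ, hρ⟩ := hΩ.2.2 x hx
  obtain ⟨K, t₁, ht₁, hK⟩ := exists_lipschitzOnWith_unit_gradient hρ
  obtain ⟨t, htsub, hto, hxt⟩ := mem_nhds_iff.1 (inter_mem ht₁ (hρ.eventually hΩ.1))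
  obtain ⟨C, hC0, hC⟩ := volume_tube_le hN K
  refine ⟨t, hto.mem_nhds hxt, (2 * (C + 1)).toNNReal, ?_⟩
  intro ε hε
  set n : Euc N → Euc N := fun z => ‖gradient ρ z‖⁻¹ • gradient ρ z with hn
  have hn1 : ∀ z, ‖n z‖ ≤ 1 := by
    intro z
    rw [hn]; simp only [norm_smul, norm_inv, norm_norm]
    exact inv_mul_le_one
  set μ := (layerMeasure Ω ε).restrict t with hμ
  have tube : ∀ s : Set (Euc N), ∀ δ : ℝ, 0 < δ → (∀ x ∈ s, ∀ y ∈ s, dist x y ≤ δ) →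
      MeasurableSet s → μ s ≤ ENNReal.ofReal (C * (ε + δ) * δ ^ (N - 1)) := by
    intro s δ hδ hs hms
    rw [hμ, Measure.restrict_apply hms, layerMeasure,
      Measure.map_apply_of_aemeasurable (aemeasurable_nearestBoundaryPoint_layer hΩ.1 hne ε)
        (hms.inter hto.measurableSet)]
    rw [Measure.restrict_apply' (measurableSet_boundaryLayer hΩ.1 ε)]
    refine (measure_mono ?_).trans
      (hC n (s ∩ t) (hK.mono fun z hz => (htsub hz.2).1) (fun z _ => hn1 z) ε δ hε.1 hε.2 hδ
        fun a ha b hb => hs a ha.1 b hb.1)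
    rintro y ⟨hy, hyl⟩
    rw [mem_boundaryLayer hΩ.1 hne] at hyl
    obtain ⟨hp, hd⟩ := dist_nearestBoundaryPoint hΩ.1 hne hyl.1
    set p := nearestBoundaryPoint Ω y with hpdef
    have hy' : p ∈ s ∩ t := hy
    have hnp := ((htsub hy'.2).2 hp).unit_gradient_eq hΩ.1 hyl.1 hp hd
    refine ⟨p, hy', dist y p, dist_nonneg, hd ▸ hyl.2, ?_⟩
    have hyp : ‖y - p‖ ≠ 0 := by
      rw [norm_ne_zero_iff]
      intro h0
      rw [sub_eq_zero] at h0
      exact frontier_subset_compl hΩ.1 hp (h0 ▸ hyl.1)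
    rw [hn]
    simp only
    rw [hnp, dist_eq_norm, smul_neg, smul_smul, mul_inv_cancel₀ hyp]
    module
  have key : ∀ s : Set (Euc N), Metric.ediam s ≤ ENNReal.ofReal ε →
      μ s ≤ ENNReal.ofReal (C * (2 * ε)) * Metric.ediam s ^ ((N - 1 : ℕ) : ℝ) := by
    intro s hs
    have hfin : Metric.ediam s ≠ ⊤ := (hs.trans_lt ENNReal.ofReal_lt_top).ne
    set δ := (Metric.ediam s).toReal with hδ
    have hδε : δ ≤ ε := ENNReal.toReal_le_of_le_ofReal hε.1.le hs
    have hδ0 : 0 ≤ δ := ENNReal.toReal_nonneg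
    -- The tube estimate needs a measurable set and a positive diameter bound. The closure of s
    -- provides the first at no cost, and letting δ' decrease to δ covers diameter 0.
    have h1 : ∀ δ' > δ, μ s ≤ ENNReal.ofReal (C * (ε + δ') * δ' ^ (N - 1)) := by
      intro δ' hδ'
      refine (measure_mono subset_closure).trans (tube (closure s) δ' (hδ0.trans_lt hδ') ?_
        isClosed_closure.measurableSet)
      intro a ha b hb
      have : edist a b ≤ Metric.ediam s := by
        rw [← Metric.ediam_closure]
        exact Metric.edist_le_ediam_of_mem ha hb
      rw [dist_edist]
      exact (ENNReal.toReal_mono hfin this).trans hδ'.le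
    have h2 : Tendsto (fun δ' : ℝ => ENNReal.ofReal (C * (ε + δ') * δ' ^ (N - 1))) (𝓝[>] δ)
        (𝓝 (ENNReal.ofReal (C * (ε + δ) * δ ^ (N - 1)))) := by
      have : Continuous fun δ' : ℝ => ENNReal.ofReal (C * (ε + δ') * δ' ^ (N - 1)) :=
        ENNReal.continuous_ofReal.comp (by fun_prop)
      exact (this.tendsto δ).mono_left nhdsWithin_le_nhds
    refine (ge_of_tendsto h2 (by filter_upwards [self_mem_nhdsWithin] with δ' hδ' using h1 δ' hδ')).trans ?_
    rw [ENNReal.rpow_natCast, ← ENNReal.ofReal_toReal hfin, ← hδ, ← ENNReal.ofReal_pow hδ0,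
      ← ENNReal.ofReal_mul (by have := hε.1; positivity)]
    apply ENNReal.ofReal_le_ofReal
    gcongr
    linarith
  -- C + 1 instead of C keeps c non-zero, so that μ can be divided by it.
  set c : ℝ≥0∞ := ENNReal.ofReal ((C + 1) * (2 * ε)) with hc
  have hc0 : c ≠ 0 := by
    have := hε.1
    rw [hc, ne_eq, ENNReal.ofReal_eq_zero, not_le]
    positivity
  have hct : c ≠ ⊤ := ENNReal.ofReal_ne_top
  have h3 : c⁻¹ • μ ≤ (μH[(N - 1 : ℕ)] : Measure (Euc N)) := by
    refine Measure.le_hausdorffMeasure _ _ (ENNReal.ofReal ε) (ENNReal.ofReal_pos.2 hε.1) ?_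
    intro s hs
    rw [Measure.smul_apply, smul_eq_mul, mul_comm, ← div_eq_mul_inv]
    refine ENNReal.div_le_of_le_mul ?_
    rw [mul_comm]
    refine (key s hs).trans (mul_le_mul_left (ENNReal.ofReal_le_ofReal ?_) _)
    have := hε.1
    gcongr
    linarith
  have hcc : ((2 * (C + 1)).toNNReal : ℝ≥0∞) * ENNReal.ofReal ε = c := by
    rw [hc, ← ENNReal.ofReal, ← ENNReal.ofReal_mul (by positivity)]
    congr 1; ring
  rw [hcc]
  calc μ = c • (c⁻¹ • μ) := by rw [smul_smul, ENNReal.mul_inv_cancel hc0 hct, one_smul]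
    _ ≤ c • (μH[(N - 1 : ℕ)] : Measure (Euc N)) := by
        rw [Measure.le_iff'] at h3 ⊢
        intro s
        simp only [Measure.smul_apply, smul_eq_mul] at h3 ⊢
        gcongr
        exact h3 s

/-- The two normalizations of Hausdorff measure differ by a non-zero constant; the comparison by
diameters yields the unnormalized one. -/
theorem hausdorffMeasure_frontier_le {N : ℕ} (Ω : Set (Euc N)) : ∃ C : ℝ≥0,
    (μH[(N - 1 : ℕ)] : Measure (Euc N)).restrict (frontier Ω) ≤ C • surfaceMeasure Ω := by
  set c := Measure.addHaarScalarFactor (volume : Measure (EuclideanSpace ℝ (Fin (N - 1))))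
    μH[(N - 1 : ℕ)] with hc
  have hc0 : c ≠ 0 := Measure.addHaarScalarFactor_volume_hausdorffMeasure_ne_zero (N - 1)
  refine ⟨c⁻¹, ?_⟩
  rw [surfaceMeasure, Measure.euclideanHausdorffMeasure_def, ← hc, Measure.restrict_smul,
    smul_smul, inv_mul_cancel₀ hc0, one_smul]

theorem layerMeasure_restrict_le {N : ℕ} (hN : 1 ≤ N) {Ω : Set (Euc N)} (hΩ : IsSmoothDomain Ω)
    (hne : Ω ≠ univ) {K : Set (Euc N)} (hK : IsCompact K) (hKf : K ⊆ frontier Ω) : ∃ C : ℝ≥0,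
    ∀ ε ∈ Ioc (0 : ℝ) 1, (layerMeasure Ω ε).restrict K ≤
      (C * ENNReal.ofReal ε) • (μH[(N - 1 : ℕ)] : Measure (Euc N)) := by
  refine hK.induction_on (p := fun K => ∃ C : ℝ≥0,
    ∀ ε ∈ Ioc (0 : ℝ) 1, (layerMeasure Ω ε).restrict K ≤
      (C * ENNReal.ofReal ε) • (μH[(N - 1 : ℕ)] : Measure (Euc N))) ?_ ?_ ?_ ?_
  · exact ⟨0, fun ε _ => by simp⟩
  · rintro s t hst ⟨C, hC⟩
    exact ⟨C, fun ε hε => (Measure.restrict_mono hst le_rfl).trans (hC ε hε)⟩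
  · rintro s t ⟨C, hC⟩ ⟨D, hD⟩
    refine ⟨C + D, fun ε hε => (Measure.restrict_union_le s t).trans ?_⟩
    rw [ENNReal.coe_add, add_mul, add_smul]
    exact add_le_add (hC ε hε) (hD ε hε)
  · intro x hx
    obtain ⟨t, ht, C, hC⟩ := layerMeasure_le_locally hN hΩ hne (hKf hx)
    exact ⟨t, mem_nhdsWithin_of_mem_nhds ht, C, hC⟩

/-- On bounded sets the volume of the part of the boundary layer of width `ε` that projects to a
boundary set is at most a multiple of `ε` times the surface measure of that set. -/
theorem layerMeasure_restrict_closedBall_le {N : ℕ} (hN : 1 ≤ N) {Ω : Set (Euc N)}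
    (hΩ : IsSmoothDomain Ω) (hne : Ω ≠ univ) (R : ℝ) : ∃ C : ℝ≥0, ∀ ε ∈ Ioc (0 : ℝ) 1,
    (layerMeasure Ω ε).restrict (Metric.closedBall 0 R) ≤
      (C * ENNReal.ofReal ε) • (surfaceMeasure Ω) := by
  obtain ⟨D, hD⟩ := hausdorffMeasure_frontier_le Ω
  obtain ⟨C, hC⟩ := layerMeasure_restrict_le hN hΩ hne
    ((isCompact_closedBall (0 : Euc N) R).inter_left isClosed_frontier) inter_subset_left
  refine ⟨C * D, fun ε hε => ?_⟩
  have h1 : layerMeasure Ω ε = (layerMeasure Ω ε).restrict (frontier Ω) := by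
    symm
    rw [Measure.restrict_eq_self_of_ae_mem]
    rw [layerMeasure]
    refine (ae_map_iff (aemeasurable_nearestBoundaryPoint_layer hΩ.1 hne ε)
      (isClosed_frontier (s := Ω)).measurableSet).2 ?_
    filter_upwards [ae_restrict_mem (measurableSet_boundaryLayer hΩ.1 ε)] with y hy
    exact (dist_nearestBoundaryPoint hΩ.1 hne hy.1).1
  have h2 : (layerMeasure Ω ε).restrict (Metric.closedBall 0 R) =
      ((layerMeasure Ω ε).restrict (frontier Ω ∩ Metric.closedBall 0 R)).restrict (frontier Ω) := by
    rw [Measure.restrict_restrict isClosed_frontier.measurableSet, ← inter_assoc, inter_self]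
    conv_lhs => rw [h1, Measure.restrict_restrict Metric.isClosed_closedBall.measurableSet,
      inter_comm]
  rw [h2]
  calc _ ≤ ((C * ENNReal.ofReal ε) • (μH[(N - 1 : ℕ)] : Measure (Euc N))).restrict (frontier Ω) :=
        Measure.restrict_mono le_rfl (hC ε hε)
    _ = (C * ENNReal.ofReal ε) • (μH[(N - 1 : ℕ)] : Measure (Euc N)).restrict (frontier Ω) :=
        Measure.restrict_smul _ _ _
    _ ≤ (C * ENNReal.ofReal ε) • (D • surfaceMeasure Ω) := by
        rw [Measure.le_iff'] at hD ⊢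
        intro s
        simp only [Measure.smul_apply, smul_eq_mul] at hD ⊢
        gcongr
        exact hD s
    _ = ((C * D : ℝ≥0) * ENNReal.ofReal ε) • surfaceMeasure Ω := by
        ext s
        simp only [Measure.smul_apply, smul_eq_mul, ENNReal.smul_def, ENNReal.coe_mul]
        ring

theorem layerMeasure_absolutelyContinuous {N : ℕ} (hN : 1 ≤ N) {Ω : Set (Euc N)}
    (hΩ : IsSmoothDomain Ω) (hne : Ω ≠ univ) {ε : ℝ} (hε : ε ∈ Ioc (0 : ℝ) 1) :
    layerMeasure Ω ε ≪ surfaceMeasure Ω := by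
  intro s hs
  have h : ∀ n : ℕ, layerMeasure Ω ε (s ∩ Metric.closedBall 0 n) = 0 := by
    intro n
    obtain ⟨C, hC⟩ := layerMeasure_restrict_closedBall_le hN hΩ hne n
    have h1 := Measure.le_iff'.1 (hC ε hε) s
    rw [Measure.restrict_apply' Metric.isClosed_closedBall.measurableSet] at h1
    simpa [hs] using h1
  rw [← nonpos_iff_eq_zero]
  calc _ ≤ layerMeasure Ω ε (⋃ n : ℕ, s ∩ Metric.closedBall 0 n) := by
        rw [← inter_iUnion, Metric.iUnion_closedBall_nat, inter_univ]
    _ = 0 := measure_iUnion_null h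

/-- A property that holds almost everywhere on the boundary holds at the nearest boundary point of
almost every point of a boundary layer. -/
theorem ae_nearestBoundaryPoint {N : ℕ} (hN : 1 ≤ N) {Ω : Set (Euc N)}
    (hΩ : IsSmoothDomain Ω) (hne : Ω ≠ univ) {ε : ℝ} (hε : ε ∈ Ioc (0 : ℝ) 1) {P : Euc N → Prop}
    (hP : ∀ᵐ x ∂surfaceMeasure Ω, P x) :
    ∀ᵐ y ∂(volume.restrict (boundaryLayer Ω ε)), P (nearestBoundaryPoint Ω y) :=
  ae_of_ae_map (aemeasurable_nearestBoundaryPoint_layer hΩ.1 hne ε)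
    ((layerMeasure_absolutelyContinuous hN hΩ hne hε).ae_le hP)

theorem aestronglyMeasurable_comp_nearestBoundaryPoint {N : ℕ} (hN : 1 ≤ N) {Ω : Set (Euc N)}
    (hΩ : IsSmoothDomain Ω) (hne : Ω ≠ univ) {ε : ℝ} (hε : ε ∈ Ioc (0 : ℝ) 1) {h : Euc N → ℝ}
    (hh : AEStronglyMeasurable h (surfaceMeasure Ω)) :
    AEStronglyMeasurable (fun y => h (nearestBoundaryPoint Ω y))
      (volume.restrict (boundaryLayer Ω ε)) :=
  (hh.mono_ac (layerMeasure_absolutelyContinuous hN hΩ hne hε)).comp_aemeasurable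
    (aemeasurable_nearestBoundaryPoint_layer hΩ.1 hne ε)

theorem lintegral_comp_nearestBoundaryPoint_le {N : ℕ} (hN : 1 ≤ N) {Ω : Set (Euc N)}
    (hΩ : IsSmoothDomain Ω) (hne : Ω ≠ univ) (R : ℝ) : ∃ C : ℝ≥0, ∀ ε ∈ Ioc (0 : ℝ) 1,
    ∀ f : Euc N → ℝ≥0∞, AEMeasurable f (surfaceMeasure Ω) →
    ∫⁻ y in boundaryLayer Ω ε ∩ Metric.ball 0 R, f (nearestBoundaryPoint Ω y) ≤
      C * ENNReal.ofReal ε * ∫⁻ x in Metric.ball 0 (R + 2), f x ∂(surfaceMeasure Ω) := by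
  -- The projection moves a point of the layer by less than ε ≤ 1, hence the closed ball of radius R
  -- + 1; the open ball of radius R + 2 contains it.
  obtain ⟨C, hC⟩ := layerMeasure_restrict_closedBall_le hN hΩ hne (R + 1)
  refine ⟨C, fun ε hε f hf => ?_⟩
  set B : Set (Euc N) := Metric.closedBall 0 (R + 1) with hB
  have hBm : MeasurableSet B := Metric.isClosed_closedBall.measurableSet
  have hπ := aemeasurable_nearestBoundaryPoint_layer hΩ.1 hne ε
  have hac := layerMeasure_absolutelyContinuous hN hΩ hne hε
  calc _ = ∫⁻ y in boundaryLayer Ω ε ∩ Metric.ball 0 R,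
        (B.indicator f) (nearestBoundaryPoint Ω y) := by
        refine setLIntegral_congr_fun
          ((measurableSet_boundaryLayer hΩ.1 ε).inter Metric.isOpen_ball.measurableSet) ?_
        rintro y ⟨hy, hyR⟩
        rw [mem_boundaryLayer hΩ.1 hne] at hy
        have hd := (dist_nearestBoundaryPoint hΩ.1 hne hy.1).2
        have : nearestBoundaryPoint Ω y ∈ B := by
          rw [hB, Metric.mem_closedBall]
          rw [Metric.mem_ball] at hyR
          have h1 := dist_triangle_left (nearestBoundaryPoint Ω y) 0 y
          have h2 := hε.2
          linarith [hy.2]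
        simp [indicator_of_mem this]
    _ ≤ ∫⁻ y in boundaryLayer Ω ε, (B.indicator f) (nearestBoundaryPoint Ω y) :=
        lintegral_mono_set inter_subset_left
    _ = ∫⁻ x, B.indicator f x ∂(layerMeasure Ω ε) := by
        rw [layerMeasure, lintegral_map' _ hπ]
        exact ((hf.indicator hBm).mono_ac hac)
    _ = ∫⁻ x, f x ∂((layerMeasure Ω ε).restrict B) := lintegral_indicator hBm f
    _ = ∫⁻ x, f x ∂(((layerMeasure Ω ε).restrict B).restrict B) := by
        rw [Measure.restrict_restrict hBm, inter_self]
    _ ≤ ∫⁻ x, f x ∂(((C * ENNReal.ofReal ε) • surfaceMeasure Ω).restrict B) :=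
        lintegral_mono' (Measure.restrict_mono le_rfl (hC ε hε)) le_rfl
    _ = C * ENNReal.ofReal ε * ∫⁻ x in B, f x ∂(surfaceMeasure Ω) := by
        rw [Measure.restrict_smul, lintegral_smul_measure, smul_eq_mul]
    _ ≤ _ := by
        gcongr
        exact Metric.closedBall_subset_ball (by linarith)

/-! ### A dominated convergence theorem with varying bounds -/

/-- (F₀ - Fₙ)⁺ is dominated by F₀, so its integral tends to 0; convergence of ∫ Fₙ then gives the
same for (Fₙ - F₀)⁺. This serves products with mollified L² functions, which have no common
integrable majorant at hand. -/
theorem tendsto_integral_of_tendsto_bounds {X : Type*} [MeasurableSpace X] {μ : Measure X}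
    {f F : ℕ → X → ℝ} {f₀ F₀ : X → ℝ} (hf : ∀ n, AEStronglyMeasurable (f n) μ)
    (hF : ∀ n, Integrable (F n) μ) (hF₀ : Integrable F₀ μ)
    (hle : ∀ n, ∀ᵐ x ∂μ, |f n x| ≤ F n x)
    (hflim : ∀ᵐ x ∂μ, Tendsto (fun n => f n x) atTop (𝓝 (f₀ x)))
    (hFlim : ∀ᵐ x ∂μ, Tendsto (fun n => F n x) atTop (𝓝 (F₀ x)))
    (hint : Tendsto (fun n => ∫ x, F n x ∂μ) atTop (𝓝 (∫ x, F₀ x ∂μ))) :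
    Tendsto (fun n => ∫ x, f n x ∂μ) atTop (𝓝 (∫ x, f₀ x ∂μ)) := by
  have hle' : ∀ᵐ x ∂μ, ∀ n, |f n x| ≤ F n x := ae_all_iff.2 hle
  have hF₀nn : ∀ᵐ x ∂μ, 0 ≤ F₀ x := by
    filter_upwards [hle', hFlim] with x h1 h2
    exact ge_of_tendsto' h2 fun n => (abs_nonneg _).trans (h1 n)
  have hf₀ : ∀ᵐ x ∂μ, |f₀ x| ≤ F₀ x := by
    filter_upwards [hle', hflim, hFlim] with x h1 h2 h3
    exact le_of_tendsto_of_tendsto' h2.abs h3 h1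
  have hfi : ∀ n, Integrable (f n) μ := fun n => (hF n).mono' (hf n) (hle n)
  have h1 : Tendsto (fun n => ∫ x, max (F₀ x - F n x) 0 ∂μ) atTop (𝓝 (∫ x, (0 : ℝ) ∂μ)) := by
    refine tendsto_integral_of_dominated_convergence F₀
      (fun n => ((hF₀.sub (hF n)).pos_part).1) hF₀ (fun n => ?_) ?_
    · filter_upwards [hle', hF₀nn] with x h2 h3
      have h4 := (abs_nonneg _).trans (h2 n)
      rw [Real.norm_of_nonneg (le_max_right _ _)]
      exact max_le (by linarith) h3
    · filter_upwards [hFlim] with x h2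
      have := (h2.const_sub (F₀ x)).max (tendsto_const_nhds (x := (0 : ℝ)))
      simpa using this
  have h2 : Tendsto (fun n => ∫ x, max (F n x - F₀ x) 0 ∂μ) atTop (𝓝 0) := by
    have e : ∀ n, ∫ x, max (F n x - F₀ x) 0 ∂μ =
        (∫ x, F n x ∂μ - ∫ x, F₀ x ∂μ) + ∫ x, max (F₀ x - F n x) 0 ∂μ := by
      intro n
      have i1 : Integrable (fun x => F n x - F₀ x) μ := (hF n).sub hF₀
      have i2 : Integrable (fun x => max (F₀ x - F n x) 0) μ := (hF₀.sub (hF n)).pos_part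
      rw [← integral_sub (hF n) hF₀, ← integral_add i1 i2]
      congr 1 with x
      rcases le_total (F n x) (F₀ x) with h | h
      · rw [max_eq_right (by linarith), max_eq_left (by linarith)]; ring
      · rw [max_eq_left (by linarith), max_eq_right (by linarith)]; ring
    simp_rw [e]
    simpa using (hint.sub_const (∫ x, F₀ x ∂μ)).add h1
  -- Truncating fₙ at ±F₀ makes ordinary dominated convergence applicable and changes fₙ by at most
  -- (Fₙ - F₀)⁺.
  set g : ℕ → X → ℝ := fun n x => max (-F₀ x) (min (F₀ x) (f n x)) with hg
  have hgm : ∀ n, AEStronglyMeasurable (g n) μ := fun n => hF₀.1.neg.sup (hF₀.1.inf (hf n))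
  have hgle : ∀ n, ∀ᵐ x ∂μ, |g n x| ≤ F₀ x := by
    intro n
    filter_upwards [hF₀nn] with x hx
    rw [abs_le]
    exact ⟨le_max_left _ _, max_le (by linarith) (min_le_left _ _)⟩
  have h3 : Tendsto (fun n => ∫ x, g n x ∂μ) atTop (𝓝 (∫ x, f₀ x ∂μ)) := by
    refine tendsto_integral_of_dominated_convergence F₀ hgm hF₀ hgle ?_
    filter_upwards [hflim, hf₀] with x h4 h5
    have := (tendsto_const_nhds (x := -F₀ x)).max ((tendsto_const_nhds (x := F₀ x)).min h4)
    rw [abs_le] at h5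
    rwa [min_eq_right h5.2, max_eq_right h5.1] at this
  have h4 : Tendsto (fun n => ∫ x, f n x ∂μ - ∫ x, g n x ∂μ) atTop (𝓝 0) := by
    refine squeeze_zero_norm (fun n => ?_) h2
    rw [← integral_sub (hfi n) (hF₀.mono' (hgm n) (hgle n))]
    refine norm_integral_le_of_norm_le ((hF n).sub hF₀).pos_part ?_
    filter_upwards [hle', hF₀nn] with x h5 h6
    have h7 := abs_le.1 (h5 n)
    simp only [hg]
    rw [Real.norm_eq_abs, abs_le]
    rcases le_total (F₀ x) (f n x) with h | h
    · rw [min_eq_left h, max_eq_right (by linarith : -F₀ x ≤ F₀ x)]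
      constructor
      · linarith [le_max_right (F n x - F₀ x) 0]
      · linarith [le_max_left (F n x - F₀ x) 0]
    · rw [min_eq_right h]
      rcases le_total (-F₀ x) (f n x) with h' | h'
      · rw [max_eq_right h']
        constructor <;> linarith [le_max_right (F n x - F₀ x) 0]
      · rw [max_eq_left h']
        constructor
        · linarith [le_max_left (F n x - F₀ x) 0]
        · linarith [le_max_right (F n x - F₀ x) 0]
  simpa using h4.add h3

/-! ### Mollification -/

/-- The radius of the `n`-th mollifier. -/
def mollRadius (n : ℕ) : ℝ := 1 / (n + 1)

theorem mollRadius_pos (n : ℕ) : 0 < mollRadius n := by unfold mollRadius; positivity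

theorem tendsto_mollRadius : Tendsto mollRadius atTop (𝓝 0) := tendsto_one_div_add_atTop_nhds_zero_nat

/-- The bump function that defines the `n`-th mollifier. -/
def mollBump (N n : ℕ) : ContDiffBump (0 : Euc N) where
  rIn := mollRadius n / 2
  rOut := mollRadius n
  rIn_pos := half_pos (mollRadius_pos n)
  rIn_lt_rOut := half_lt_self (mollRadius_pos n)

/-- The `n`-th mollifier. -/
def mollKernel (N n : ℕ) : Euc N → ℝ := (mollBump N n).normed volume

/-- Mollification. -/
def moll {N : ℕ} (n : ℕ) (g : Euc N → ℝ) : Euc N → ℝ :=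
  convolution (mollKernel N n) g (ContinuousLinearMap.lsmul ℝ ℝ) volume

section Moll

variable {N : ℕ}

theorem mollKernel_nonneg (n : ℕ) (x : Euc N) : 0 ≤ mollKernel N n x :=
  (mollBump N n).nonneg_normed x

theorem contDiff_mollKernel (n : ℕ) : ContDiff ℝ ∞ (mollKernel N n) :=
  (mollBump N n).contDiff_normed

theorem integral_mollKernel (n : ℕ) : ∫ x, mollKernel N n x = 1 := (mollBump N n).integral_normed

theorem integrable_mollKernel (n : ℕ) : Integrable (mollKernel N n) :=
  (mollBump N n).integrable_normed

theorem hasCompactSupport_mollKernel (n : ℕ) : HasCompactSupport (mollKernel N n) :=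
  (mollBump N n).hasCompactSupport_normed

theorem tsupport_mollKernel (n : ℕ) :
    tsupport (mollKernel N n) = Metric.closedBall 0 (mollRadius n) :=
  (mollBump N n).tsupport_normed_eq

theorem moll_apply (n : ℕ) (g : Euc N → ℝ) (x : Euc N) :
    moll n g x = ∫ t, mollKernel N n t * g (x - t) := by
  simp [moll, convolution_def]

theorem moll_apply_swap (n : ℕ) (g : Euc N → ℝ) (x : Euc N) :
    moll n g x = ∫ t, mollKernel N n (x - t) * g t := by
  simp [moll, convolution_lsmul_swap]

theorem integrable_mollKernel_mul (n : ℕ) {g : Euc N → ℝ} (hg : LocallyIntegrable g) (x : Euc N) :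
    Integrable fun t => mollKernel N n t * g (x - t) := by
  simpa [ConvolutionExistsAt] using (hasCompactSupport_mollKernel n).convolutionExists_left
    (ContinuousLinearMap.lsmul ℝ ℝ) (contDiff_mollKernel n).continuous hg x

theorem ae_tendsto_moll {g : Euc N → ℝ} (hg : LocallyIntegrable g) :
    ∀ᵐ x, Tendsto (fun n => moll n g x) atTop (𝓝 (g x)) := by
  refine ContDiffBump.ae_convolution_tendsto_right_of_locallyIntegrable (K := 2)
    (φ := fun n => mollBump N n) tendsto_mollRadius (Eventually.of_forall fun n => ?_) hg
  simp [mollBump]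
  linarith

theorem contDiff_moll (n : ℕ) {g : Euc N → ℝ} (hg : LocallyIntegrable g) :
    ContDiff ℝ ∞ (moll n g) :=
  (hasCompactSupport_mollKernel n).contDiff_convolution_left _ (contDiff_mollKernel n) hg

theorem moll_nonneg (n : ℕ) {g : Euc N → ℝ} (hg : ∀ x, 0 ≤ g x) (x : Euc N) : 0 ≤ moll n g x := by
  rw [moll_apply]
  exact integral_nonneg fun t => mul_nonneg (mollKernel_nonneg n t) (hg _)

theorem abs_moll_le (n : ℕ) {g : Euc N → ℝ} {M : ℝ} (hM : ∀ᵐ x, |g x| ≤ M) (x : Euc N) :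
    |moll n g x| ≤ M := by
  rw [moll_apply, ← Real.norm_eq_abs]
  have h1 : ∀ᵐ t : Euc N, |g (x - t)| ≤ M :=
    (quasiMeasurePreserving_sub_left volume x).ae hM
  calc _ ≤ ∫ t, mollKernel N n t * M := by
        refine norm_integral_le_of_norm_le ((integrable_mollKernel n).mul_const M) ?_
        filter_upwards [h1] with t ht
        rw [norm_mul, Real.norm_of_nonneg (mollKernel_nonneg n t), Real.norm_eq_abs]
        exact mul_le_mul_of_nonneg_left ht (mollKernel_nonneg n t)
    _ = M := by rw [integral_mul_const, integral_mollKernel, one_mul]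

/-- Jensen's inequality: the kernel is a probability density, and the variance about the mean c is
non-negative. -/
theorem sq_moll_le (n : ℕ) {g : Euc N → ℝ} (hg : LocallyIntegrable g)
    (hg2 : LocallyIntegrable fun x => g x ^ 2) (x : Euc N) :
    moll n g x ^ 2 ≤ moll n (fun x => g x ^ 2) x := by
  set c := moll n g x with hc
  have i1 := integrable_mollKernel_mul n hg x
  have i2 := integrable_mollKernel_mul n hg2 x
  have i0 := integrable_mollKernel (N := N) n
  have h : 0 ≤ ∫ t, mollKernel N n t * (g (x - t) - c) ^ 2 :=
    integral_nonneg fun t => mul_nonneg (mollKernel_nonneg n t) (sq_nonneg _)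
  have e : ∫ t, mollKernel N n t * (g (x - t) - c) ^ 2 =
      moll n (fun x => g x ^ 2) x - 2 * c * c + c ^ 2 := by
    have : ∀ t, mollKernel N n t * (g (x - t) - c) ^ 2 = mollKernel N n t * g (x - t) ^ 2
        - 2 * c * (mollKernel N n t * g (x - t)) + c ^ 2 * mollKernel N n t := fun t => by ring
    simp_rw [this]
    have i3 : Integrable fun t => mollKernel N n t * g (x - t) ^ 2
        - 2 * c * (mollKernel N n t * g (x - t)) := i2.sub (i1.const_mul _)
    rw [integral_add i3 (i0.const_mul _), integral_sub i2 (i1.const_mul _),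
      integral_const_mul, integral_const_mul, integral_mollKernel, ← moll_apply,
      moll_apply n fun x => g x ^ 2, mul_one, hc]
  nlinarith

theorem integrable_moll (n : ℕ) {g : Euc N → ℝ} (hg : Integrable g) : Integrable (moll n g) :=
  (integrable_mollKernel n).integrable_convolution _ hg

theorem integral_moll (n : ℕ) {g : Euc N → ℝ} (hg : Integrable g) :
    ∫ x, moll n g x = ∫ x, g x := by
  unfold moll
  rw [integral_convolution _ (integrable_mollKernel n) hg, integral_mollKernel]
  simp

theorem partialDeriv_moll (n : ℕ) {g : Euc N → ℝ} (hg : LocallyIntegrable g) (i : Fin N)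
    (x : Euc N) :
    partialDeriv i (moll n g) x = ∫ t, g t * partialDeriv i (mollKernel N n) (x - t) := by
  have h1 : moll n g = convolution g (mollKernel N n) (ContinuousLinearMap.lsmul ℝ ℝ).flip
      volume := by
    rw [moll, convolution_flip]
  have hs := hasCompactSupport_mollKernel (N := N) n
  have h2 := hs.hasFDerivAt_convolution_right (ContinuousLinearMap.lsmul ℝ ℝ).flip hg
    ((contDiff_mollKernel n).of_le (by norm_cast)) x
  rw [partialDeriv, h1, h2.fderiv, convolution_precompR_apply _ hg (hs.fderiv ℝ)
    ((contDiff_mollKernel n).continuous_fderiv (by simp))]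
  simp only [convolution_def, ContinuousLinearMap.flip_apply, ContinuousLinearMap.lsmul_apply,
    smul_eq_mul, partialDeriv]
  exact integral_congr_ae (Eventually.of_forall fun t => mul_comm _ _)

theorem fderiv_comp_const_sub {f : Euc N → ℝ} (hf : Differentiable ℝ f) (x y : Euc N) :
    fderiv ℝ (fun z => f (x - z)) y = -fderiv ℝ f (x - y) := by
  have h := (hf (x - y)).hasFDerivAt.comp y ((hasFDerivAt_id y).const_sub x)
  refine h.fderiv.trans ?_
  ext v
  simp

/-- The reflected kernel centred at x is supported in the closed ball of the mollification radius,
hence is a test function in Ω once that ball lies in Ω. Off this region the derivative of the zero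
extension is not controlled. -/
theorem partialDeriv_moll_of_hasWeakPartial (n : ℕ) {Ω : Set (Euc N)} (hΩ : MeasurableSet Ω)
    {i : Fin N} {v w : Euc N → ℝ} (h : HasWeakPartial Ω i v w)
    (hv : LocallyIntegrable (Ω.indicator v)) {x : Euc N}
    (hx : Metric.closedBall x (mollRadius n) ⊆ Ω) :
    partialDeriv i (moll n (Ω.indicator v)) x = moll n (Ω.indicator w) x := by
  have htest : IsTestFunction Ω fun y => mollKernel N n (x - y) := by
    have hts : tsupport (fun y => mollKernel N n (x - y)) ⊆ Metric.closedBall x (mollRadius n) := by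
      refine closure_minimal ?_ Metric.isClosed_closedBall
      intro y hy
      have : x - y ∈ tsupport (mollKernel N n) := subset_tsupport _ hy
      rw [tsupport_mollKernel, mem_closedBall_zero_iff] at this
      rwa [Metric.mem_closedBall, dist_comm, dist_eq_norm]
    refine ⟨(contDiff_mollKernel n).comp (contDiff_const.sub contDiff_id), ?_, hts.trans hx⟩
    exact (isCompact_closedBall x _).of_isClosed_subset (isClosed_tsupport _) hts
  have h1 := h _ htest
  rw [partialDeriv_moll n hv, moll_apply_swap]
  have e1 : ∀ y, partialDeriv i (fun y => mollKernel N n (x - y)) y =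
      -partialDeriv i (mollKernel N n) (x - y) := by
    intro y
    simp [partialDeriv, fderiv_comp_const_sub ((contDiff_mollKernel n).differentiable (by simp))]
  simp_rw [e1, mul_neg] at h1
  rw [integral_neg, neg_inj, ← integral_indicator hΩ, ← integral_indicator hΩ] at h1
  calc _ = ∫ a, Ω.indicator (fun x_1 => v x_1 * partialDeriv i (mollKernel N n) (x - x_1)) a := by
        congr 1 with t
        by_cases ht : t ∈ Ω <;> simp [ht]
    _ = _ := h1
    _ = _ := by
        congr 1 with t
        by_cases ht : t ∈ Ω <;> simp [ht, mul_comm]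

/-- Integration by parts holds for a Lipschitz function with its almost everywhere derivative.
Lipschitz is the natural regularity here, since η will involve the distance to the complement. -/
theorem partialDeriv_moll_of_lipschitzWith (n : ℕ) {K : ℝ≥0} {η : Euc N → ℝ}
    (hη : LipschitzWith K η) (i : Fin N) (x : Euc N) :
    partialDeriv i (moll n η) x = moll n (partialDeriv i η) x := by
  have hρ : ContDiff ℝ ∞ (fun y => mollKernel N n (x - y)) :=
    (contDiff_mollKernel n).comp (contDiff_const.sub contDiff_id)
  have hs : HasCompactSupport (fun y => mollKernel N n (x - y)) :=
    (hasCompactSupport_mollKernel n).comp_homeomorph (Homeomorph.subLeft x)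
  obtain ⟨D, hD⟩ := ContDiff.lipschitzWith_of_hasCompactSupport hs hρ (by simp)
  have h := hη.integral_lineDeriv_mul_eq (μ := volume) hD hs (EuclideanSpace.single i 1)
  rw [partialDeriv_moll n hη.continuous.locallyIntegrable, moll_apply_swap]
  have e1 : ∀ y, lineDeriv ℝ (fun y => mollKernel N n (x - y)) y (-EuclideanSpace.single i 1) =
      partialDeriv i (mollKernel N n) (x - y) := by
    intro y
    rw [((hρ.differentiable (by simp)) y).lineDeriv_eq_fderiv,
      fderiv_comp_const_sub ((contDiff_mollKernel n).differentiable (by simp))]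
    simp [partialDeriv]
  simp_rw [e1] at h
  have e2 : ∀ᵐ t, lineDeriv ℝ η t (EuclideanSpace.single i 1) * mollKernel N n (x - t) =
      mollKernel N n (x - t) * partialDeriv i η t := by
    filter_upwards [hη.ae_differentiableAt] with t ht
    rw [ht.lineDeriv_eq_fderiv, mul_comm]; rfl
  rw [← integral_congr_ae e2, h]
  exact integral_congr_ae (Eventually.of_forall fun t => mul_comm _ _)

theorem moll_eq_zero_of_disjoint (n : ℕ) {g : Euc N → ℝ} {x : Euc N}
    (h : ∀ y ∈ Metric.closedBall x (mollRadius n), g y = 0) : moll n g x = 0 := by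
  rw [moll_apply]
  refine integral_eq_zero_of_ae (Eventually.of_forall fun t => ?_)
  by_cases ht : t ∈ tsupport (mollKernel N n)
  · rw [tsupport_mollKernel, mem_closedBall_zero_iff] at ht
    simp [h (x - t) (by simpa [Metric.mem_closedBall, dist_eq_norm] using ht)]
  · simp [image_eq_zero_of_notMem_tsupport ht]

theorem abs_partialDeriv_le_of_lipschitzWith {K : ℝ≥0} {η : Euc N → ℝ} (hη : LipschitzWith K η)
    (i : Fin N) (x : Euc N) : |partialDeriv i η x| ≤ K := by
  rw [partialDeriv, ← Real.norm_eq_abs]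
  refine ((fderiv ℝ η x).le_opNorm _).trans ?_
  rw [PiLp.norm_single, norm_one, mul_one]
  exact norm_fderiv_le_of_lipschitz ℝ hη

theorem measurable_partialDeriv (i : Fin N) (η : Euc N → ℝ) : Measurable (partialDeriv i η) :=
  measurable_fderiv_apply_const ℝ η _

theorem locallyIntegrable_of_abs_le {g : Euc N → ℝ} {M : ℝ} (hg : AEStronglyMeasurable g)
    (hM : ∀ᵐ x, |g x| ≤ M) : LocallyIntegrable g :=
  (memLp_top_of_bound hg M hM).locallyIntegrable le_top

end Moll

/-! ### Testing with functions of the solution -/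

section Testing

variable {N : ℕ}

theorem partialDeriv_eq_zero_of_notMem_tsupport {η : Euc N → ℝ} {x : Euc N} (hx : x ∉ tsupport η)
    (i : Fin N) : partialDeriv i η x = 0 := by
  rw [partialDeriv, fderiv_of_notMem_tsupport ℝ hx]; rfl

theorem integrable_indicator_abs_of_memLp {f : Euc N → ℝ} (hf : MemLp f 2) {K : Set (Euc N)}
    (hK : IsCompact K) : Integrable (K.indicator fun x => |f x|) := by
  have : IsFiniteMeasure (volume.restrict K) := ⟨by simpa using hK.measure_lt_top⟩
  rw [integrable_indicator_iff hK.measurableSet]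
  exact ((hf.restrict K).integrable one_le_two).abs

theorem integrable_sq_of_memLp {f : Euc N → ℝ} (hf : MemLp f 2) :
    Integrable fun x => f x ^ 2 := (memLp_two_iff_integrable_sq hf.1).1 hf

theorem memLp_partialDeriv_of_lipschitzWith {η : Euc N → ℝ} {K : ℝ≥0} (hη : LipschitzWith K η)
    (hηs : HasCompactSupport η) (i : Fin N) : MemLp (partialDeriv i η) 2 := by
  have h1 : MemLp ((tsupport η).indicator fun _ => (K : ℝ)) 2 (volume : Measure (Euc N)) :=
    memLp_indicator_const 2 (isClosed_tsupport η).measurableSet _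
      (Or.inr hηs.isCompact.measure_lt_top.ne)
  refine h1.mono' (measurable_partialDeriv i η).aestronglyMeasurable
    (Eventually.of_forall fun x => ?_)
  by_cases hx : x ∈ tsupport η
  · rw [indicator_of_mem hx]
    exact abs_partialDeriv_le_of_lipschitzWith hη i x
  · rw [indicator_of_notMem hx, partialDeriv_eq_zero_of_notMem_tsupport hx, norm_zero]

theorem partialDeriv_comp_mul {Ψ : ℝ → ℝ} (hΨ : Differentiable ℝ Ψ) {v η : Euc N → ℝ}
    (hv : Differentiable ℝ v) (hη : Differentiable ℝ η) (i : Fin N) (x : Euc N) :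
    partialDeriv i (fun x => Ψ (v x) * η x) x =
      deriv Ψ (v x) * partialDeriv i v x * η x + Ψ (v x) * partialDeriv i η x := by
  have h1 : HasFDerivAt (fun x => Ψ (v x)) (deriv Ψ (v x) • fderiv ℝ v x) x :=
    (hΨ (v x)).hasDerivAt.comp_hasFDerivAt x (hv x).hasFDerivAt
  have h2 := h1.mul (hη x).hasFDerivAt
  have h3 : fderiv ℝ (fun x => Ψ (v x) * η x) x =
    Ψ (v x) • fderiv ℝ η x + η x • deriv Ψ (v x) • fderiv ℝ v x := h2.fderiv
  rw [partialDeriv, h3]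
  simp only [partialDeriv, add_apply, smul_apply,
    smul_eq_mul]
  ring

/-- The test functions are Ψ(wₙ) ηₙ with both factors mollified, so that the product and chain rules
are classical. The limit is delicate only in A · ∇wₙ, where the gradients converge almost everywhere
but need a bound that varies with n. -/
theorem weak_inequality_comp_aux {Ω : Set (Euc N)} (hΩ : IsOpen Ω) {w h : Euc N → ℝ}
    {D A : Fin N → Euc N → ℝ} {M : ℝ} (hw : MemLp w 2) (hwM : ∀ᵐ x, |w x| ≤ M)
    (hh : MemLp h 2) (hD : ∀ i, MemLp (D i) 2) (hA : ∀ i, MemLp (A i) 2)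
    (hweak : ∀ i n x, Metric.closedBall x (mollRadius n) ⊆ Ω →
      partialDeriv i (moll n w) x = moll n (D i) x)
    (htest : ∀ φ, IsTestFunction Ω φ → (∀ x, 0 ≤ φ x) →
      (∫ x, ∑ j, A j x * partialDeriv j φ x) + ∫ x, h x * φ x ≤ 0)
    {Ψ : ℝ → ℝ} (hΨ : ContDiff ℝ ∞ Ψ) (hΨ0 : ∀ s, 0 ≤ Ψ s)
    {η : Euc N → ℝ} {K : ℝ≥0} (hη : LipschitzWith K η) (hη0 : ∀ x, 0 ≤ η x)
    (hηs : HasCompactSupport η) (hηΩ : tsupport η ⊆ Ω) :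
    (∫ x, ∑ j, A j x * (deriv Ψ (w x) * D j x * η x + Ψ (w x) * partialDeriv j η x)) +
      ∫ x, h x * (Ψ (w x) * η x) ≤ 0 := by
  -- The margin δ is spent twice: mollifying η enlarges its support by one radius, and the balls
  -- about the points of that support by another. Hence all radii are kept below δ/2.
  obtain ⟨δ, hδ, hδΩ⟩ := hηs.exists_cthickening_subset_open hΩ hηΩ
  obtain ⟨n₀, hn₀⟩ : ∃ n₀, ∀ n ≥ n₀, mollRadius n < δ / 2 :=
    eventually_atTop.1 (tendsto_mollRadius.eventually (gt_mem_nhds (half_pos hδ)))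
  set k : ℕ → ℕ := fun n => n + n₀ with hk
  have hkr : ∀ n, mollRadius (k n) < δ / 2 := fun n => hn₀ _ (Nat.le_add_left _ _)
  have hkt : Tendsto k atTop atTop := tendsto_add_atTop_nat n₀
  set K' := Metric.cthickening δ (tsupport η) with hK'
  have hK'c : IsCompact K' := hηs.isCompact.cthickening
  have hball : ∀ n x, x ∉ Metric.cthickening (mollRadius (k n)) (tsupport η) →
      ∀ y ∈ Metric.closedBall x (mollRadius (k n)), y ∉ tsupport η := by
    intro n x hx y hy hy2
    apply hx
    exact Metric.closedBall_subset_cthickening hy2 _ (Metric.mem_closedBall_comm.1 hy)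
  have hcth : ∀ n, Metric.cthickening (mollRadius (k n)) (tsupport η) ⊆ K' := fun n =>
    Metric.cthickening_mono (by linarith [hkr n]) _
  have hηz : ∀ n x, x ∉ Metric.cthickening (mollRadius (k n)) (tsupport η) →
      moll (k n) η x = 0 := fun n x hx => moll_eq_zero_of_disjoint _ fun y hy =>
        image_eq_zero_of_notMem_tsupport (hball n x hx y hy)
  have hmz : ∀ n j x, x ∉ Metric.cthickening (mollRadius (k n)) (tsupport η) →
      moll (k n) (partialDeriv j η) x = 0 := fun n j x hx => moll_eq_zero_of_disjoint _ fun y hy =>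
        partialDeriv_eq_zero_of_notMem_tsupport (hball n x hx y hy) j
  obtain ⟨B, hB⟩ : ∃ B, ∀ x, |η x| ≤ B := by
    obtain ⟨B, hB⟩ := hηs.exists_bound_of_continuous hη.continuous
    exact ⟨B, hB⟩
  have hB0 : 0 ≤ B := (abs_nonneg _).trans (hB 0)
  obtain ⟨C₁, hC₁⟩ : ∃ C, ∀ s ∈ Icc (-M) M, ‖Ψ s‖ ≤ C :=
    isCompact_Icc.exists_bound_of_continuousOn hΨ.continuous.continuousOn
  obtain ⟨C₂, hC₂⟩ : ∃ C, ∀ s ∈ Icc (-M) M, ‖deriv Ψ s‖ ≤ C :=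
    isCompact_Icc.exists_bound_of_continuousOn (hΨ.continuous_deriv (by simp)).continuousOn
  have hwn : ∀ n x, moll n w x ∈ Icc (-M) M := fun n x => abs_le.1 (abs_moll_le n hwM x)
  have hM0 : (0 : ℝ) ∈ Icc (-M) M := by
    have := (abs_nonneg _).trans (abs_moll_le 0 hwM 0)
    exact ⟨by linarith, this⟩
  have hC₁0 : 0 ≤ C₁ := (norm_nonneg _).trans (hC₁ 0 hM0)
  have hC₂0 : 0 ≤ C₂ := (norm_nonneg _).trans (hC₂ 0 hM0)
  have hwl : LocallyIntegrable w := hw.locallyIntegrable one_le_two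
  have hDl : ∀ i, LocallyIntegrable (D i) := fun i => (hD i).locallyIntegrable one_le_two
  have hD2 : ∀ i, Integrable fun x => D i x ^ 2 := fun i => integrable_sq_of_memLp (hD i)
  have hml : ∀ j, LocallyIntegrable (partialDeriv j η) := fun j =>
    locallyIntegrable_of_abs_le (measurable_partialDeriv j η).aestronglyMeasurable
      (Eventually.of_forall (abs_partialDeriv_le_of_lipschitzWith hη j))
  have cw := fun n => contDiff_moll n hwl
  have cη := fun n => contDiff_moll n hη.continuous.locallyIntegrable
  have cD := fun i n => contDiff_moll n (hDl i)
  have cm := fun j n => contDiff_moll n (hml j)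
  set φ : ℕ → Euc N → ℝ := fun n x => Ψ (moll (k n) w x) * moll (k n) η x with hφ
  have hφt : ∀ n, IsTestFunction Ω (φ n) := by
    intro n
    have hts : tsupport (φ n) ⊆ Metric.cthickening (mollRadius (k n)) (tsupport η) := by
      refine closure_minimal ?_ Metric.isClosed_cthickening
      intro x hx
      by_contra hx2
      exact hx (by simp [hφ, hηz n x hx2])
    refine ⟨(hΨ.comp (cw _)).mul (cη _), ?_, hts.trans ((hcth n).trans hδΩ)⟩
    exact hK'c.of_isClosed_subset (isClosed_tsupport _) (hts.trans (hcth n))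
  have hφ0 : ∀ n x, 0 ≤ φ n x := fun n x => mul_nonneg (hΨ0 _) (moll_nonneg _ hη0 x)
  have hφd : ∀ n j x, partialDeriv j (φ n) x =
      deriv Ψ (moll (k n) w x) * moll (k n) (D j) x * moll (k n) η x +
        Ψ (moll (k n) w x) * moll (k n) (partialDeriv j η) x := by
    intro n j x
    rw [hφ]
    simp only
    rw [partialDeriv_comp_mul (hΨ.differentiable (by simp)) ((cw _).differentiable (by simp))
      ((cη _).differentiable (by simp)), partialDeriv_moll_of_lipschitzWith _ hη]
    -- Outside the enlarged support the mollified η vanishes, and the derivative of the mollified w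
    -- is irrelevant.
    by_cases hx : x ∈ Metric.cthickening (mollRadius (k n)) (tsupport η)
    · rw [hweak]
      refine subset_trans ?_ hδΩ
      refine (Metric.closedBall_subset_cthickening hx _).trans
        ((Metric.cthickening_cthickening_subset (mollRadius_pos _).le (mollRadius_pos _).le
          _).trans (Metric.cthickening_mono (by linarith [hkr n]) _))
    · rw [hηz n x hx, mul_zero, mul_zero]
  have aw : ∀ᵐ x, Tendsto (fun n => moll (k n) w x) atTop (𝓝 (w x)) := by
    filter_upwards [ae_tendsto_moll hwl] with x hx using hx.comp hkt
  have aη : ∀ᵐ x, Tendsto (fun n => moll (k n) η x) atTop (𝓝 (η x)) := by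
    filter_upwards [ae_tendsto_moll hη.continuous.locallyIntegrable] with x hx using hx.comp hkt
  have aD : ∀ᵐ x, ∀ j, Tendsto (fun n => moll (k n) (D j) x) atTop (𝓝 (D j x)) := by
    refine ae_all_iff.2 fun j => ?_
    filter_upwards [ae_tendsto_moll (hDl j)] with x hx using hx.comp hkt
  have aD2 : ∀ᵐ x, ∀ j, Tendsto (fun n => moll (k n) (fun x => D j x ^ 2) x) atTop
      (𝓝 (D j x ^ 2)) := by
    refine ae_all_iff.2 fun j => ?_
    filter_upwards [ae_tendsto_moll (hD2 j).locallyIntegrable] with x hx using hx.comp hkt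
  have am : ∀ᵐ x, ∀ j, Tendsto (fun n => moll (k n) (partialDeriv j η) x) atTop
      (𝓝 (partialDeriv j η x)) := by
    refine ae_all_iff.2 fun j => ?_
    filter_upwards [ae_tendsto_moll (hml j)] with x hx using hx.comp hkt
  have cont_dΨ : Continuous (deriv Ψ) := hΨ.continuous_deriv (by simp)
  have L1 : Tendsto (fun n => ∫ x, h x * φ n x) atTop (𝓝 (∫ x, h x * (Ψ (w x) * η x))) := by
    refine tendsto_integral_of_dominated_convergence
      (fun x => C₁ * B * K'.indicator (fun x => |h x|) x)
      (fun n => hh.1.mul (hφt n).1.continuous.aestronglyMeasurable)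
      ((integrable_indicator_abs_of_memLp hh hK'c).const_mul _) ?_ ?_
    · refine fun n => Eventually.of_forall fun x => ?_
      by_cases hx : x ∈ Metric.cthickening (mollRadius (k n)) (tsupport η)
      · rw [indicator_of_mem (hcth n hx), norm_mul, norm_mul, Real.norm_eq_abs (h x), mul_comm |h x|]
        gcongr
        · exact hC₁ _ (hwn _ _)
        · exact abs_moll_le _ (Eventually.of_forall hB) x
      · rw [hφ]
        simp only [hηz n x hx, mul_zero, norm_zero]
        exact mul_nonneg (by positivity) (indicator_nonneg (fun _ _ => abs_nonneg _) _)
    · filter_upwards [aw, aη] with x h1 h2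
      exact (((hΨ.continuous.tendsto _).comp h1).mul h2).const_mul _
  have L2 : Tendsto (fun n => ∫ x, ∑ j, A j x * partialDeriv j (φ n) x) atTop
      (𝓝 (∫ x, ∑ j, A j x * (deriv Ψ (w x) * D j x * η x + Ψ (w x) * partialDeriv j η x))) := by
    have iA : ∀ j, Integrable fun x => A j x ^ 2 := fun j => integrable_sq_of_memLp (hA j)
    have iK : ∀ j, Integrable (K'.indicator fun x => |A j x|) := fun j =>
      integrable_indicator_abs_of_memLp (hA j) hK'c
    have iF : ∀ g : Fin N → Euc N → ℝ, (∀ j, Integrable (g j)) → Integrable fun x =>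
        ∑ j, (C₂ * B * (A j x ^ 2 + g j x) + C₁ * K * K'.indicator (fun x => |A j x|) x) :=
      fun g hg => integrable_finsetSum _ fun j _ =>
        (((iA j).add (hg j)).const_mul _).add ((iK j).const_mul _)
    have eF : ∀ g : Fin N → Euc N → ℝ, (∀ j, Integrable (g j)) →
        ∫ x, ∑ j, (C₂ * B * (A j x ^ 2 + g j x) + C₁ * K * K'.indicator (fun x => |A j x|) x) =
        ∑ j, (C₂ * B * ((∫ x, A j x ^ 2) + ∫ x, g j x) +
          C₁ * K * ∫ x, K'.indicator (fun x => |A j x|) x) := by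
      intro g hg
      have i1 : ∀ j, Integrable fun x => C₂ * B * (A j x ^ 2 + g j x) := fun j =>
        ((iA j).add (hg j)).const_mul _
      have i2 : ∀ j ∈ Finset.univ, Integrable fun x => C₂ * B * (A j x ^ 2 + g j x) +
          C₁ * K * K'.indicator (fun x => |A j x|) x := fun j _ => (i1 j).add ((iK j).const_mul _)
      rw [integral_finsetSum _ i2]
      refine Finset.sum_congr rfl fun j _ => ?_
      rw [integral_add (i1 j) ((iK j).const_mul _), integral_const_mul, integral_const_mul,
        integral_add (iA j) (hg j)]
    have iM : ∀ n j, Integrable (moll (k n) fun x => D j x ^ 2) := fun n j =>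
      integrable_moll _ (hD2 j)
    -- |A · moll D| ≤ A² + moll (D²), by Jensen. The majorants vary with n, but mollification
    -- preserves integrals, so their integrals are constant.
    refine tendsto_integral_of_tendsto_bounds
      (F := fun n x => ∑ j, (C₂ * B * (A j x ^ 2 + moll (k n) (fun x => D j x ^ 2) x) +
        C₁ * K * K'.indicator (fun x => |A j x|) x))
      (F₀ := fun x => ∑ j, (C₂ * B * (A j x ^ 2 + D j x ^ 2) +
        C₁ * K * K'.indicator (fun x => |A j x|) x))
      ?_ (fun n => iF _ (iM n)) (iF _ hD2) ?_ ?_ ?_ ?_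
    · refine fun n => Finset.aestronglyMeasurable_fun_sum _ fun j _ => (hA j).1.mul ?_
      exact (measurable_partialDeriv j (φ n)).aestronglyMeasurable
    · refine fun n => Eventually.of_forall fun x => ?_
      refine (Finset.abs_sum_le_sum_abs _ _).trans (Finset.sum_le_sum fun j _ => ?_)
      rw [hφd, mul_add]
      refine (abs_add_le _ _).trans (add_le_add ?_ ?_)
      · have b1 : |deriv Ψ (moll (k n) w x)| ≤ C₂ := hC₂ _ (hwn _ _)
        have b2 : |moll (k n) η x| ≤ B := abs_moll_le _ (Eventually.of_forall hB) x
        have b3 : moll (k n) (D j) x ^ 2 ≤ moll (k n) (fun x => D j x ^ 2) x :=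
          sq_moll_le _ (hDl j) (hD2 j).locallyIntegrable x
        have b4 : |A j x| * |moll (k n) (D j) x| ≤
            A j x ^ 2 + moll (k n) (fun x => D j x ^ 2) x := by
          have e1 := sq_abs (A j x)
          have e2 := sq_abs (moll (k n) (D j) x)
          nlinarith [sq_nonneg (|A j x| - |moll (k n) (D j) x|), sq_nonneg (A j x),
            sq_nonneg (moll (k n) (D j) x)]
        calc |A j x * (deriv Ψ (moll (k n) w x) * moll (k n) (D j) x * moll (k n) η x)|
            = |deriv Ψ (moll (k n) w x)| * |moll (k n) η x| *
                (|A j x| * |moll (k n) (D j) x|) := by simp only [abs_mul]; ring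
          _ ≤ _ := by gcongr
      · by_cases hx : x ∈ Metric.cthickening (mollRadius (k n)) (tsupport η)
        · rw [indicator_of_mem (hcth n hx), abs_mul, abs_mul, mul_comm |A j x|]
          gcongr
          · exact hC₁ _ (hwn _ _)
          · exact abs_moll_le _ (Eventually.of_forall
              (abs_partialDeriv_le_of_lipschitzWith hη j)) x
        · simp only [hmz n j x hx, mul_zero, abs_zero]
          exact mul_nonneg (by positivity) (indicator_nonneg (fun _ _ => abs_nonneg _) _)
    · filter_upwards [aw, aη, aD, am] with x h1 h2 h3 h4
      refine tendsto_finsetSum _ fun j _ => Tendsto.const_mul _ ?_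
      simp_rw [hφd]
      exact ((((cont_dΨ.tendsto _).comp h1).mul (h3 j)).mul h2).add
        (((hΨ.continuous.tendsto _).comp h1).mul (h4 j))
    · filter_upwards [aD2] with x h1
      exact tendsto_finsetSum _ fun j _ => (((h1 j).const_add _).const_mul _).add_const _
    · have e : ∀ n, ∫ x, ∑ j, (C₂ * B * (A j x ^ 2 + moll (k n) (fun x => D j x ^ 2) x) +
          C₁ * K * K'.indicator (fun x => |A j x|) x) =
          ∫ x, ∑ j, (C₂ * B * (A j x ^ 2 + D j x ^ 2) +
          C₁ * K * K'.indicator (fun x => |A j x|) x) := by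
        intro n
        rw [eF _ (iM n), eF _ hD2]
        simp_rw [integral_moll _ (hD2 _)]
      simp_rw [e]
      exact tendsto_const_nhds
  exact le_of_tendsto' (L2.add L1) fun n => htest _ (hφt n) (hφ0 n)

/-- The weak inequality `-div A + h ≤ 0`, tested with `Ψ(w) η`, where `A · ∇w ≥ 0` and `Ψ` is
non-decreasing. -/
theorem weak_inequality_comp {Ω : Set (Euc N)} (hΩ : IsOpen Ω) {w h : Euc N → ℝ}
    {D A : Fin N → Euc N → ℝ} {M : ℝ} (hw : MemLp w 2 (bulkMeasure Ω))
    (hwM : ∀ᵐ x ∂(bulkMeasure Ω), |w x| ≤ M)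
    (hh : MemLp h 2 (bulkMeasure Ω)) (hD : ∀ i, MemLp (D i) 2 (bulkMeasure Ω))
    (hA : ∀ i, MemLp (A i) 2 (bulkMeasure Ω)) (hweak : ∀ i, HasWeakPartial Ω i w (D i))
    (htest : ∀ φ, IsTestFunction Ω φ → (∀ x, 0 ≤ φ x) →
      (∫ x in Ω, ∑ j, A j x * partialDeriv j φ x) + ∫ x in Ω, h x * φ x ≤ 0)
    (hell : ∀ᵐ x ∂(bulkMeasure Ω), 0 ≤ ∑ j, A j x * D j x)
    {Ψ : ℝ → ℝ} (hΨ : ContDiff ℝ ∞ Ψ) (hΨ0 : ∀ s, 0 ≤ Ψ s) (hΨ' : ∀ s, 0 ≤ deriv Ψ s)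
    {η : Euc N → ℝ} {K : ℝ≥0} (hη : LipschitzWith K η) (hη0 : ∀ x, 0 ≤ η x)
    (hηs : HasCompactSupport η) (hηΩ : tsupport η ⊆ Ω) :
    (∫ x in Ω, Ψ (w x) * ∑ j, A j x * partialDeriv j η x) +
      ∫ x in Ω, h x * (Ψ (w x) * η x) ≤ 0 := by
  have hm := hΩ.measurableSet
  have ind : ∀ {f : Euc N → ℝ}, MemLp f 2 (bulkMeasure Ω) → MemLp (Ω.indicator f) 2 :=
    fun hf => (memLp_indicator_iff_restrict hm).2 hf
  have h1 : (∫ x in Ω, ∑ j, A j x * (deriv Ψ (w x) * D j x * η x + Ψ (w x) * partialDeriv j η x)) +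
      ∫ x in Ω, h x * (Ψ (w x) * η x) ≤ 0 := by
    have hwM' : ∀ᵐ x, |Ω.indicator w x| ≤ max M 0 := by
      have := (ae_restrict_iff' hm).1 hwM
      filter_upwards [this] with x hx
      by_cases hxΩ : x ∈ Ω
      · rw [indicator_of_mem hxΩ]; exact (hx hxΩ).trans (le_max_left _ _)
      · rw [indicator_of_notMem hxΩ]; simp
    have := weak_inequality_comp_aux hΩ (D := fun i => Ω.indicator (D i))
      (A := fun i => Ω.indicator (A i)) (ind hw) hwM' (ind hh)
      (fun i => ind (hD i)) (fun i => ind (hA i))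
      (fun i n x hx => partialDeriv_moll_of_hasWeakPartial n hm (hweak i)
        ((ind hw).locallyIntegrable one_le_two) hx) ?_ hΨ hΨ0 hη hη0 hηs hηΩ
    · refine le_of_eq_of_le ?_ this
      rw [← integral_indicator hm, ← integral_indicator hm]
      congr 2
      · ext x
        by_cases hx : x ∈ Ω <;> simp [hx]
      · ext x
        by_cases hx : x ∈ Ω <;> simp [hx]
    · intro φ hφ hφ0
      refine le_of_eq_of_le ?_ (htest φ hφ hφ0)
      rw [← integral_indicator hm, ← integral_indicator hm]
      congr 2
      · ext x
        by_cases hx : x ∈ Ω <;> simp [hx]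
      · ext x
        by_cases hx : x ∈ Ω <;> simp [hx]
  obtain ⟨B, hB⟩ : ∃ B, ∀ x, |η x| ≤ B := by
    obtain ⟨B, hB⟩ := hηs.exists_bound_of_continuous hη.continuous
    exact ⟨B, hB⟩
  obtain ⟨C₁, hC₁⟩ : ∃ C, ∀ s ∈ Icc (-M) M, ‖Ψ s‖ ≤ C :=
    isCompact_Icc.exists_bound_of_continuousOn hΨ.continuous.continuousOn
  obtain ⟨C₂, hC₂⟩ : ∃ C, ∀ s ∈ Icc (-M) M, ‖deriv Ψ s‖ ≤ C :=
    isCompact_Icc.exists_bound_of_continuousOn (hΨ.continuous_deriv (by simp)).continuousOn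
  have i1 : ∀ j, Integrable (fun x => A j x * (deriv Ψ (w x) * D j x * η x))
      (volume.restrict Ω) := by
    intro j
    have e : ∀ x, A j x * (deriv Ψ (w x) * D j x * η x) =
        (deriv Ψ (w x) * η x) * (A j x * D j x) := fun x => by ring
    simp_rw [e]
    refine ((hA j).integrable_mul (hD j)).bdd_mul (c := C₂ * B) ?_ ?_
    · exact ((hΨ.continuous_deriv (by simp)).comp_aestronglyMeasurable hw.1).mul
        hη.continuous.aestronglyMeasurable
    · filter_upwards [hwM] with x hx
      rw [norm_mul]
      exact mul_le_mul (hC₂ _ (abs_le.1 hx)) (hB x) (norm_nonneg _)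
        ((norm_nonneg _).trans (hC₂ _ (abs_le.1 hx)))
  have i2 : ∀ j, Integrable (fun x => A j x * (Ψ (w x) * partialDeriv j η x))
      (volume.restrict Ω) := by
    intro j
    have i3 : Integrable (fun x => A j x * partialDeriv j η x) (volume.restrict Ω) :=
      (hA j).integrable_mul ((memLp_partialDeriv_of_lipschitzWith hη hηs j).restrict Ω)
    have e : ∀ x, A j x * (Ψ (w x) * partialDeriv j η x) =
        Ψ (w x) * (A j x * partialDeriv j η x) := fun x => by ring
    simp_rw [e]
    refine i3.bdd_mul (c := C₁) (hΨ.continuous.comp_aestronglyMeasurable hw.1) ?_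
    filter_upwards [hwM] with x hx using hC₁ _ (abs_le.1 hx)
  -- The term Ψ'(w) η (A · D) is non-negative and is dropped; positive ellipticity is not needed.
  refine le_trans (add_le_add_left (integral_mono_ae ?_ ?_ ?_) _) h1
  · have : ∀ x, Ψ (w x) * ∑ j, A j x * partialDeriv j η x =
        ∑ j, A j x * (Ψ (w x) * partialDeriv j η x) := fun x => by
      rw [Finset.mul_sum]; exact Finset.sum_congr rfl fun j _ => by ring
    simp_rw [this]
    exact integrable_finsetSum _ fun j _ => i2 j
  · refine integrable_finsetSum _ fun j _ => ?_
    simp_rw [mul_add]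
    exact (i1 j).add (i2 j)
  · filter_upwards [hell] with x hx
    have : ∑ j, A j x * (deriv Ψ (w x) * D j x * η x + Ψ (w x) * partialDeriv j η x) =
        deriv Ψ (w x) * η x * ∑ j, A j x * D j x + Ψ (w x) * ∑ j, A j x * partialDeriv j η x := by
      rw [Finset.mul_sum, Finset.mul_sum, ← Finset.sum_add_distrib]
      exact Finset.sum_congr rfl fun j _ => by ring
    rw [this]
    have := mul_nonneg (mul_nonneg (hΨ' (w x)) (hη0 x)) hx
    linarith

end Testing

/-! ### Averages over boundary layers -/

theorem eLpNorm_one_mul_le {X : Type*} [MeasurableSpace X] {μ : Measure X} {f g : X → ℝ}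
    (hf : AEStronglyMeasurable f μ) (hg : AEStronglyMeasurable g μ) :
    eLpNorm (fun x => f x * g x) 1 μ ≤ eLpNorm f 2 μ * eLpNorm g 2 μ := by
  have h : eLpNorm (fun x => f x * g x) 1 μ ≤ (1 : ℝ≥0) * eLpNorm f 2 μ * eLpNorm g 2 μ :=
    eLpNorm_le_eLpNorm_mul_eLpNorm_of_nnnorm hf hg (fun a b => a * b) 1
      (Eventually.of_forall fun x => by simp)
  simpa using h

/-- The difference telescopes into a p (d - Δ) + p (a - α) Δ + α (p - P) Δ. In each term one factor
is bounded and the other two are paired by Cauchy–Schwarz. Thus L² convergence of the three factors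
to their boundary values suffices for the product in L¹. -/
theorem eLpNorm_triple_product_sub_le {X : Type*} [MeasurableSpace X] {μ : Measure X}
    {p P a α d Δ : X → ℝ} {B C : ℝ} (hp : AEStronglyMeasurable p μ)
    (hP : AEStronglyMeasurable P μ) (ha : AEStronglyMeasurable a μ)
    (hα : AEStronglyMeasurable α μ) (hd : AEStronglyMeasurable d μ)
    (hΔ : AEStronglyMeasurable Δ μ) (hpB : ∀ᵐ x ∂μ, |p x| ≤ B) (haC : ∀ᵐ x ∂μ, |a x| ≤ C)
    (hαC : ∀ᵐ x ∂μ, |α x| ≤ C) :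
    eLpNorm (fun x => p x * a x * d x - P x * α x * Δ x) 1 μ ≤
      ENNReal.ofReal C * ((eLpNorm (fun x => p x - P x) 2 μ + eLpNorm P 2 μ) *
        eLpNorm (fun x => d x - Δ x) 2 μ) +
      ENNReal.ofReal B * (eLpNorm (fun x => a x - α x) 2 μ * eLpNorm Δ 2 μ) +
      ENNReal.ofReal C * (eLpNorm (fun x => p x - P x) 2 μ * eLpNorm Δ 2 μ) := by
  have hp2 : eLpNorm p 2 μ ≤ eLpNorm (fun x => p x - P x) 2 μ + eLpNorm P 2 μ := by
    have := eLpNorm_add_le (hp.sub hP) hP one_le_two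
    rwa [sub_add_cancel] at this
  have e : (fun x => p x * a x * d x - P x * α x * Δ x) =
      ((fun x => a x * (p x * (d x - Δ x))) + fun x => p x * ((a x - α x) * Δ x)) +
        fun x => α x * ((p x - P x) * Δ x) := by
    ext x; simp only [Pi.add_apply]; ring
  rw [e]
  have m1 : AEStronglyMeasurable (fun x => a x * (p x * (d x - Δ x))) μ :=
    ha.mul (hp.mul (hd.sub hΔ))
  have m2 : AEStronglyMeasurable (fun x => p x * ((a x - α x) * Δ x)) μ :=
    hp.mul ((ha.sub hα).mul hΔ)
  have m3 : AEStronglyMeasurable (fun x => α x * ((p x - P x) * Δ x)) μ :=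
    hα.mul ((hp.sub hP).mul hΔ)
  have bd : ∀ {c f : X → ℝ} {M : ℝ}, (∀ᵐ x ∂μ, |c x| ≤ M) →
      eLpNorm (fun x => c x * f x) 1 μ ≤ ENNReal.ofReal M * eLpNorm f 1 μ := by
    intro c f M hc
    refine eLpNorm_le_mul_eLpNorm_of_ae_le_mul ?_ 1
    filter_upwards [hc] with x hx
    rw [norm_mul]
    exact mul_le_mul_of_nonneg_right hx (norm_nonneg _)
  refine (eLpNorm_add_le (m1.add m2) m3 le_rfl).trans (add_le_add
    ((eLpNorm_add_le m1 m2 le_rfl).trans (add_le_add ?_ ?_)) ?_)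
  · refine (bd haC).trans (mul_le_mul_right ((eLpNorm_one_mul_le hp (hd.sub hΔ)).trans ?_) _)
    exact mul_le_mul_left hp2 _
  · exact (bd hpB).trans (mul_le_mul_right (eLpNorm_one_mul_le (ha.sub hα) hΔ) _)
  · exact (bd hαC).trans (mul_le_mul_right (eLpNorm_one_mul_le (hp.sub hP) hΔ) _)

/-- Lebesgue measure on a bounded part of the boundary layer of width `ε`, divided by `ε`. -/
def layerAvg {N : ℕ} (Ω : Set (Euc N)) (R ε : ℝ) : Measure (Euc N) :=
  (ENNReal.ofReal ε)⁻¹ • volume.restrict (boundaryLayer Ω ε ∩ Metric.ball 0 R)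

theorem layerAvg_absolutelyContinuous {N : ℕ} (Ω : Set (Euc N)) (R ε : ℝ) :
    layerAvg Ω R ε ≪ volume.restrict (boundaryLayer Ω ε) :=
  (Measure.absolutelyContinuous_of_le (Measure.restrict_mono inter_subset_left le_rfl)).smul_left _

theorem layerAvg_absolutelyContinuous_bulk {N : ℕ} (Ω : Set (Euc N)) (R ε : ℝ) :
    layerAvg Ω R ε ≪ bulkMeasure Ω :=
  (layerAvg_absolutelyContinuous Ω R ε).trans
    (Measure.absolutelyContinuous_of_le (Measure.restrict_mono inter_subset_left le_rfl))

theorem eLpNorm_two_eq {X : Type*} [MeasurableSpace X] (μ : Measure X) (f : X → ℝ) :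
    eLpNorm f 2 μ = (∫⁻ x, ‖f x‖ₑ ^ 2 ∂μ) ^ (1 / 2 : ℝ) := by
  rw [eLpNorm_eq_lintegral_rpow_enorm_toReal two_ne_zero ENNReal.ofNat_ne_top]
  simp

theorem HasBoundaryValue.tendsto_eLpNorm {N : ℕ} {Ω : Set (Euc N)} {v h : Euc N → ℝ}
    (hv : HasBoundaryValue Ω v h) {R : ℝ} (hR : 0 < R) :
    Tendsto (fun ε => eLpNorm (fun y => v y - h (nearestBoundaryPoint Ω y)) 2 (layerAvg Ω R ε))
      (𝓝[>] 0) (𝓝 0) := by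
  have h1 := hv.2.2 R hR
  have h2 : Tendsto (fun x : ℝ≥0∞ => x ^ (1 / 2 : ℝ)) (𝓝 0) (𝓝 0) := by
    have := (ENNReal.continuous_rpow_const (y := (1 / 2 : ℝ))).tendsto 0
    simpa using this
  refine (h2.comp h1).congr fun ε => ?_
  rw [eLpNorm_two_eq, layerAvg, lintegral_smul_measure]
  rfl

/-- The factor ε in the projection estimate cancels the 1/ε of the average; local square
integrability of h on ∂Ω does the rest. -/
theorem eLpNorm_comp_nearestBoundaryPoint_le {N : ℕ} (hN : 1 ≤ N) {Ω : Set (Euc N)}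
    (hΩ : IsSmoothDomain Ω) (hne : Ω ≠ univ) {v h : Euc N → ℝ} (hv : HasBoundaryValue Ω v h)
    {R : ℝ} (hR : 0 < R) : ∃ C : ℝ≥0∞, C ≠ ⊤ ∧ ∀ ε ∈ Ioc (0 : ℝ) 1,
      eLpNorm (fun y => h (nearestBoundaryPoint Ω y)) 2 (layerAvg Ω R ε) ≤ C := by
  obtain ⟨C, hC⟩ := lintegral_comp_nearestBoundaryPoint_le hN hΩ hne R
  set I := ∫⁻ x in Metric.ball 0 (R + 2), ‖h x‖ₑ ^ 2 ∂(surfaceMeasure Ω) with hI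
  have hIt : I < ⊤ := hv.2.1 (R + 2) (by linarith)
  refine ⟨(C * I) ^ (1 / 2 : ℝ), ?_, ?_⟩
  · exact ENNReal.rpow_ne_top_of_nonneg (by norm_num) (ENNReal.mul_ne_top ENNReal.coe_ne_top hIt.ne)
  · intro ε hε
    rw [eLpNorm_two_eq, layerAvg, lintegral_smul_measure, smul_eq_mul]
    refine ENNReal.rpow_le_rpow ?_ (by norm_num)
    have h1 := hC ε hε (fun x => ‖h x‖ₑ ^ 2) (hv.1.enorm.pow_const 2)
    have hε0 : ENNReal.ofReal ε ≠ 0 := (ENNReal.ofReal_pos.2 hε.1).ne'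
    calc _ ≤ (ENNReal.ofReal ε)⁻¹ * (C * ENNReal.ofReal ε * I) := mul_le_mul_right h1 _
      _ = (ENNReal.ofReal ε)⁻¹ * ENNReal.ofReal ε * (C * I) := by ring
      _ = C * I := by rw [ENNReal.inv_mul_cancel hε0 ENNReal.ofReal_ne_top, one_mul]

theorem HasBoundaryValue.sub {N : ℕ} (hN : 1 ≤ N) {Ω : Set (Euc N)} (hΩ : IsSmoothDomain Ω)
    {v₁ v₂ h₁ h₂ : Euc N → ℝ} (hv₁ : HasBoundaryValue Ω v₁ h₁) (hv₂ : HasBoundaryValue Ω v₂ h₂)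
    (hm : AEStronglyMeasurable v₁ (bulkMeasure Ω)) :
    HasBoundaryValue Ω (fun x => v₁ x - v₂ x) (fun x => h₁ x - h₂ x) := by
  have sq : ∀ a b : ℝ, ‖a - b‖ₑ ^ 2 ≤ 2 * ‖a‖ₑ ^ 2 + 2 * ‖b‖ₑ ^ 2 := by
    intro a b
    have e : ∀ z : ℝ, ‖z‖ₑ ^ 2 = ENNReal.ofReal (z ^ 2) := by
      intro z
      rw [← ofReal_norm, ← ENNReal.ofReal_pow (norm_nonneg _), Real.norm_eq_abs, sq_abs]
    have e2 : (2 : ℝ≥0∞) = ENNReal.ofReal 2 := by simp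
    rw [e, e, e, e2, ← ENNReal.ofReal_mul (by norm_num), ← ENNReal.ofReal_mul (by norm_num),
      ← ENNReal.ofReal_add (by positivity) (by positivity)]
    exact ENNReal.ofReal_le_ofReal (by nlinarith [sq_nonneg (a + b)])
  refine ⟨hv₁.1.sub hv₂.1, fun R hR => ?_, fun R hR => ?_⟩
  · calc _ ≤ ∫⁻ x in Metric.ball 0 R, (2 * ‖h₁ x‖ₑ ^ 2 + 2 * ‖h₂ x‖ₑ ^ 2) ∂(surfaceMeasure Ω) :=
          lintegral_mono fun x => sq _ _
      _ = 2 * ∫⁻ x in Metric.ball 0 R, ‖h₁ x‖ₑ ^ 2 ∂(surfaceMeasure Ω) +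
          2 * ∫⁻ x in Metric.ball 0 R, ‖h₂ x‖ₑ ^ 2 ∂(surfaceMeasure Ω) := by
          rw [lintegral_add_left' ((hv₁.1.enorm.pow_const 2).restrict.const_mul 2),
            lintegral_const_mul' _ _ (by simp), lintegral_const_mul' _ _ (by simp)]
      _ < ⊤ := ENNReal.add_lt_top.2 ⟨ENNReal.mul_lt_top (by simp) (hv₁.2.1 R hR),
          ENNReal.mul_lt_top (by simp) (hv₂.2.1 R hR)⟩
  -- The whole space has empty frontier, so its layers are empty; the facts on the projection assume
  -- a boundary.
  · by_cases hne : Ω = univ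
    · have : ∀ ε : ℝ, Ω ∩ Metric.thickening ε (frontier Ω) ∩ Metric.ball 0 R = ∅ := by
        intro ε; simp [hne]
      simp_rw [this]
      simp
    · have hlim := ((ENNReal.Tendsto.const_mul (hv₁.2.2 R hR) (Or.inr (by simp : (2 : ℝ≥0∞) ≠ ⊤))).add
        (ENNReal.Tendsto.const_mul (hv₂.2.2 R hR) (Or.inr (by simp : (2 : ℝ≥0∞) ≠ ⊤))))
      simp only [mul_zero, add_zero] at hlim
      refine tendsto_of_tendsto_of_tendsto_of_le_of_le' tendsto_const_nhds hlim
        (Eventually.of_forall fun _ => zero_le) ?_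
      filter_upwards [Ioc_mem_nhdsGT (zero_lt_one : (0 : ℝ) < 1)] with ε hε
      set S := Ω ∩ Metric.thickening ε (frontier Ω) ∩ Metric.ball 0 R with hS
      have hm1 : AEMeasurable (fun y => ‖v₁ y - h₁ (nearestBoundaryPoint Ω y)‖ₑ ^ 2)
          (volume.restrict S) := by
        have i1 : AEStronglyMeasurable v₁ (volume.restrict S) :=
          hm.mono_measure (Measure.restrict_mono (inter_subset_left.trans inter_subset_left) le_rfl)
        have i2 : AEStronglyMeasurable (fun y => h₁ (nearestBoundaryPoint Ω y))
          (volume.restrict S) := (aestronglyMeasurable_comp_nearestBoundaryPoint hN hΩ hne hε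
            hv₁.1).mono_measure (Measure.restrict_mono inter_subset_left le_rfl)
        exact (i1.sub i2).enorm.pow_const 2
      calc _ ≤ (ENNReal.ofReal ε)⁻¹ * ∫⁻ y in S,
            (2 * ‖v₁ y - h₁ (nearestBoundaryPoint Ω y)‖ₑ ^ 2 +
              2 * ‖v₂ y - h₂ (nearestBoundaryPoint Ω y)‖ₑ ^ 2) := by
            refine mul_le_mul_right (lintegral_mono fun y => ?_) _
            have := sq (v₁ y - h₁ (nearestBoundaryPoint Ω y)) (v₂ y - h₂ (nearestBoundaryPoint Ω y))
            rwa [sub_sub_sub_comm] at this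
        _ = _ := by
            rw [lintegral_add_left' (hm1.const_mul 2), lintegral_const_mul' _ _ (by simp),
              lintegral_const_mul' _ _ (by simp)]
            ring

/-! ### The boundary term -/

/-- All three factors converge to their boundary values in quadratic layer mean: w and d by
assumption, a as part of its regularity, q(w) because q is Lipschitz. The condition q 0 = 0 gives
|q(tw)| ≤ K |tw|, hence the L² bound of the boundary value of q(w). -/
theorem tendsto_eLpNorm_flux {N : ℕ} (hN : 1 ≤ N) {Ω : Set (Euc N)}
    (hΩ : IsSmoothDomain Ω) (hne : Ω ≠ univ) {w tw d td a : Euc N → ℝ}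
    (hw : HasBoundaryValue Ω w tw) (hd : HasBoundaryValue Ω d td) (ha : HasBoundaryValue Ω a a)
    (hwm : AEStronglyMeasurable w (bulkMeasure Ω)) (hdm : AEStronglyMeasurable d (bulkMeasure Ω))
    (ham : AEStronglyMeasurable a (bulkMeasure Ω)) {C : ℝ}
    (haC : ∀ᵐ x ∂(bulkMeasure Ω), |a x| ≤ C) (haC' : ∀ᵐ x ∂(surfaceMeasure Ω), |a x| ≤ C)
    {q : ℝ → ℝ} {K : ℝ≥0} {B : ℝ} (hq : LipschitzWith K q) (hqB : ∀ s, |q s| ≤ B) (hq0 : q 0 = 0)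
    {R : ℝ} (hR : 0 < R) :
    Tendsto (fun ε => eLpNorm (fun y => q (w y) * a y * d y -
      q (tw (nearestBoundaryPoint Ω y)) * a (nearestBoundaryPoint Ω y) *
        td (nearestBoundaryPoint Ω y)) 1 (layerAvg Ω R ε)) (𝓝[>] 0) (𝓝 0) := by
  obtain ⟨Cw, hCwt, hCw⟩ := eLpNorm_comp_nearestBoundaryPoint_le hN hΩ hne hw hR
  obtain ⟨Cd, hCdt, hCd⟩ := eLpNorm_comp_nearestBoundaryPoint_le hN hΩ hne hd hR
  set π := nearestBoundaryPoint Ω with hπ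
  set X : ℝ → ℝ≥0∞ := fun ε => K * eLpNorm (fun y => w y - tw (π y)) 2 (layerAvg Ω R ε) with hX
  set Y : ℝ → ℝ≥0∞ := fun ε => eLpNorm (fun y => a y - a (π y)) 2 (layerAvg Ω R ε) with hY
  set Z : ℝ → ℝ≥0∞ := fun ε => eLpNorm (fun y => d y - td (π y)) 2 (layerAvg Ω R ε) with hZ
  have tX : Tendsto X (𝓝[>] 0) (𝓝 0) := by
    have := ENNReal.Tendsto.const_mul (hw.tendsto_eLpNorm hR)
      (Or.inr (ENNReal.coe_ne_top : (K : ℝ≥0∞) ≠ ⊤))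
    simpa using this
  have tY : Tendsto Y (𝓝[>] 0) (𝓝 0) := ha.tendsto_eLpNorm hR
  have tZ : Tendsto Z (𝓝[>] 0) (𝓝 0) := hd.tendsto_eLpNorm hR
  have hlim : Tendsto (fun ε => ENNReal.ofReal C * ((X ε + K * Cw) * Z ε) +
      ENNReal.ofReal B * (Y ε * Cd) + ENNReal.ofReal C * (X ε * Cd)) (𝓝[>] 0) (𝓝 0) := by
    have hKC : (K : ℝ≥0∞) * Cw ≠ ⊤ := ENNReal.mul_ne_top ENNReal.coe_ne_top hCwt
    have t1 : Tendsto (fun ε => (X ε + K * Cw) * Z ε) (𝓝[>] 0) (𝓝 ((0 + K * Cw) * 0)) :=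
      ENNReal.Tendsto.mul (tX.add tendsto_const_nhds) (Or.inr ENNReal.zero_ne_top) tZ
        (Or.inr (by simpa using hKC))
    have t2 : Tendsto (fun ε => Y ε * Cd) (𝓝[>] 0) (𝓝 (0 * Cd)) :=
      ENNReal.Tendsto.mul_const tY (Or.inr hCdt)
    have t3 : Tendsto (fun ε => X ε * Cd) (𝓝[>] 0) (𝓝 (0 * Cd)) :=
      ENNReal.Tendsto.mul_const tX (Or.inr hCdt)
    have := ((ENNReal.Tendsto.const_mul t1 (Or.inr (ENNReal.ofReal_ne_top (r := C)))).add
      (ENNReal.Tendsto.const_mul t2 (Or.inr (ENNReal.ofReal_ne_top (r := B))))).add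
      (ENNReal.Tendsto.const_mul t3 (Or.inr (ENNReal.ofReal_ne_top (r := C))))
    simpa using this
  refine tendsto_of_tendsto_of_tendsto_of_le_of_le' tendsto_const_nhds hlim
    (Eventually.of_forall fun _ => zero_le) ?_
  filter_upwards [Ioc_mem_nhdsGT (zero_lt_one : (0 : ℝ) < 1)] with ε hε
  have ac1 := layerAvg_absolutelyContinuous_bulk Ω R ε
  have ac2 := layerAvg_absolutelyContinuous Ω R ε
  have mπ : ∀ {f : Euc N → ℝ}, AEStronglyMeasurable f (surfaceMeasure Ω) →
      AEStronglyMeasurable (fun y => f (π y)) (layerAvg Ω R ε) := fun hf =>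
    (aestronglyMeasurable_comp_nearestBoundaryPoint hN hΩ hne hε hf).mono_ac ac2
  have qm : AEStronglyMeasurable (fun y => q (w y)) (layerAvg Ω R ε) :=
    hq.continuous.comp_aestronglyMeasurable (hwm.mono_ac ac1)
  have Qm : AEStronglyMeasurable (fun y => q (tw (π y))) (layerAvg Ω R ε) :=
    hq.continuous.comp_aestronglyMeasurable (mπ hw.1)
  have e1 : eLpNorm (fun y => q (w y) - q (tw (π y))) 2 (layerAvg Ω R ε) ≤ X ε := by
    rw [hX]
    have := eLpNorm_le_mul_eLpNorm_of_ae_le_mul (μ := layerAvg Ω R ε) (c := K)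
      (f := fun y => q (w y) - q (tw (π y))) (g := fun y => w y - tw (π y))
      (Eventually.of_forall fun y => by
        simpa [dist_eq_norm] using hq.dist_le_mul (w y) (tw (π y))) 2
    simpa using this
  have e2 : eLpNorm (fun y => q (tw (π y))) 2 (layerAvg Ω R ε) ≤ K * Cw := by
    have := eLpNorm_le_mul_eLpNorm_of_ae_le_mul (μ := layerAvg Ω R ε) (c := K)
      (f := fun y => q (tw (π y))) (g := fun y => tw (π y))
      (Eventually.of_forall fun y => by
        simpa [dist_eq_norm, hq0] using hq.dist_le_mul (tw (π y)) 0) 2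
    refine this.trans ?_
    rw [ENNReal.ofReal_coe_nnreal]
    exact mul_le_mul_right (hCw ε hε) _
  have e3 : eLpNorm (fun y => td (π y)) 2 (layerAvg Ω R ε) ≤ Cd := hCd ε hε
  refine (eLpNorm_triple_product_sub_le qm Qm (ham.mono_ac ac1) (mπ ha.1) (hdm.mono_ac ac1)
    (mπ hd.1) (B := B) (Eventually.of_forall fun _ => hqB _) (ac1.ae_le haC)
    (ac2.ae_le (ae_nearestBoundaryPoint hN hΩ hne hε haC'))).trans ?_
  gcongr

/-- Composing Ψ with the clamp to [-M, M] changes nothing at the values of a function bounded by M.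
The global Lipschitz constant is needed since the trace carries no bound. -/
theorem exists_truncation {Ψ : ℝ → ℝ} (hΨ : ContDiff ℝ ∞ Ψ) (hΨ0 : ∀ s, 0 ≤ Ψ s)
    (hΨn : ∀ s ≤ 0, Ψ s = 0) {M : ℝ} (hM : 0 ≤ M) :
    ∃ (q : ℝ → ℝ) (K : ℝ≥0) (B : ℝ), LipschitzWith K q ∧ (∀ s, |q s| ≤ B) ∧
      (∀ s, |s| ≤ M → q s = Ψ s) ∧ (∀ s ≤ 0, q s = 0) ∧ ∀ s, 0 ≤ q s := by
  obtain ⟨C₁, hC₁⟩ : ∃ C, ∀ s ∈ Icc (-M) M, ‖Ψ s‖ ≤ C :=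
    isCompact_Icc.exists_bound_of_continuousOn hΨ.continuous.continuousOn
  obtain ⟨C₂, hC₂⟩ : ∃ C, ∀ s ∈ Icc (-M) M, ‖deriv Ψ s‖ ≤ C :=
    isCompact_Icc.exists_bound_of_continuousOn (hΨ.continuous_deriv (by simp)).continuousOn
  have hL : LipschitzOnWith C₂.toNNReal Ψ (Icc (-M) M) :=
    (convex_Icc _ _).lipschitzOnWith_of_nnnorm_deriv_le
      (fun s _ => (hΨ.differentiable (by simp)) s) fun s hs => by
        rw [← NNReal.coe_le_coe, coe_nnnorm]
        exact (hC₂ s hs).trans (Real.le_coe_toNNReal _)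
  have hc : LipschitzWith 1 fun s : ℝ => max (-M) (min M s) :=
    (LipschitzWith.id.const_min M).const_max (-M)
  have hmem : ∀ s : ℝ, max (-M) (min M s) ∈ Icc (-M) M := fun s =>
    ⟨le_max_left _ _, max_le (by linarith) (min_le_left _ _)⟩
  refine ⟨fun s => Ψ (max (-M) (min M s)), C₂.toNNReal * 1, C₁, ?_, fun s => hC₁ _ (hmem s), ?_,
    fun s hs => hΨn _ (max_le (by linarith) ((min_le_right _ _).trans hs)), fun s => hΨ0 _⟩
  · rw [← lipschitzOnWith_univ] at hc ⊢
    exact hL.comp hc fun s _ => hmem s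
  · intro s hs
    rw [abs_le] at hs
    simp only
    rw [min_eq_right hs.2, max_eq_right hs.1]

/-! ### Cutoff functions near the boundary -/

theorem smoothTransition_deriv_bound : ∃ C : ℝ, 0 ≤ C ∧ ∀ s, |deriv Real.smoothTransition s| ≤ C := by
  have hc : Continuous (deriv Real.smoothTransition) :=
    (Real.smoothTransition.contDiff (n := 1)).continuous_deriv le_rfl
  obtain ⟨C, hC⟩ := isCompact_Icc (a := (0 : ℝ)) (b := 1) |>.exists_bound_of_continuousOn
    hc.continuousOn
  have hC0 : 0 ≤ C := (norm_nonneg _).trans (hC 0 (by simp))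
  refine ⟨C, hC0, fun s => ?_⟩
  by_cases hs : s ∈ Icc (0 : ℝ) 1
  · exact hC s hs
  · have : deriv Real.smoothTransition s = 0 := by
      rw [mem_Icc, not_and_or, not_le, not_le] at hs
      rcases hs with hs | hs
      · apply IsLocalMin.deriv_eq_zero
        refine Eventually.of_forall fun y => ?_
        rw [Real.smoothTransition.zero_of_nonpos hs.le]
        exact Real.smoothTransition.nonneg y
      · apply IsLocalMax.deriv_eq_zero
        refine Eventually.of_forall fun y => ?_
        rw [Real.smoothTransition.one_of_one_le hs.le]
        exact Real.smoothTransition.le_one y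
    rw [this, abs_zero]; exact hC0

theorem deriv_smoothTransition_of_one_le {s : ℝ} (hs : 1 ≤ s) :
    deriv Real.smoothTransition s = 0 := by
  apply IsLocalMax.deriv_eq_zero
  refine Eventually.of_forall fun y => ?_
  rw [Real.smoothTransition.one_of_one_le hs]
  exact Real.smoothTransition.le_one y

theorem deriv_smoothTransition_nonneg (s : ℝ) : 0 ≤ deriv Real.smoothTransition s :=
  Real.smoothTransition.monotone.deriv_nonneg

/-- A cutoff function which vanishes at distance at most `ε / 2` from the complement of `Ω` and is
`1` at distance at least `ε`. -/
def innerCutoff {N : ℕ} (Ω : Set (Euc N)) (ε : ℝ) (y : Euc N) : ℝ :=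
  Real.smoothTransition (2 / ε * Metric.infDist y Ωᶜ - 1)

theorem innerCutoff_nonneg {N : ℕ} (Ω : Set (Euc N)) (ε : ℝ) (y : Euc N) : 0 ≤ innerCutoff Ω ε y :=
  Real.smoothTransition.nonneg _

theorem innerCutoff_le_one {N : ℕ} (Ω : Set (Euc N)) (ε : ℝ) (y : Euc N) : innerCutoff Ω ε y ≤ 1 :=
  Real.smoothTransition.le_one _

theorem exists_lipschitzWith_innerCutoff {N : ℕ} (Ω : Set (Euc N)) (ε : ℝ) :
    ∃ K, LipschitzWith K (innerCutoff Ω ε) := by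
  obtain ⟨C, hC0, hC⟩ := smoothTransition_deriv_bound
  have h1 : LipschitzWith C.toNNReal Real.smoothTransition :=
    lipschitzWith_of_nnnorm_deriv_le
      ((Real.smoothTransition.contDiff (n := 1)).differentiable one_ne_zero) fun s => by
        rw [← NNReal.coe_le_coe, coe_nnnorm]
        exact (hC s).trans (Real.le_coe_toNNReal _)
  have h2 : LipschitzWith (‖2 / ε‖₊ * 1 + 0) fun y : Euc N =>
      2 / ε * Metric.infDist y Ωᶜ - 1 := by
    have h3 : LipschitzWith (‖2 / ε‖₊ * 1) fun y : Euc N => 2 / ε * Metric.infDist y Ωᶜ :=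
      (lipschitzWith_smul (2 / ε)).comp (Metric.lipschitz_infDist_pt Ωᶜ)
    exact h3.sub (LipschitzWith.const 1)
  exact ⟨_, h1.comp h2⟩

theorem LipschitzWith.mul_bounded {X : Type*} [PseudoMetricSpace X] {f g : X → ℝ} {K L : ℝ≥0}
    (hf : LipschitzWith K f) (hg : LipschitzWith L g) {A B : ℝ≥0} (hA : ∀ x, |f x| ≤ A)
    (hB : ∀ x, |g x| ≤ B) : LipschitzWith (A * L + B * K) fun x => f x * g x := by
  refine LipschitzWith.of_dist_le_mul fun x y => ?_
  have h1 := hf.dist_le_mul x y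
  have h2 := hg.dist_le_mul x y
  rw [Real.dist_eq] at h1 h2 ⊢
  have e : f x * g x - f y * g y = f x * (g x - g y) + g y * (f x - f y) := by ring
  rw [e]
  refine (abs_add_le _ _).trans ?_
  rw [abs_mul, abs_mul]
  calc _ ≤ A * (L * dist x y) + B * (K * dist x y) := by
        gcongr
        · exact hA x
        · exact hB y
    _ = _ := by push_cast; ring

theorem partialDeriv_mul_innerCutoff {N : ℕ} {Ω : Set (Euc N)} {ε : ℝ} {χ : Euc N → ℝ}
    (hχ : Differentiable ℝ χ) {y : Euc N}
    (hd : DifferentiableAt ℝ (fun z => Metric.infDist z Ωᶜ) y) (j : Fin N) :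
    partialDeriv j (fun y => χ y * innerCutoff Ω ε y) y =
      innerCutoff Ω ε y * partialDeriv j χ y +
      χ y * (deriv Real.smoothTransition (2 / ε * Metric.infDist y Ωᶜ - 1) * (2 / ε)) *
        partialDeriv j (fun z => Metric.infDist z Ωᶜ) y := by
  have h1 : HasFDerivAt (fun y => 2 / ε * Metric.infDist y Ωᶜ - 1)
      ((2 / ε) • fderiv ℝ (fun z => Metric.infDist z Ωᶜ) y) y :=
    (hd.hasFDerivAt.const_mul (2 / ε)).sub_const 1
  have h2 : HasFDerivAt (innerCutoff Ω ε)
      (deriv Real.smoothTransition (2 / ε * Metric.infDist y Ωᶜ - 1) •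
        ((2 / ε) • fderiv ℝ (fun z => Metric.infDist z Ωᶜ) y)) y :=
    (((Real.smoothTransition.contDiff (n := 1)).differentiable one_ne_zero)
      _).hasDerivAt.comp_hasFDerivAt y h1
  have h3 := ((hχ y).hasFDerivAt.mul h2).fderiv
  rw [partialDeriv]
  refine (congrArg (fun L => L (EuclideanSpace.single j 1)) h3).trans ?_
  simp only [partialDeriv, add_apply, smul_apply, smul_eq_mul]
  ring

theorem tsupport_mul_innerCutoff {N : ℕ} {Ω : Set (Euc N)} {ε : ℝ} (hε : 0 < ε) (χ : Euc N → ℝ) :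
    tsupport (fun y => χ y * innerCutoff Ω ε y) ⊆ Ω := by
  have h : tsupport (fun y => χ y * innerCutoff Ω ε y) ⊆ {y | ε / 2 ≤ Metric.infDist y Ωᶜ} := by
    refine closure_minimal (fun y hy => ?_)
      (isClosed_le continuous_const (Metric.continuous_infDist_pt _))
    by_contra hlt
    rw [mem_ofPred_eq, not_le] at hlt
    apply hy
    have : innerCutoff Ω ε y = 0 := by
      apply Real.smoothTransition.zero_of_nonpos
      have : 2 / ε * Metric.infDist y Ωᶜ ≤ 2 / ε * (ε / 2) := by gcongr
      have e : 2 / ε * (ε / 2) = 1 := by field_simp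
      linarith
    simp [this]
  intro y hy
  by_contra hy2
  have := h hy
  rw [mem_ofPred_eq, Metric.infDist_zero_of_mem (show y ∈ Ωᶜ from hy2)] at this
  linarith

theorem abs_outerNormal_le {N : ℕ} {Ω : Set (Euc N)} (hΩ : IsSmoothDomain Ω) {p : Euc N}
    (hp : p ∈ frontier Ω) (j : Fin N) : |outerNormal Ω p j| ≤ 1 := by
  obtain ⟨ρ, hρ, hn⟩ := exists_isOuterNormalAt hΩ hp
  have h1 : ‖outerNormal Ω p‖ ≤ 1 := by
    rw [hn, norm_smul, norm_inv, norm_norm]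
    exact inv_mul_le_one
  exact (PiLp.norm_apply_le (outerNormal Ω p) j).trans h1

/-! ### The weak inequality up to the boundary -/

theorem integrable_mul_sum_partialDeriv {N : ℕ} {Ω : Set (Euc N)} {A : Fin N → Euc N → ℝ}
    (hA : ∀ i, MemLp (A i) 2 (bulkMeasure Ω)) {c : Euc N → ℝ} {C : ℝ}
    (hcm : AEStronglyMeasurable c (bulkMeasure Ω)) (hc : ∀ᵐ x ∂(bulkMeasure Ω), |c x| ≤ C)
    {η : Euc N → ℝ} {K : ℝ≥0} (hη : LipschitzWith K η) (hηs : HasCompactSupport η) :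
    Integrable (fun x => c x * ∑ j, A j x * partialDeriv j η x) (bulkMeasure Ω) :=
  (integrable_finsetSum _ fun j _ => (hA j).integrable_mul
    ((memLp_partialDeriv_of_lipschitzWith hη hηs j).restrict Ω)).bdd_mul (c := C) hcm hc

/-- The boundary term that arises from cutting off close to the boundary is non-negative up to
an error that is controlled by averages over the boundary layer. -/
theorem boundary_term_ge {N : ℕ} (hN : 1 ≤ N) {Ω : Set (Euc N)} (hΩ : IsSmoothDomain Ω)
    (hne : Ω ≠ univ) {a : Fin N → Fin N → Euc N → ℝ} {D tD : Fin N → Euc N → ℝ}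
    {w tw : Euc N → ℝ} {q : ℝ → ℝ} (hq0 : ∀ s, 0 ≤ q s) (hqn : ∀ s ≤ 0, q s = 0)
    (hsign : ∀ᵐ x ∂(surfaceMeasure Ω),
      tw x ≤ 0 ∨ ∑ i, ∑ j, a i j x * outerNormal Ω x j * tD i x ≤ 0)
    {χ : Euc N → ℝ} (hχ0 : ∀ x, 0 ≤ χ x) {Cχ R : ℝ} (hCχ : ∀ x, χ x ≤ Cχ)
    (hR : ∀ x, x ∉ Metric.ball 0 R → χ x = 0) {Cθ : ℝ}
    (hCθ : ∀ s, |deriv Real.smoothTransition s| ≤ Cθ) {ε : ℝ} (hε : ε ∈ Ioc (0 : ℝ) 1)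
    (hfin : ∀ i j, Integrable (fun y => q (w y) * a i j y * D i y -
      q (tw (nearestBoundaryPoint Ω y)) * a i j (nearestBoundaryPoint Ω y) *
        tD i (nearestBoundaryPoint Ω y)) (layerAvg Ω R ε))
    (hint : Integrable (fun y => q (w y) *
      (χ y * (deriv Real.smoothTransition (2 / ε * Metric.infDist y Ωᶜ - 1) * (2 / ε))) *
      ∑ j, (∑ i, a i j y * D i y) * partialDeriv j (fun z => Metric.infDist z Ωᶜ) y)
      (bulkMeasure Ω)) :
    -(2 * Cχ * Cθ * ∑ i, ∑ j, ∫ y, |q (w y) * a i j y * D i y -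
      q (tw (nearestBoundaryPoint Ω y)) * a i j (nearestBoundaryPoint Ω y) *
        tD i (nearestBoundaryPoint Ω y)| ∂(layerAvg Ω R ε)) ≤
    ∫ y in Ω, q (w y) *
      (χ y * (deriv Real.smoothTransition (2 / ε * Metric.infDist y Ωᶜ - 1) * (2 / ε))) *
      ∑ j, (∑ i, a i j y * D i y) * partialDeriv j (fun z => Metric.infDist z Ωᶜ) y := by
  set π := nearestBoundaryPoint Ω with hπ
  set f : Fin N → Fin N → Euc N → ℝ := fun i j y => q (w y) * a i j y * D i y -
    q (tw (π y)) * a i j (π y) * tD i (π y) with hf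
  set S := boundaryLayer Ω ε ∩ Metric.ball 0 R with hS
  have hSm : MeasurableSet S :=
    (measurableSet_boundaryLayer hΩ.1 ε).inter Metric.isOpen_ball.measurableSet
  have hSΩ : S ⊆ Ω := inter_subset_left.trans inter_subset_left
  have hε0 : (ENNReal.ofReal ε)⁻¹ ≠ 0 := ENNReal.inv_ne_zero.2 ENNReal.ofReal_ne_top
  have hεt : (ENNReal.ofReal ε)⁻¹ ≠ ⊤ := ENNReal.inv_ne_top.2 (ENNReal.ofReal_pos.2 hε.1).ne'
  have hfi : ∀ i j, Integrable (fun y => |f i j y|) (volume.restrict S) := fun i j =>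
    ((integrable_smul_measure hε0 hεt).1 (hfin i j)).abs
  have hCθ0 : 0 ≤ Cθ := (abs_nonneg _).trans (hCθ 0)
  have hCχ0 : 0 ≤ Cχ := (hχ0 0).trans (hCχ 0)
  -- The error is written as an integral over Ω, so that the claim reduces to a pointwise
  -- inequality; the 1/ε of the average matches the size 2/ε of the gradient of the cutoff.
  have e1 : -(2 * Cχ * Cθ * ∑ i, ∑ j, ∫ y, |f i j y| ∂(layerAvg Ω R ε)) =
      ∫ y in Ω, S.indicator (fun y => -(2 * Cχ * Cθ / ε) * ∑ i, ∑ j, |f i j y|) y := by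
    rw [setIntegral_indicator hSm, inter_eq_self_of_subset_right hSΩ, integral_const_mul,
      integral_finsetSum _ fun i _ => integrable_finsetSum _ fun j _ => hfi i j]
    have : ∀ i, ∫ y in S, ∑ j, |f i j y| = ∑ j, ∫ y in S, |f i j y| := fun i =>
      integral_finsetSum _ fun j _ => hfi i j
    simp_rw [this, layerAvg, ← hS, integral_smul_measure, ENNReal.toReal_inv,
      ENNReal.toReal_ofReal hε.1.le, smul_eq_mul, ← Finset.mul_sum]
    field_simp
  rw [e1]
  refine integral_mono_ae ?_ hint ?_
  · rw [integrable_indicator_iff hSm, IntegrableOn, Measure.restrict_restrict hSm,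
      inter_eq_self_of_subset_left hSΩ]
    exact (integrable_finsetSum _ fun i _ => integrable_finsetSum _ fun j _ => hfi i j).const_mul _
  · have hae := (ae_restrict_iff' (measurableSet_boundaryLayer hΩ.1 ε)).1
      (ae_nearestBoundaryPoint hN hΩ hne hε hsign)
    filter_upwards [ae_restrict_of_ae hae, ae_restrict_of_ae (ae_differentiableAt_infDist Ωᶜ),
      ae_restrict_mem hΩ.1.measurableSet] with y hy hd hyΩ
    by_cases hyS : y ∈ S
    · rw [indicator_of_mem hyS]
      have hs := hy hyS.1
      have hp := (dist_nearestBoundaryPoint hΩ.1 hne hyΩ).1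
      set ν := outerNormal Ω (π y) with hν
      have hnu : ∀ j, |ν j| ≤ 1 := fun j => abs_outerNormal_le hΩ hp j
      have hpd : ∀ j, partialDeriv j (fun z => Metric.infDist z Ωᶜ) y = -ν j := fun j =>
        partialDeriv_infDist_compl hΩ hne hyΩ hd j
      set θ := deriv Real.smoothTransition (2 / ε * Metric.infDist y Ωᶜ - 1) with hθ
      have hθ0 : 0 ≤ θ := deriv_smoothTransition_nonneg _
      have hθC : θ ≤ Cθ := (le_abs_self _).trans (hCθ _)
      -- The boundary condition at π(y): if tw ≤ 0 the factor q(tw) vanishes, otherwise the conormal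
      -- derivative is at most 0.
      have hsgn : q (tw (π y)) * ∑ i, ∑ j, a i j (π y) * ν j * tD i (π y) ≤ 0 := by
        rcases hs with hs | hs
        · rw [hqn _ hs, zero_mul]
        · exact mul_nonpos_of_nonneg_of_nonpos (hq0 _) hs
      -- Since ∇d = -ν(π(y)), the interior flux is minus the conormal expression at π(y), which has
      -- a favourable sign, minus ∑ f_ij ν_j with |ν_j| ≤ 1.
      have hsum : -∑ i, ∑ j, |f i j y| ≤
          q (w y) * ∑ j, (∑ i, a i j y * D i y) * partialDeriv j
            (fun z => Metric.infDist z Ωᶜ) y := by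
        have e2 : q (w y) * ∑ j, (∑ i, a i j y * D i y) * partialDeriv j
            (fun z => Metric.infDist z Ωᶜ) y =
            -∑ i, ∑ j, f i j y * ν j -
              q (tw (π y)) * ∑ i, ∑ j, a i j (π y) * ν j * tD i (π y) := by
          simp only [hpd, hf, Finset.mul_sum, Finset.sum_mul]
          rw [Finset.sum_comm, ← Finset.sum_neg_distrib, ← Finset.sum_sub_distrib]
          refine Finset.sum_congr rfl fun i _ => ?_
          rw [← Finset.sum_neg_distrib, ← Finset.sum_sub_distrib]
          refine Finset.sum_congr rfl fun j _ => ?_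
          ring
        have e3 : ∑ i, ∑ j, f i j y * ν j ≤ ∑ i, ∑ j, |f i j y| := by
          refine Finset.sum_le_sum fun i _ => Finset.sum_le_sum fun j _ => ?_
          refine (le_abs_self _).trans ?_
          rw [abs_mul]
          exact mul_le_of_le_one_right (abs_nonneg _) (hnu j)
        rw [e2]
        linarith
      have hF0 : 0 ≤ ∑ i, ∑ j, |f i j y| :=
        Finset.sum_nonneg fun i _ => Finset.sum_nonneg fun j _ => abs_nonneg _
      have hc0 : 0 ≤ χ y * (θ * (2 / ε)) :=
        mul_nonneg (hχ0 y) (mul_nonneg hθ0 (div_nonneg zero_le_two hε.1.le))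
      have hcC : χ y * (θ * (2 / ε)) ≤ 2 * Cχ * Cθ / ε := by
        have hε1 := hε.1
        calc χ y * (θ * (2 / ε)) ≤ Cχ * (Cθ * (2 / ε)) := by
              gcongr
              exact hCχ y
          _ = _ := by ring
      calc -(2 * Cχ * Cθ / ε) * ∑ i, ∑ j, |f i j y|
          ≤ χ y * (θ * (2 / ε)) * -∑ i, ∑ j, |f i j y| := by
            have := mul_le_mul_of_nonneg_right hcC hF0
            linarith
        _ ≤ χ y * (θ * (2 / ε)) * (q (w y) * ∑ j, (∑ i, a i j y * D i y) * partialDeriv j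
            (fun z => Metric.infDist z Ωᶜ) y) := mul_le_mul_of_nonneg_left hsum hc0
        _ = _ := by ring
    · rw [indicator_of_notMem hyS]
      -- Off S either χ vanishes or d ≥ ε, where the argument of the step is at least 1 and its
      -- derivative is 0.
      have : χ y * (deriv Real.smoothTransition (2 / ε * Metric.infDist y Ωᶜ - 1) * (2 / ε)) = 0 := by
        by_cases hyR : y ∈ Metric.ball (0 : Euc N) R
        · have : ¬ (y ∈ boundaryLayer Ω ε) := fun h => hyS ⟨h, hyR⟩
          rw [mem_boundaryLayer hΩ.1 hne, not_and, not_lt] at this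
          have h2 := this hyΩ
          rw [deriv_smoothTransition_of_one_le, zero_mul, mul_zero]
          have hε1 := hε.1
          have h3 : 2 / ε * ε ≤ 2 / ε * Metric.infDist y Ωᶜ := by gcongr
          have e : 2 / ε * ε = 2 := by field_simp
          linarith
        · rw [hR y hyR, zero_mul]
      rw [this, mul_zero, zero_mul]

theorem aestronglyMeasurable_flux {N : ℕ} (hN : 1 ≤ N) {Ω : Set (Euc N)}
    (hΩ : IsSmoothDomain Ω) (hne : Ω ≠ univ) {w tw d td a : Euc N → ℝ}
    (hw : HasBoundaryValue Ω w tw) (hd : HasBoundaryValue Ω d td) (ha : HasBoundaryValue Ω a a)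
    (hwm : AEStronglyMeasurable w (bulkMeasure Ω)) (hdm : AEStronglyMeasurable d (bulkMeasure Ω))
    (ham : AEStronglyMeasurable a (bulkMeasure Ω)) {q : ℝ → ℝ} (hq : Continuous q) (R : ℝ) {ε : ℝ}
    (hε : ε ∈ Ioc (0 : ℝ) 1) :
    AEStronglyMeasurable (fun y => q (w y) * a y * d y -
      q (tw (nearestBoundaryPoint Ω y)) * a (nearestBoundaryPoint Ω y) *
        td (nearestBoundaryPoint Ω y)) (layerAvg Ω R ε) := by
  have ac1 := layerAvg_absolutelyContinuous_bulk Ω R ε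
  have mπ : ∀ {f : Euc N → ℝ}, AEStronglyMeasurable f (surfaceMeasure Ω) →
      AEStronglyMeasurable (fun y => f (nearestBoundaryPoint Ω y)) (layerAvg Ω R ε) := fun hf =>
    (aestronglyMeasurable_comp_nearestBoundaryPoint hN hΩ hne hε hf).mono_ac
      (layerAvg_absolutelyContinuous Ω R ε)
  exact (((hq.comp_aestronglyMeasurable (hwm.mono_ac ac1)).mul (ham.mono_ac ac1)).mul
    (hdm.mono_ac ac1)).sub
    (((hq.comp_aestronglyMeasurable (mπ hw.1)).mul (mπ ha.1)).mul (mπ hd.1))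

/-- The inequality `-div (a ∇w) + h ≤ 0` in `Ω`, in the sense of distributions, together with the
boundary condition `w ≤ 0` or `a ∇w · ν ≤ 0` on `∂Ω`. Here `D = ∇w`, and `tw`, `tD` are boundary
values. -/
structure IsStationarySubsolution {N : ℕ} (Ω : Set (Euc N)) (a : Fin N → Fin N → Euc N → ℝ)
    (w h : Euc N → ℝ) (D : Fin N → Euc N → ℝ) (tw : Euc N → ℝ) (tD : Fin N → Euc N → ℝ) :
    Prop where
  memLp : MemLp w 2 (bulkMeasure Ω)
  bounded : ∃ M : ℝ, ∀ᵐ x ∂(bulkMeasure Ω), |w x| ≤ M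
  memLp_rhs : MemLp h 2 (bulkMeasure Ω)
  memLp_grad : ∀ i, MemLp (D i) 2 (bulkMeasure Ω)
  coeff_meas : ∀ i j, AEStronglyMeasurable (a i j) (bulkMeasure Ω)
  coeff_bounded : ∃ C : ℝ, ∀ i j, (∀ᵐ x ∂(bulkMeasure Ω), |a i j x| ≤ C) ∧
    ∀ᵐ x ∂(surfaceMeasure Ω), |a i j x| ≤ C
  weak : ∀ i, HasWeakPartial Ω i w (D i)
  test : ∀ φ, IsTestFunction Ω φ → (∀ x, 0 ≤ φ x) →
    (∫ x in Ω, ∑ j, (∑ i, a i j x * D i x) * partialDeriv j φ x) + ∫ x in Ω, h x * φ x ≤ 0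
  elliptic : ∀ᵐ x ∂(bulkMeasure Ω), 0 ≤ ∑ j, (∑ i, a i j x * D i x) * D j x
  trace : HasBoundaryValue Ω w tw
  trace_grad : ∀ i, HasBoundaryValue Ω (D i) (tD i)
  trace_coeff : ∀ i j, HasBoundaryValue Ω (a i j) (a i j)
  sign : ∀ᵐ x ∂(surfaceMeasure Ω),
      tw x ≤ 0 ∨ ∑ i, ∑ j, a i j x * outerNormal Ω x j * tD i x ≤ 0

/-! ### The energy inequality at a fixed time -/

section Stationary

variable {N : ℕ} {Ω : Set (Euc N)} {a : Fin N → Fin N → Euc N → ℝ}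
  {w h : Euc N → ℝ} {D : Fin N → Euc N → ℝ} {tw : Euc N → ℝ} {tD : Fin N → Euc N → ℝ}

theorem memLp_flux (ham : ∀ i j, AEStronglyMeasurable (a i j) (bulkMeasure Ω))
    (hab : ∃ C : ℝ, ∀ i j, ∀ᵐ x ∂(bulkMeasure Ω), |a i j x| ≤ C)
    (hD : ∀ i, MemLp (D i) 2 (bulkMeasure Ω)) (j : Fin N) :
    MemLp (fun x => ∑ i, a i j x * D i x) 2 (bulkMeasure Ω) := by
  obtain ⟨C, hC⟩ := hab
  refine memLp_finsetSum _ fun i _ => ?_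
  refine (hD i).of_le_mul (c := C) ((ham i j).mul (hD i).1) ?_
  filter_upwards [hC i j] with x hx
  rw [norm_mul]
  exact mul_le_mul_of_nonneg_right hx (norm_nonneg _)

theorem IsStationarySubsolution.memLp_flux
    (H : IsStationarySubsolution Ω a w h D tw tD) (j : Fin N) :
    MemLp (fun x => ∑ i, a i j x * D i x) 2 (bulkMeasure Ω) := by
  obtain ⟨C, hC⟩ := H.coeff_bounded
  exact ParabolicSystem.memLp_flux H.coeff_meas ⟨C, fun i j => (hC i j).1⟩ H.memLp_grad j

/-- The support of χ may now meet ∂Ω. Testing with Ψ(w) χ ζ_ε, where ζ_ε is `innerCutoff Ω ε`,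
produces ζ_ε ∇χ, which converges dominatedly because ζ_ε → 1 in Ω, and χ ∇ζ_ε, which is bounded
below by an error that tends to 0. This is the substitute for Green's formula. -/
theorem IsStationarySubsolution.integral_cutoff_le (hN : 1 ≤ N) (hΩ : IsSmoothDomain Ω)
    (H : IsStationarySubsolution Ω a w h D tw tD)
    {Ψ : ℝ → ℝ} (hΨ : ContDiff ℝ ∞ Ψ) (hΨ0 : ∀ s, 0 ≤ Ψ s) (hΨ' : ∀ s, 0 ≤ deriv Ψ s)
    (hΨn : ∀ s ≤ 0, Ψ s = 0) {χ : Euc N → ℝ} (hχ : ContDiff ℝ ∞ χ) (hχ0 : ∀ x, 0 ≤ χ x)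
    (hχs : HasCompactSupport χ) :
    (∫ x in Ω, Ψ (w x) * ∑ j, (∑ i, a i j x * D i x) * partialDeriv j χ x) +
      ∫ x in Ω, h x * (Ψ (w x) * χ x) ≤ 0 := by
  obtain ⟨M, hM⟩ := H.bounded
  obtain ⟨Ca, hCa⟩ := H.coeff_bounded
  have hA := H.memLp_flux
  obtain ⟨Kχ, hKχ⟩ := ContDiff.lipschitzWith_of_hasCompactSupport hχs hχ (by simp)
  -- Without a boundary χ itself is admissible, and no limit is needed.
  by_cases hne : Ω = univ
  · exact weak_inequality_comp hΩ.1 H.memLp hM H.memLp_rhs H.memLp_grad hA H.weak H.test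
      H.elliptic hΨ hΨ0 hΨ' hKχ hχ0 hχs (by simp [hne])
  obtain ⟨Cχ, hCχ⟩ : ∃ B, ∀ x, |χ x| ≤ B := by
    obtain ⟨B, hB⟩ := hχs.exists_bound_of_continuous hχ.continuous
    exact ⟨B, hB⟩
  have hCχ0 : 0 ≤ Cχ := (abs_nonneg _).trans (hCχ 0)
  obtain ⟨Cθ, hCθ0, hCθ⟩ := smoothTransition_deriv_bound
  obtain ⟨R, hR0, hR⟩ : ∃ R, 0 < R ∧ tsupport χ ⊆ Metric.ball 0 R := by
    obtain ⟨R, hR⟩ := hχs.isCompact.isBounded.subset_ball 0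
    exact ⟨max R 1, by positivity, hR.trans (Metric.ball_subset_ball (le_max_left _ _))⟩
  have hRz : ∀ x, x ∉ Metric.ball (0 : Euc N) R → χ x = 0 := fun x hx =>
    image_eq_zero_of_notMem_tsupport fun h => hx (hR h)
  obtain ⟨q, K, B, hqL, hqB, hqΨ, hqn, hq0⟩ := exists_truncation hΨ hΨ0 hΨn
    (le_max_right M 0)
  have hqw : ∀ᵐ x ∂(bulkMeasure Ω), q (w x) = Ψ (w x) := by
    filter_upwards [hM] with x hx using hqΨ _ (hx.trans (le_max_left _ _))
  have hΨB : ∀ᵐ x ∂(bulkMeasure Ω), |Ψ (w x)| ≤ B := by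
    filter_upwards [hqw] with x hx
    rw [← hx]; exact hqB _
  have hΨm : AEStronglyMeasurable (fun x => Ψ (w x)) (bulkMeasure Ω) :=
    hΨ.continuous.comp_aestronglyMeasurable H.memLp.1
  set A : Fin N → Euc N → ℝ := fun j x => ∑ i, a i j x * D i x with hAdef
  set G : Euc N → ℝ := fun x => Ψ (w x) * ∑ j, A j x * partialDeriv j χ x with hG
  have iG : Integrable G (bulkMeasure Ω) := integrable_mul_sum_partialDeriv hA hΨm hΨB hKχ hχs
  set H₁ : Euc N → ℝ := fun x => h x * (Ψ (w x) * χ x) with hH₁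
  have iH : Integrable H₁ (bulkMeasure Ω) := by
    have e : H₁ = fun x => Ψ (w x) * (h x * χ x) := by ext x; simp only [hH₁]; ring
    rw [e]
    have hχL : MemLp χ 2 (bulkMeasure Ω) :=
      (hχ.continuous.memLp_of_hasCompactSupport hχs).restrict Ω
    exact (H.memLp_rhs.integrable_mul hχL).bdd_mul (c := B) hΨm hΨB
  set f : Fin N → Fin N → Euc N → ℝ := fun i j y => q (w y) * a i j y * D i y -
    q (tw (nearestBoundaryPoint Ω y)) * a i j (nearestBoundaryPoint Ω y) *
      tD i (nearestBoundaryPoint Ω y) with hf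
  have tf : ∀ i j, Tendsto (fun ε => eLpNorm (f i j) 1 (layerAvg Ω R ε)) (𝓝[>] 0) (𝓝 0) :=
    fun i j => tendsto_eLpNorm_flux hN hΩ hne H.trace (H.trace_grad i) (H.trace_coeff i j)
      H.memLp.1 (H.memLp_grad i).1 (H.coeff_meas i j) (hCa i j).1 (hCa i j).2 hqL hqB
      (hqn 0 le_rfl) hR0
  have mf : ∀ i j, ∀ ε ∈ Ioc (0 : ℝ) 1, AEStronglyMeasurable (f i j) (layerAvg Ω R ε) :=
    fun i j ε hε => aestronglyMeasurable_flux hN hΩ hne H.trace (H.trace_grad i)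
      (H.trace_coeff i j) H.memLp.1 (H.memLp_grad i).1 (H.coeff_meas i j) hqL.continuous R hε
  have hev : ∀ᶠ ε : ℝ in 𝓝[>] 0, ε ∈ Ioc (0 : ℝ) 1 := Ioc_mem_nhdsGT zero_lt_one
  have tI : ∀ i j, Tendsto (fun ε => ∫ y, |f i j y| ∂(layerAvg Ω R ε)) (𝓝[>] 0) (𝓝 0) := by
    intro i j
    have h1 := (ENNReal.tendsto_toReal ENNReal.zero_ne_top).comp (tf i j)
    rw [ENNReal.toReal_zero] at h1
    refine h1.congr' ?_
    filter_upwards [hev] with ε hε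
    rw [Function.comp_apply, eLpNorm_one_eq_lintegral_enorm,
      ← integral_norm_eq_lintegral_enorm (mf i j ε hε)]
    rfl
  have tE : Tendsto (fun ε => 2 * Cχ * Cθ * ∑ i, ∑ j, ∫ y, |f i j y| ∂(layerAvg Ω R ε))
      (𝓝[>] 0) (𝓝 0) := by
    have := (tendsto_finsetSum (Finset.univ : Finset (Fin N)) fun i _ =>
      tendsto_finsetSum (Finset.univ : Finset (Fin N)) fun j _ => tI i j).const_mul (2 * Cχ * Cθ)
    simpa using this
  have hfin : ∀ᶠ ε : ℝ in 𝓝[>] 0, ∀ i j, Integrable (f i j) (layerAvg Ω R ε) := by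
    refine eventually_all.2 fun i => eventually_all.2 fun j => ?_
    filter_upwards [hev, (tf i j).eventually (gt_mem_nhds zero_lt_one)] with ε h1 h2
    exact memLp_one_iff_integrable.1 ⟨mf i j ε h1, h2.trans ENNReal.one_lt_top⟩
  have mζ : ∀ ε, AEStronglyMeasurable (innerCutoff Ω ε) (bulkMeasure Ω) := by
    intro ε
    obtain ⟨L, hL⟩ := exists_lipschitzWith_innerCutoff Ω ε
    exact hL.continuous.aestronglyMeasurable
  have hζ1 : ∀ ε y, ‖innerCutoff Ω ε y‖ ≤ 1 := fun ε y => by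
    rw [Real.norm_of_nonneg (innerCutoff_nonneg _ _ _)]
    exact innerCutoff_le_one _ _ _
  -- Only small ε are used, since the layer estimates need ε ≤ 1 and the integrability of the errors
  -- is known only once their L¹ norms are below 1.
  have key : ∀ᶠ ε : ℝ in 𝓝[>] 0,
      (∫ x in Ω, innerCutoff Ω ε x * G x) + ∫ x in Ω, innerCutoff Ω ε x * H₁ x ≤
        2 * Cχ * Cθ * ∑ i, ∑ j, ∫ y, |f i j y| ∂(layerAvg Ω R ε) := by
    filter_upwards [hev, hfin] with ε hε hfi
    obtain ⟨L, hL⟩ := exists_lipschitzWith_innerCutoff Ω ε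
    have hηL := LipschitzWith.mul_bounded hKχ hL (A := Cχ.toNNReal) (B := 1)
      (fun x => (hCχ x).trans (Real.le_coe_toNNReal _)) (fun x => hζ1 ε x)
    have hηs : HasCompactSupport fun y => χ y * innerCutoff Ω ε y := hχs.mul_right
    have h1 := weak_inequality_comp hΩ.1 H.memLp hM H.memLp_rhs H.memLp_grad hA H.weak H.test
      H.elliptic hΨ hΨ0 hΨ' hηL (fun x => mul_nonneg (hχ0 x) (innerCutoff_nonneg _ _ _)) hηs
      (tsupport_mul_innerCutoff hε.1 χ)
    set b : Euc N → ℝ := fun y => q (w y) *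
      (χ y * (deriv Real.smoothTransition (2 / ε * Metric.infDist y Ωᶜ - 1) * (2 / ε))) *
      ∑ j, A j y * partialDeriv j (fun z => Metric.infDist z Ωᶜ) y with hb
    have eb : (fun x => Ψ (w x) * ∑ j, A j x * partialDeriv j (fun y => χ y * innerCutoff Ω ε y) x)
        =ᵐ[volume.restrict Ω] fun x => innerCutoff Ω ε x * G x + b x := by
      filter_upwards [hqw, ae_restrict_of_ae (ae_differentiableAt_infDist Ωᶜ)] with x h2 h3
      simp only [hb, hG, h2, partialDeriv_mul_innerCutoff (hχ.differentiable (by simp)) h3,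
        Finset.mul_sum]
      rw [← Finset.sum_add_distrib]
      exact Finset.sum_congr rfl fun j _ => by ring
    have iζG : Integrable (fun x => innerCutoff Ω ε x * G x) (bulkMeasure Ω) :=
      iG.bdd_mul (c := 1) (mζ ε) (Eventually.of_forall (hζ1 ε))
    have i1 : Integrable (fun x => Ψ (w x) *
        ∑ j, A j x * partialDeriv j (fun y => χ y * innerCutoff Ω ε y) x) (bulkMeasure Ω) :=
      integrable_mul_sum_partialDeriv hA hΨm hΨB hηL hηs
    have ib : Integrable b (bulkMeasure Ω) := by
      refine (i1.sub iζG).congr ?_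
      filter_upwards [eb] with x hx
      rw [Pi.sub_apply, hx, add_sub_cancel_left]
    have h2 := boundary_term_ge hN hΩ hne hq0 hqn H.sign hχ0
      (fun x => (le_abs_self _).trans (hCχ x)) hRz hCθ hε hfi ib
    have e1 : ∫ x in Ω, Ψ (w x) *
        ∑ j, A j x * partialDeriv j (fun y => χ y * innerCutoff Ω ε y) x =
        (∫ x in Ω, innerCutoff Ω ε x * G x) + ∫ x in Ω, b x :=
      (integral_congr_ae eb).trans (integral_add iζG ib)
    have h1 : (∫ x in Ω, Ψ (w x) *
        ∑ j, A j x * partialDeriv j (fun y => χ y * innerCutoff Ω ε y) x) +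
        ∫ x in Ω, h x * (Ψ (w x) * (χ x * innerCutoff Ω ε x)) ≤ 0 := h1
    rw [e1] at h1
    have e3 : ∫ x in Ω, h x * (Ψ (w x) * (χ x * innerCutoff Ω ε x)) =
        ∫ x in Ω, innerCutoff Ω ε x * H₁ x := by
      congr 1 with x
      simp only [hH₁]; ring
    rw [e3] at h1
    have h3 : -(2 * Cχ * Cθ * ∑ i, ∑ j, ∫ y, |f i j y| ∂(layerAvg Ω R ε)) ≤ ∫ y in Ω, b y := h2
    linarith
  have lim : ∀ {g : Euc N → ℝ}, Integrable g (bulkMeasure Ω) →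
      Tendsto (fun ε => ∫ x in Ω, innerCutoff Ω ε x * g x) (𝓝[>] 0) (𝓝 (∫ x in Ω, g x)) := by
    intro g hg
    refine tendsto_integral_filter_of_dominated_convergence (fun x => ‖g x‖)
      (Eventually.of_forall fun ε => (mζ ε).mul hg.1) (Eventually.of_forall fun ε =>
        Eventually.of_forall fun x => ?_) hg.norm ?_
    · rw [norm_mul]
      exact mul_le_of_le_one_left (norm_nonneg _) (hζ1 ε x)
    · filter_upwards [ae_restrict_mem hΩ.1.measurableSet] with x hx
      have hpos : 0 < Metric.infDist x Ωᶜ := by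
        rw [← hΩ.1.isClosed_compl.notMem_iff_infDist_pos (nonempty_compl.2 hne)]
        simpa using hx
      refine tendsto_const_nhds.congr' ?_
      filter_upwards [Ioc_mem_nhdsGT hpos] with ε hε
      have : innerCutoff Ω ε x = 1 := by
        apply Real.smoothTransition.one_of_one_le
        have hε0 := hε.1
        have h3 : 2 / ε * ε ≤ 2 / ε * Metric.infDist x Ωᶜ := by
          gcongr
          exact hε.2
        have e : 2 / ε * ε = 2 := by field_simp
        linarith
      rw [this, one_mul]
  exact le_of_tendsto_of_tendsto ((lim iG).add (lim iH)) tE key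

theorem abs_partialDeriv_comp_smul_le {χ : Euc N → ℝ} (hχ : ContDiff ℝ ∞ χ)
    (hχs : HasCompactSupport χ) : ∃ C : ℝ, 0 ≤ C ∧ ∀ r : ℝ, 0 ≤ r → ∀ j x,
      |partialDeriv j (fun x => χ (r • x)) x| ≤ r * C := by
  obtain ⟨K, hK⟩ := ContDiff.lipschitzWith_of_hasCompactSupport hχs hχ (by simp)
  refine ⟨K, K.2, fun r hr j x => ?_⟩
  have h1 : LipschitzWith (K * ‖r‖₊) fun x => χ (r • x) := hK.comp (lipschitzWith_smul r)
  refine (abs_partialDeriv_le_of_lipschitzWith h1 j x).trans ?_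
  push_cast
  rw [Real.norm_of_nonneg hr, mul_comm]

/-- Dilated bumps tend to 1 while their gradients are O(r). The bound Ψ(s) ≤ |s| puts Ψ(w) into L²,
so Ψ(w) A_j and h Ψ(w) are integrable on the possibly unbounded Ω and serve as majorants. -/
theorem IsStationarySubsolution.integral_comp_le (hN : 1 ≤ N) (hΩ : IsSmoothDomain Ω)
    (H : IsStationarySubsolution Ω a w h D tw tD)
    {Ψ : ℝ → ℝ} (hΨ : ContDiff ℝ ∞ Ψ) (hΨ0 : ∀ s, 0 ≤ Ψ s) (hΨ' : ∀ s, 0 ≤ deriv Ψ s)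
    (hΨn : ∀ s ≤ 0, Ψ s = 0) (hΨle : ∀ s, Ψ s ≤ |s|) :
    ∫ x in Ω, h x * Ψ (w x) ≤ 0 := by
  have hA := H.memLp_flux
  set A : Fin N → Euc N → ℝ := fun j x => ∑ i, a i j x * D i x with hAdef
  let χ₁ : ContDiffBump (0 : Euc N) := ⟨1, 2, one_pos, one_lt_two⟩
  have hχ₁ : ContDiff ℝ ∞ χ₁ := χ₁.contDiff
  obtain ⟨C, hC0, hC⟩ := abs_partialDeriv_comp_smul_le hχ₁ χ₁.hasCompactSupport
  set r : ℕ → ℝ := mollRadius with hr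
  set χ : ℕ → Euc N → ℝ := fun n x => χ₁ (r n • x) with hχ
  have hr0 : ∀ n, 0 < r n := mollRadius_pos
  have cχ : ∀ n, ContDiff ℝ ∞ (χ n) := fun n => hχ₁.comp (contDiff_const_smul (r n))
  have sχ : ∀ n, HasCompactSupport (χ n) := fun n =>
    χ₁.hasCompactSupport.comp_homeomorph (Homeomorph.smulOfNeZero (r n) (hr0 n).ne')
  have key := fun n => H.integral_cutoff_le hN hΩ hΨ hΨ0 hΨ' hΨn (cχ n) (fun x => χ₁.nonneg) (sχ n)
  have hΨm : AEStronglyMeasurable (fun x => Ψ (w x)) (bulkMeasure Ω) :=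
    hΨ.continuous.comp_aestronglyMeasurable H.memLp.1
  have hΨabs : ∀ s, |Ψ s| ≤ |s| := fun s => by rw [abs_of_nonneg (hΨ0 s)]; exact hΨle s
  have hΨL : MemLp (fun x => Ψ (w x)) 2 (bulkMeasure Ω) :=
    H.memLp.of_le hΨm (Eventually.of_forall fun x => hΨabs _)
  have hr1 : ∀ n, r n ≤ 1 := fun n => by
    have : (0 : ℝ) ≤ n := n.cast_nonneg
    show mollRadius n ≤ 1
    rw [mollRadius, div_le_one (by positivity)]
    linarith
  have L1 : Tendsto (fun n => ∫ x in Ω, Ψ (w x) * ∑ j, A j x * partialDeriv j (χ n) x) atTop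
      (𝓝 (∫ x in Ω, (0 : ℝ))) := by
    refine tendsto_integral_of_dominated_convergence (fun x => C * ∑ j, |Ψ (w x) * A j x|)
      (fun n => hΨm.mul (Finset.aestronglyMeasurable_fun_sum _ fun j _ => (hA j).1.mul
        (measurable_partialDeriv j (χ n)).aestronglyMeasurable))
      ((integrable_finsetSum _ fun j _ => (hΨL.integrable_mul (hA j)).abs).const_mul _) ?_ ?_
    · refine fun n => Eventually.of_forall fun x => ?_
      rw [Finset.mul_sum, Finset.mul_sum, Real.norm_eq_abs]
      refine (Finset.abs_sum_le_sum_abs _ _).trans (Finset.sum_le_sum fun j _ => ?_)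
      rw [← mul_assoc, abs_mul, mul_comm]
      refine mul_le_mul_of_nonneg_right ((hC (r n) (hr0 n).le j x).trans ?_) (abs_nonneg _)
      exact mul_le_of_le_one_left hC0 (hr1 n)
    · refine Eventually.of_forall fun x => ?_
      have h1 : ∀ j, Tendsto (fun n => partialDeriv j (χ n) x) atTop (𝓝 0) := by
        intro j
        refine squeeze_zero_norm (fun n => hC (r n) (hr0 n).le j x) ?_
        simpa using tendsto_mollRadius.mul_const C
      have := (tendsto_finsetSum (Finset.univ : Finset (Fin N)) fun j _ =>
        (h1 j).const_mul (A j x)).const_mul (Ψ (w x))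
      simpa using this
  have L2 : Tendsto (fun n => ∫ x in Ω, h x * (Ψ (w x) * χ n x)) atTop
      (𝓝 (∫ x in Ω, h x * Ψ (w x))) := by
    refine tendsto_integral_of_dominated_convergence (fun x => ‖h x * Ψ (w x)‖)
      (fun n => H.memLp_rhs.1.mul (hΨm.mul (cχ n).continuous.aestronglyMeasurable))
      (H.memLp_rhs.integrable_mul hΨL).norm ?_ ?_
    · refine fun n => Eventually.of_forall fun x => ?_
      rw [← mul_assoc, norm_mul]
      refine mul_le_of_le_one_right (norm_nonneg _) ?_
      rw [Real.norm_of_nonneg χ₁.nonneg]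
      exact χ₁.le_one
    · refine Eventually.of_forall fun x => ?_
      have h1 : Tendsto (fun n => r n • x) atTop (𝓝 (0 : Euc N)) := by
        simpa using tendsto_mollRadius.smul_const x
      have h2 := (χ₁.continuous.tendsto 0).comp h1
      rw [χ₁.one_of_mem_closedBall (Metric.mem_closedBall_self χ₁.rIn_pos.le)] at h2
      simpa using (h2.const_mul (Ψ (w x))).const_mul (h x)
  have := le_of_tendsto' (L1.add L2) key
  simpa using this

/-- The function `s ↦ s θ((n + 1) s)`, a smooth approximation of the positive part. -/
def smoothPos (n : ℕ) (s : ℝ) : ℝ := s * Real.smoothTransition ((n + 1) * s)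

theorem contDiff_smoothPos (n : ℕ) : ContDiff ℝ ∞ (smoothPos n) :=
  contDiff_id.mul (Real.smoothTransition.contDiff.comp (contDiff_const.mul contDiff_id))

theorem smoothPos_of_nonpos (n : ℕ) {s : ℝ} (hs : s ≤ 0) : smoothPos n s = 0 := by
  rw [smoothPos, Real.smoothTransition.zero_of_nonpos, mul_zero]
  exact mul_nonpos_of_nonneg_of_nonpos (by positivity) hs

theorem smoothPos_nonneg (n : ℕ) (s : ℝ) : 0 ≤ smoothPos n s := by
  rcases le_total s 0 with hs | hs
  · rw [smoothPos_of_nonpos n hs]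
  · exact mul_nonneg hs (Real.smoothTransition.nonneg _)

theorem smoothPos_le (n : ℕ) (s : ℝ) : smoothPos n s ≤ |s| := by
  rcases le_total s 0 with hs | hs
  · rw [smoothPos_of_nonpos n hs]; exact abs_nonneg s
  · rw [abs_of_nonneg hs]
    exact mul_le_of_le_one_right hs (Real.smoothTransition.le_one _)

theorem monotone_smoothPos (n : ℕ) : Monotone (smoothPos n) := by
  intro s t hst
  rcases le_total s 0 with hs | hs
  · rw [smoothPos_of_nonpos n hs]; exact smoothPos_nonneg n t
  · exact mul_le_mul hst (Real.smoothTransition.monotone (by gcongr))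
      (Real.smoothTransition.nonneg _) (hs.trans hst)

theorem tendsto_smoothPos (s : ℝ) :
    Tendsto (fun n => smoothPos n s) atTop (𝓝 (max s 0)) := by
  rcases le_or_gt s 0 with hs | hs
  · rw [max_eq_right hs]
    simp_rw [smoothPos_of_nonpos _ hs]
    exact tendsto_const_nhds
  · rw [max_eq_left hs.le]
    refine tendsto_const_nhds.congr' ?_
    obtain ⟨n₀, hn₀⟩ := exists_nat_gt (1 / s)
    filter_upwards [eventually_ge_atTop n₀] with n hn
    rw [smoothPos, Real.smoothTransition.one_of_one_le, mul_one]
    rw [div_lt_iff₀ hs] at hn₀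
    have : (n₀ : ℝ) ≤ n := by exact_mod_cast hn
    nlinarith

/-- The energy inequality: `∫ h w⁺ ≤ 0`. -/
theorem IsStationarySubsolution.integral_mul_posPart_le (hN : 1 ≤ N) (hΩ : IsSmoothDomain Ω)
    (H : IsStationarySubsolution Ω a w h D tw tD) :
    ∫ x in Ω, h x * max (w x) 0 ≤ 0 := by
  have L : Tendsto (fun n => ∫ x in Ω, h x * smoothPos n (w x)) atTop
      (𝓝 (∫ x in Ω, h x * max (w x) 0)) := by
    refine tendsto_integral_of_dominated_convergence (fun x => ‖h x * w x‖)
      (fun n => H.memLp_rhs.1.mul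
        ((contDiff_smoothPos n).continuous.comp_aestronglyMeasurable H.memLp.1))
      (H.memLp_rhs.integrable_mul H.memLp).norm ?_ ?_
    · refine fun n => Eventually.of_forall fun x => ?_
      rw [norm_mul, norm_mul, Real.norm_of_nonneg (smoothPos_nonneg _ _)]
      exact mul_le_mul_of_nonneg_left (smoothPos_le n _) (norm_nonneg _)
    · exact Eventually.of_forall fun x => (tendsto_smoothPos (w x)).const_mul _
  exact le_of_tendsto' L fun n => H.integral_comp_le hN hΩ (contDiff_smoothPos n)
    (smoothPos_nonneg n) (fun s => (monotone_smoothPos n).deriv_nonneg)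
    (fun s hs => smoothPos_of_nonpos n hs) (smoothPos_le n)

end Stationary

/-! ### Quasi-monotone functions -/

theorem Euc.sum_smul_single {n : ℕ} (x : Euc n) :
    ∑ j, x j • (EuclideanSpace.single j 1 : Euc n) = x := by
  simpa using (EuclideanSpace.basisFun (Fin n) ℝ).sum_repr x

theorem Euc.norm_le_sum_abs {n : ℕ} (x : Euc n) : ‖x‖ ≤ ∑ j, |x j| := by
  conv_lhs => rw [← Euc.sum_smul_single x]
  refine (norm_sum_le _ _).trans (Finset.sum_le_sum fun j _ => ?_)
  rw [norm_smul, PiLp.norm_single]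
  simp

theorem fderiv_apply_eq_sum {n : ℕ} (φ : Euc n → ℝ) (x e : Euc n) :
    fderiv ℝ φ x e = ∑ j, e j * partialDeriv j φ x := by
  conv_lhs => rw [← Euc.sum_smul_single e]
  simp [map_sum, partialDeriv]

/-- A locally Lipschitz function is non-decreasing along every segment in whose direction its
derivative is non-negative almost everywhere. -/
theorem le_add_of_ae_fderiv_nonneg {n : ℕ} {φ : Euc n → ℝ}
    (hL : ∀ M : ℕ, ∃ L : ℝ≥0, LipschitzOnWith L φ (Metric.closedBall 0 M)) {e : Euc n}
    (hd : ∀ᵐ U : Euc n, DifferentiableAt ℝ φ U ∧ 0 ≤ fderiv ℝ φ U e) (U : Euc n) :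
    φ U ≤ φ (U + e) := by
  have hc : Continuous φ := by
    refine continuous_iff_continuousAt.2 fun x => ?_
    obtain ⟨M, hM⟩ := exists_nat_gt ‖x‖
    obtain ⟨L, hL⟩ := hL M
    exact hL.continuousOn.continuousAt (mem_of_superset
      (Metric.isOpen_ball.mem_nhds (by simpa using hM)) Metric.ball_subset_closedBall)
  -- The Fubini argument along lines requires a measurable set of full measure.
  obtain ⟨G, hGs, hGm, hG⟩ : ∃ G ⊆ {U | DifferentiableAt ℝ φ U ∧ 0 ≤ fderiv ℝ φ U e},
      MeasurableSet G ∧ ∀ᵐ U : Euc n, U ∈ G := by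
    obtain ⟨S, hS, hSm, hS0⟩ := exists_measurable_superset_of_null hd
    refine ⟨Sᶜ, fun x hx => ?_, hSm.compl, measure_eq_zero_iff_ae_notMem.1 hS0⟩
    by_contra h
    exact hx (hS h)
  let T : ℝ →ₗ[ℝ] Euc n := LinearMap.toSpanSingleton ℝ _ e
  have hae : ∀ᵐ z : Euc n, φ z ≤ φ (z + e) := by
    -- A given segment may lie in the exceptional null set. By Fubini, almost every line parallel to
    -- e meets it in a null set, and on such a line the Lipschitz function is the integral of its
    -- derivative.
    filter_upwards [(ae_ae_add_linearMap_mem_iff T volume volume hGm).2 hG] with z hz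
    obtain ⟨M, hM⟩ := exists_nat_gt (‖z‖ + ‖e‖)
    obtain ⟨L, hL⟩ := hL M
    have hline : LipschitzWith ‖e‖₊ fun s : ℝ => z + s • e := by
      refine LipschitzWith.of_dist_le_mul fun s t => ?_
      rw [dist_add_left, dist_eq_norm, ← sub_smul, norm_smul, mul_comm, ← dist_eq_norm]
      rfl
    have hmaps : MapsTo (fun s : ℝ => z + s • e) (uIcc 0 1) (Metric.closedBall 0 M) := by
      intro s hs
      rw [uIcc_of_le zero_le_one] at hs
      rw [mem_closedBall_zero_iff]
      refine (norm_add_le _ _).trans (le_trans ?_ hM.le)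
      rw [norm_smul, Real.norm_of_nonneg hs.1]
      have := mul_le_of_le_one_left (norm_nonneg e) hs.2
      linarith
    have hac := (hL.comp (hline.lipschitzOnWith (s := uIcc 0 1))
      hmaps).absolutelyContinuousOnInterval.integral_deriv_eq_sub
    have hnn : 0 ≤ ∫ s in (0 : ℝ)..1, deriv (φ ∘ fun s : ℝ => z + s • e) s := by
      refine intervalIntegral.integral_nonneg_of_ae_restrict zero_le_one
        (ae_restrict_of_ae ?_)
      filter_upwards [hz] with s hs
      obtain ⟨h1, h2⟩ := hGs hs
      have h3 : HasDerivAt (fun s : ℝ => z + s • e) e s := by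
        simpa using ((hasDerivAt_id s).smul_const e).const_add z
      have h4 := h1.hasFDerivAt.comp_hasDerivAt_of_eq s h3 rfl
      rw [h4.deriv]
      exact h2
    rw [hac] at hnn
    simpa using hnn
  -- A closed set of full measure is everything, which removes the exceptional base points.
  have hcl : IsClosed {z | φ z ≤ φ (z + e)} :=
    isClosed_le hc (hc.comp (continuous_id.add continuous_const))
  have := (Measure.dense_of_ae hae).closure_eq
  rw [hcl.closure_eq] at this
  exact this.symm.subset (mem_univ U)

/-- One-sided Lipschitz estimate for quasi-monotone functions. -/
theorem sub_le_of_quasiMonotone {n : ℕ} {k : Fin n} {φ : Euc n → ℝ}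
    (hL : ∀ M : ℕ, ∃ L : ℝ≥0, LipschitzOnWith L φ (Metric.closedBall 0 M))
    (hd : ∀ᵐ U : Euc n, DifferentiableAt ℝ φ U ∧ ∀ j, j ≠ k → 0 ≤ partialDeriv j φ U)
    {M : ℝ} {L : ℝ≥0} (hLM : LipschitzOnWith L φ (Metric.closedBall 0 (n * M)))
    {U V : Euc n} (hU : ∀ j, |U j| ≤ M) (hV : ∀ j, |V j| ≤ M) (hk : V k ≤ U k) :
    φ U - φ V ≤ L * ∑ j, max (U j - V j) 0 := by
  -- U + e is the componentwise maximum of U and V. Its k-th component is that of U, so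
  -- quasi-monotonicity gives φ U ≤ φ (U + e); it still obeys the bound M, and it exceeds V exactly
  -- by the positive part of U - V.
  set e : Euc n := WithLp.toLp 2 fun j => max (V j - U j) 0 with he
  have hej : ∀ j, e j = max (V j - U j) 0 := fun j => rfl
  have hek : e k = 0 := by rw [hej, max_eq_right]; linarith
  have h1 : φ U ≤ φ (U + e) := by
    refine le_add_of_ae_fderiv_nonneg hL ?_ U
    filter_upwards [hd] with W hW
    refine ⟨hW.1, ?_⟩
    rw [fderiv_apply_eq_sum]
    refine Finset.sum_nonneg fun j _ => ?_
    by_cases hj : j = k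
    · rw [hj, hek, zero_mul]
    · exact mul_nonneg (by rw [hej]; exact le_max_right _ _) (hW.2 j hj)
  have hball : ∀ {W : Euc n}, (∀ j, |W j| ≤ M) → W ∈ Metric.closedBall (0 : Euc n) (n * M) := by
    intro W hW
    rw [mem_closedBall_zero_iff]
    refine (Euc.norm_le_sum_abs W).trans ((Finset.sum_le_sum fun j _ => hW j).trans ?_)
    simp
  have hUe : ∀ j, |(U + e) j| ≤ M := by
    intro j
    rw [PiLp.add_apply, hej]
    rcases max_choice (V j - U j) 0 with h | h <;> rw [h]
    · rw [add_sub_cancel]; exact hV j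
    · rw [add_zero]; exact hU j
  have h2 : φ (U + e) - φ V ≤ L * ‖U + e - V‖ := by
    have := hLM.dist_le_mul _ (hball hUe) _ (hball hV)
    rw [dist_eq_norm, dist_eq_norm] at this
    exact (le_abs_self _).trans this
  have h3 : ‖U + e - V‖ ≤ ∑ j, max (U j - V j) 0 := by
    refine (Euc.norm_le_sum_abs _).trans_eq (Finset.sum_congr rfl fun j _ => ?_)
    rw [PiLp.sub_apply, PiLp.add_apply, hej]
    rcases le_total (V j) (U j) with h | h
    · rw [max_eq_right (by linarith), max_eq_left (by linarith), add_zero,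
        abs_of_nonneg (by linarith)]
    · rw [max_eq_left (by linarith), max_eq_right (by linarith)]
      simp
  have h4 := mul_le_mul_of_nonneg_left h3 L.2
  change (L : ℝ) * _ ≤ L * _ at h4
  linarith

/-! ### The positive part in `L²` and its evolution -/

section PosPart

variable {α : Type*} [MeasurableSpace α] {μ : Measure α}

theorem inner_Lp_eq_integral (f g : Lp ℝ 2 μ) : inner ℝ f g = ∫ x, f x * g x ∂μ := by
  rw [L2.inner_def]
  refine integral_congr_ae (Eventually.of_forall fun x => ?_)
  simp [mul_comm]

theorem integrable_mul_Lp (f g : Lp ℝ 2 μ) : Integrable (fun x => f x * g x) μ :=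
  (Lp.memLp f).integrable_mul (Lp.memLp g)

theorem inner_posPart_self (u : Lp ℝ 2 μ) :
    inner ℝ u (Lp.posPart u) = ‖Lp.posPart u‖ ^ 2 := by
  rw [← real_inner_self_eq_norm_sq, inner_Lp_eq_integral, inner_Lp_eq_integral]
  refine integral_congr_ae ?_
  filter_upwards [Lp.coeFn_posPart u] with x hx
  simp only [hx]
  rcases le_total (u x) 0 with h | h
  · simp [max_eq_right h]
  · simp [max_eq_left h]

theorem inner_posPart_le (w u : Lp ℝ 2 μ) :
    inner ℝ w (Lp.posPart u) ≤ inner ℝ (Lp.posPart w) (Lp.posPart u) := by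
  rw [inner_Lp_eq_integral, inner_Lp_eq_integral]
  refine integral_mono_ae (integrable_mul_Lp _ _) (integrable_mul_Lp _ _) ?_
  filter_upwards [Lp.coeFn_posPart u, Lp.coeFn_posPart w] with x hx hx'
  simp only [hx, hx']
  exact mul_le_mul_of_nonneg_right (le_max_left _ _) (le_max_right _ _)

/-- Convexity of u ↦ ‖u⁺‖², whose gradient is 2 u⁺: the graph at w lies above the tangent at u. This
inequality replaces differentiation of the positive part. -/
theorem norm_posPart_sq_sub_le (u w : Lp ℝ 2 μ) :
    ‖Lp.posPart u‖ ^ 2 - ‖Lp.posPart w‖ ^ 2 ≤ 2 * inner ℝ (u - w) (Lp.posPart u) := by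
  have h1 := inner_posPart_le w u
  have h2 := real_inner_le_norm (Lp.posPart w) (Lp.posPart u)
  rw [inner_sub_left, inner_posPart_self]
  nlinarith [sq_nonneg (‖Lp.posPart u‖ - ‖Lp.posPart w‖)]

/-- A real function that is non-increasing on short intervals is non-increasing. -/
theorem le_of_forall_short_le {Φ : ℝ → ℝ} {s t δ : ℝ} (hδ : 0 < δ) (hst : s ≤ t)
    (h : ∀ a b, s ≤ a → a ≤ b → b ≤ t → b - a ≤ δ → Φ b ≤ Φ a) : Φ t ≤ Φ s := by
  have key : ∀ n : ℕ, ∀ b, s ≤ b → b ≤ t → b - s ≤ n * δ → Φ b ≤ Φ s := by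
    intro n
    induction n with
    | zero =>
      intro b hb _ h0
      rw [Nat.cast_zero, zero_mul] at h0
      rw [le_antisymm (by linarith) hb]
    | succ n ih =>
      intro b hb hbt hn
      push_cast at hn
      have h1 : Φ b ≤ Φ (max s (b - δ)) :=
        h _ _ (le_max_left _ _) (max_le hb (by linarith)) hbt
          (by linarith [le_max_right s (b - δ)])
      refine h1.trans (ih _ (le_max_left _ _) (max_le hst (by linarith)) ?_)
      rcases max_choice s (b - δ) with h2 | h2 <;> rw [h2]
      · rw [sub_self]; positivity
      · linarith
  obtain ⟨n, hn⟩ := exists_nat_gt ((t - s) / δ)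
  exact key n t hst le_rfl ((div_lt_iff₀ hδ).1 hn).le

/-- The chain rule `(‖w⁺‖²)' ≤ 2 ⟨w', w⁺⟩` in integrated form. -/
theorem norm_posPart_sq_sub_le_integral {w v : ℝ → Lp ℝ 2 μ} {s t : ℝ} (hst : s ≤ t)
    (hw : ContinuousOn w (Icc s t)) (hv : IntegrableOn v (Icc s t))
    (hwv : ∀ a b, s ≤ a → a ≤ b → b ≤ t → w b - w a = ∫ r in a..b, v r) :
    IntegrableOn (fun r => inner ℝ (v r) (Lp.posPart (w r))) (Icc s t) ∧
    ‖Lp.posPart (w t)‖ ^ 2 - ‖Lp.posPart (w s)‖ ^ 2 ≤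
      2 * ∫ r in s..t, inner ℝ (v r) (Lp.posPart (w r)) := by
  set p : ℝ → Lp ℝ 2 μ := fun r => Lp.posPart (w r) with hp
  have hpc : ContinuousOn p (Icc s t) := Lp.continuous_posPart.comp_continuousOn hw
  obtain ⟨C, hC⟩ := isCompact_Icc.exists_bound_of_continuousOn hpc
  have hsm : ∀ {g : ℝ → Lp ℝ 2 μ} {C : ℝ}, AEStronglyMeasurable g (volume.restrict (Icc s t)) →
      (∀ r ∈ Icc s t, ‖g r‖ ≤ C) → IntegrableOn (fun r => inner ℝ (v r) (g r)) (Icc s t) := by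
    intro g C hg hgC
    refine (hv.norm.const_mul C).mono' (hv.1.inner hg) ?_
    filter_upwards [ae_restrict_mem measurableSet_Icc] with r hr
    refine (norm_inner_le_norm _ _).trans ?_
    rw [mul_comm]
    exact mul_le_mul_of_nonneg_right (hgC r hr) (norm_nonneg _)
  have hI := hsm (hpc.aestronglyMeasurable measurableSet_Icc) hC
  refine ⟨hI, ?_⟩
  have sub : ∀ {g : ℝ → ℝ} {a b : ℝ}, IntegrableOn g (Icc s t) → s ≤ a → a ≤ b → b ≤ t →
      IntervalIntegrable g volume a b := by
    intro g a b hg ha hab hb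
    exact (intervalIntegrable_iff_integrableOn_Icc_of_le hab).2
      (hg.mono_set (Icc_subset_Icc ha hb))
  set V := ∫ r in s..t, ‖v r‖ with hV
  refine le_of_forall_pos_le_add fun ε hε => ?_
  have hV0 : 0 ≤ V := intervalIntegral.integral_nonneg hst fun r _ => norm_nonneg _
  -- Chosen so that the total error 2 η V is at most ε; the 1 avoids division by zero.
  set η := ε / (2 * (V + 1)) with hη
  have hη0 : 0 < η := by positivity
  obtain ⟨δ, hδ, hu⟩ := Metric.uniformContinuousOn_iff_le.1
    (isCompact_Icc.uniformContinuousOn_of_continuous hpc) η hη0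
  have add : ∀ {g : ℝ → ℝ} {a b : ℝ}, IntegrableOn g (Icc s t) → s ≤ a → a ≤ b → b ≤ t →
      ∫ r in s..b, g r = (∫ r in s..a, g r) + ∫ r in a..b, g r := by
    intro g a b hg ha hab hb
    exact (intervalIntegral.integral_add_adjacent_intervals
      (sub hg le_rfl ha (hab.trans hb)) (sub hg ha hab hb)).symm
  -- On a short interval the convexity inequality holds with p frozen at the right endpoint b;
  -- uniform continuity replaces p b by p r at cost η ‖v r‖, which is subtracted in Φ.
  have key := le_of_forall_short_le (Φ := fun b => ‖p b‖ ^ 2 -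
    2 * (∫ r in s..b, inner ℝ (v r) (p r)) - 2 * η * ∫ r in s..b, ‖v r‖) hδ hst (by
    intro a b ha hab hb hd
    have h1 := norm_posPart_sq_sub_le (w b) (w a)
    have hvab : IntervalIntegrable v volume a b :=
      (intervalIntegrable_iff_integrableOn_Icc_of_le hab).2 (hv.mono_set (Icc_subset_Icc ha hb))
    have h2 : inner ℝ (w b - w a) (p b) = ∫ r in a..b, inner ℝ (v r) (p b) := by
      rw [hwv a b ha hab hb, real_inner_comm]
      have := (innerSL ℝ (p b)).intervalIntegral_comp_comm hvab
      simp only [innerSL_apply_apply] at this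
      rw [← this]
      simp_rw [real_inner_comm]
    have hIc : IntegrableOn (fun r => inner ℝ (v r) (p b)) (Icc s t) :=
      hsm aestronglyMeasurable_const (C := ‖p b‖) fun _ _ => le_rfl
    have h3 : ∫ r in a..b, inner ℝ (v r) (p b) ≤
        (∫ r in a..b, inner ℝ (v r) (p r)) + η * ∫ r in a..b, ‖v r‖ := by
      rw [← intervalIntegral.integral_const_mul, ← intervalIntegral.integral_add
        (sub hI ha hab hb) (sub (hv.norm.const_mul η) ha hab hb)]
      refine intervalIntegral.integral_mono_on hab (sub hIc ha hab hb)
        (sub (hI.add (hv.norm.const_mul η)) ha hab hb) fun r hr => ?_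
      have h4 : inner ℝ (v r) (p b) - inner ℝ (v r) (p r) ≤ η * ‖v r‖ := by
        rw [← inner_sub_right]
        refine (real_inner_le_norm _ _).trans ?_
        rw [mul_comm]
        refine mul_le_mul_of_nonneg_right ?_ (norm_nonneg _)
        rw [← dist_eq_norm]
        refine hu b ⟨ha.trans hab, hb⟩ r ⟨ha.trans hr.1, hr.2.trans hb⟩ ?_
        rw [Real.dist_eq, abs_of_nonneg (by linarith [hr.2])]
        linarith [hr.1]
      linarith
    have h5 := add hI ha hab hb
    have h6 := add hv.norm ha hab hb
    change ‖p b‖ ^ 2 - ‖p a‖ ^ 2 ≤ 2 * inner ℝ (w b - w a) (p b) at h1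
    rw [h2] at h1
    rw [h5, h6]
    linarith)
  simp only [intervalIntegral.integral_same, mul_zero, sub_zero] at key
  have h7 : 2 * η * V ≤ ε := by
    rw [hη]
    have : 2 * (ε / (2 * (V + 1))) * V = ε * (V / (V + 1)) := by field_simp
    rw [this]
    exact mul_le_of_le_one_right hε.le ((div_le_one (by positivity)).2 (by linarith))
  linarith

end PosPart

/-- Gronwall's lemma for a non-negative continuous function that vanishes at `0`. -/
theorem eq_zero_of_sub_le_integral {y : ℝ → ℝ} {T K : ℝ} (hT : 0 ≤ T) (hK : 0 ≤ K)
    (hy : ContinuousOn y (Icc 0 T)) (hy0 : y 0 = 0) (hnn : ∀ t, 0 ≤ y t)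
    (h : ∀ s t, 0 < s → s ≤ t → t ≤ T → y t - y s ≤ K * ∫ r in s..t, y r) :
    ∀ t ∈ Icc 0 T, y t = 0 := by
  -- The continuous extension of y to the line has a primitive that is differentiable everywhere,
  -- endpoints included.
  set z : ℝ → ℝ := IccExtend hT ((Icc 0 T).domRestrict y) with hz
  have hzc : Continuous z := (continuousOn_iff_continuous_domRestrict.1 hy).Icc_extend'
  have hzy : ∀ t ∈ Icc 0 T, z t = y t := fun t ht => IccExtend_of_mem hT _ ht
  have hznn : ∀ t, 0 ≤ z t := fun t => hnn _
  set Y : ℝ → ℝ := fun t => ∫ r in (0 : ℝ)..t, z r with hY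
  have hYd : ∀ t, HasDerivAt Y (z t) t := fun t =>
    (hzc.integral_hasStrictDerivAt 0 t).hasDerivAt
  have hYnn : ∀ t, 0 ≤ t → 0 ≤ Y t := fun t ht =>
    intervalIntegral.integral_nonneg ht fun r _ => hznn r
  have hle : ∀ t ∈ Icc 0 T, z t ≤ K * Y t := by
    intro t ht
    rcases ht.1.eq_or_lt with h0 | h0
    · rw [hzy t ht, ← h0, hy0]
      exact mul_nonneg hK (hYnn 0 le_rfl)
    have h1 : ∀ s ∈ Ioc 0 t, z t ≤ z s + K * Y t := by
      intro s hs
      have h2 := h s t hs.1 hs.2 ht.2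
      have h3 : ∫ r in s..t, y r = ∫ r in s..t, z r := by
        refine intervalIntegral.integral_congr fun r hr => ?_
        rw [uIcc_of_le hs.2] at hr
        exact (hzy r ⟨hs.1.le.trans hr.1, hr.2.trans ht.2⟩).symm
      have h4 : Y t = Y s + ∫ r in s..t, z r :=
        (intervalIntegral.integral_add_adjacent_intervals (hzc.intervalIntegrable _ _)
          (hzc.intervalIntegrable _ _)).symm
      have h5 := hYnn s hs.1.le
      rw [h3, ← hzy t ht, ← hzy s ⟨hs.1.le, hs.2.trans ht.2⟩] at h2
      rw [h4]
      nlinarith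
    -- The hypothesis starts at s > 0 only; continuity at 0 brings in the initial value. Then Y' ≤ K
    -- Y and Y(0) = 0.
    have h6 : Tendsto (fun s => z s + K * Y t) (𝓝[>] 0) (𝓝 (z 0 + K * Y t)) :=
      ((hzc.tendsto 0).mono_left nhdsWithin_le_nhds).add_const _
    have h7 := ge_of_tendsto h6 (by filter_upwards [Ioc_mem_nhdsGT h0] with s hs using h1 s hs)
    rwa [hzy 0 ⟨le_rfl, hT⟩, hy0, zero_add] at h7
  have hY0 : ∀ t ∈ Icc 0 T, Y t = 0 := by
    refine eq_zero_of_abs_deriv_le_mul_abs_self_of_eq_zero_right (K := K)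
      (fun t _ => (hYd t).continuousAt.continuousWithinAt)
      (fun t _ => (hYd t).hasDerivWithinAt) (by simp [hY]) fun t ht => ?_
    rw [Real.norm_of_nonneg (hznn t), Real.norm_of_nonneg (hYnn t ht.1)]
    exact hle t ⟨ht.1, ht.2.le⟩
  intro t ht
  have h8 := hle t ht
  rw [hY0 t ht, mul_zero, hzy t ht] at h8
  exact le_antisymm h8 (hnn t)

/-! ### Ordered graphs and reaction terms -/

theorem le_eSup {S : Set ℝ} {z : ℝ} (hz : z ∈ S) : (z : EReal) ≤ eSup S :=
  le_sSup (mem_image_of_mem _ hz)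

theorem eInf_le {S : Set ℝ} {z : ℝ} (hz : z ∈ S) : eInf S ≤ z :=
  sInf_le (mem_image_of_mem _ hz)

theorem eSup_singleton (z : ℝ) : eSup {z} = z := by simp [eSup]

theorem eInf_singleton (z : ℝ) : eInf {z} = z := by simp [eInf]

theorem GraphsOrdered.le {γ₁ γ₂ : ℝ → Set ℝ} (h : GraphsOrdered γ₁ γ₂) {r₁ r₂ z₁ z₂ : ℝ}
    (h₁ : z₁ ∈ γ₁ r₁) (h₂ : z₂ ∈ γ₂ r₂) (hr : r₂ < r₁) : z₂ ≤ z₁ := by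
  have := (le_eSup h₂).trans ((h r₁ ⟨z₁, h₁⟩ r₂ ⟨z₂, h₂⟩ hr).trans (eInf_le h₁))
  exact_mod_cast this

theorem IsMonotoneGraph.le {γ : ℝ → Set ℝ} (h : IsMonotoneGraph γ) {r₁ r₂ z₁ z₂ : ℝ}
    (h₁ : z₁ ∈ γ r₁) (h₂ : z₂ ∈ γ r₂) (hr : r₂ < r₁) : z₂ ≤ z₁ := by
  have := nonneg_of_mul_nonneg_left (h r₁ r₂ z₁ h₁ z₂ h₂) (sub_pos.2 hr)
  linarith

/-- If one of the two ordered reaction terms is single-valued, it controls the difference. -/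
theorem sub_le_of_singleValued {n : ℕ} {F₁ F₂ : Euc n → Set ℝ} {φ : Euc n → ℝ}
    (h : ∀ U, eSup (F₁ U) ≤ eInf (F₂ U)) (hφ : (∀ U, F₁ U = {φ U}) ∨ ∀ U, F₂ U = {φ U})
    {U V : Euc n} {f₁ f₂ : ℝ} (h₁ : f₁ ∈ F₁ U) (h₂ : f₂ ∈ F₂ V) : f₁ - f₂ ≤ φ U - φ V := by
  -- The ordering is used at the argument of the other reaction term: at V if F₁ is single-valued,
  -- at U if F₂ is.
  rcases hφ with hφ | hφ
  · rw [hφ, mem_singleton_iff] at h₁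
    have h3 := (h V).trans (eInf_le h₂)
    rw [hφ, eSup_singleton] at h3
    have : φ V ≤ f₂ := by exact_mod_cast h3
    linarith
  · rw [hφ, mem_singleton_iff] at h₂
    have h3 := (le_eSup h₁).trans (h U)
    rw [hφ, eInf_singleton] at h3
    have : f₁ ≤ φ U := by exact_mod_cast h3
    linarith

/-! ### The difference of a sub- and a super-solution at a fixed time -/

instance {N : ℕ} (Ω : Set (Euc N)) : SFinite (bulkMeasure Ω) := by
  unfold bulkMeasure; infer_instance

theorem IsTestFunction.exists_lipschitzWith {N : ℕ} {Ω : Set (Euc N)} {φ : Euc N → ℝ}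
    (hφ : IsTestFunction Ω φ) : ∃ K : ℝ≥0, LipschitzWith K φ :=
  ContDiff.lipschitzWith_of_hasCompactSupport hφ.2.1 hφ.1 (by simp)

theorem IsTestFunction.memLp {N : ℕ} {Ω : Set (Euc N)} {φ : Euc N → ℝ}
    (hφ : IsTestFunction Ω φ) : MemLp φ 2 (bulkMeasure Ω) :=
  (hφ.1.continuous.memLp_of_hasCompactSupport hφ.2.1).restrict Ω

theorem IsTestFunction.memLp_partialDeriv {N : ℕ} {Ω : Set (Euc N)} {φ : Euc N → ℝ}
    (hφ : IsTestFunction Ω φ) (i : Fin N) : MemLp (partialDeriv i φ) 2 (bulkMeasure Ω) := by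
  obtain ⟨K, hK⟩ := hφ.exists_lipschitzWith
  exact (memLp_partialDeriv_of_lipschitzWith hK hφ.2.1 i).restrict Ω

theorem IsTestFunction.integrable_mul {N : ℕ} {Ω : Set (Euc N)} {φ D : Euc N → ℝ}
    (hφ : IsTestFunction Ω φ) (hD : LocallyIntegrableOn D Ω) :
    Integrable (fun x => D x * φ x) (bulkMeasure Ω) := by
  have h1 := (hD.integrableOn_compact_subset hφ.2.2 hφ.2.1.isCompact).mul_continuousOn
    hφ.1.continuous.continuousOn hφ.2.1.isCompact
  refine Integrable.integrableOn ((integrableOn_iff_integrable_of_support_subset ?_).1 h1)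
  exact (Function.support_mul_subset_right _ _).trans (subset_tsupport φ)

theorem HasWeakPartial.sub {N : ℕ} {Ω : Set (Euc N)} {i : Fin N} {v₁ v₂ w₁ w₂ : Euc N → ℝ}
    (h₁ : HasWeakPartial Ω i v₁ w₁) (h₂ : HasWeakPartial Ω i v₂ w₂)
    (hv₁ : MemLp v₁ 2 (bulkMeasure Ω)) (hv₂ : MemLp v₂ 2 (bulkMeasure Ω))
    (hw₁ : MemLp w₁ 2 (bulkMeasure Ω)) (hw₂ : MemLp w₂ 2 (bulkMeasure Ω)) :
    HasWeakPartial Ω i (fun x => v₁ x - v₂ x) (fun x => w₁ x - w₂ x) := by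
  intro φ hφ
  have hp := hφ.memLp_partialDeriv i
  have e1 : ∫ x in Ω, (v₁ x * partialDeriv i φ x - v₂ x * partialDeriv i φ x) =
      (∫ x in Ω, v₁ x * partialDeriv i φ x) - ∫ x in Ω, v₂ x * partialDeriv i φ x :=
    integral_sub (hv₁.integrable_mul hp) (hv₂.integrable_mul hp)
  have e2 : ∫ x in Ω, (w₁ x * φ x - w₂ x * φ x) =
      (∫ x in Ω, w₁ x * φ x) - ∫ x in Ω, w₂ x * φ x :=
    integral_sub (hw₁.integrable_mul hφ.memLp) (hw₂.integrable_mul hφ.memLp)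
  simp only [sub_mul]
  rw [e1, e2, h₁ φ hφ, h₂ φ hφ]
  ring

/-- The weak form of `h ≤ ∑ ∂_j A¹_j - ∑ ∂_j A²_j`. -/
theorem integral_add_integral_le_of_hasWeakDivergence {N : ℕ} {Ω : Set (Euc N)}
    {A₁ A₂ : Fin N → Euc N → ℝ} {D₁ D₂ h : Euc N → ℝ}
    (h₁ : HasWeakDivergence Ω A₁ D₁) (h₂ : HasWeakDivergence Ω A₂ D₂)
    (hA₁ : ∀ j, MemLp (A₁ j) 2 (bulkMeasure Ω)) (hA₂ : ∀ j, MemLp (A₂ j) 2 (bulkMeasure Ω))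
    (hh : MemLp h 2 (bulkMeasure Ω)) (hle : ∀ᵐ x ∂(bulkMeasure Ω), h x ≤ D₁ x - D₂ x)
    {φ : Euc N → ℝ} (hφ : IsTestFunction Ω φ) (hφ0 : ∀ x, 0 ≤ φ x) :
    (∫ x in Ω, ∑ j, (A₁ j x - A₂ j x) * partialDeriv j φ x) + ∫ x in Ω, h x * φ x ≤ 0 := by
  have i1 : Integrable (fun x => ∑ j, A₁ j x * partialDeriv j φ x) (volume.restrict Ω) :=
    integrable_finsetSum _ fun j _ => (hA₁ j).integrable_mul (hφ.memLp_partialDeriv j)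
  have i2 : Integrable (fun x => ∑ j, A₂ j x * partialDeriv j φ x) (volume.restrict Ω) :=
    integrable_finsetSum _ fun j _ => (hA₂ j).integrable_mul (hφ.memLp_partialDeriv j)
  have j1 : Integrable (fun x => D₁ x * φ x) (volume.restrict Ω) := hφ.integrable_mul h₁.1
  have j2 : Integrable (fun x => D₂ x * φ x) (volume.restrict Ω) := hφ.integrable_mul h₂.1
  simp only [sub_mul, Finset.sum_sub_distrib]
  rw [integral_sub i1 i2, h₁.2 φ hφ, h₂.2 φ hφ]
  have : ∫ x in Ω, h x * φ x ≤ ∫ x in Ω, (D₁ x * φ x - D₂ x * φ x) := by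
    refine integral_mono_ae (hh.integrable_mul hφ.memLp) (j1.sub j2) ?_
    filter_upwards [hle] with x hx
    rw [← sub_mul]
    exact mul_le_mul_of_nonneg_right hx (hφ0 x)
  rw [integral_sub j1 j2] at this
  linarith

/-- Fubini turns the bound on the product into bounds on almost every slice. Summing the bounds of
all entries gives one constant for the interior and the boundary. -/
theorem IsCoefficient.ae_slice {N : ℕ} {Ω : Set (Euc N)} {T : ℝ}
    {a : Fin N → Fin N → ℝ → Euc N → ℝ} (h : IsCoefficient Ω T a) :
    ∀ᵐ t ∂(volume.restrict (Ioo (0 : ℝ) T)),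
      (∀ i j, AEStronglyMeasurable (a i j t) (bulkMeasure Ω)) ∧
      ∃ C : ℝ, ∀ i j, (∀ᵐ x ∂(bulkMeasure Ω), |a i j t x| ≤ C) ∧
        ∀ᵐ x ∂(surfaceMeasure Ω), |a i j t x| ≤ C := by
  choose C hC using h.bounded_boundary
  have h1 : ∀ᵐ t ∂(volume.restrict (Ioo (0 : ℝ) T)), ∀ i j,
      AEStronglyMeasurable (a i j t) (bulkMeasure Ω) :=
    ae_all_iff.2 fun i => ae_all_iff.2 fun j => (h.bounded i j).1.prodMk_left
  have h2 : ∀ i j, ∃ B : ℝ, ∀ᵐ t ∂(volume.restrict (Ioo (0 : ℝ) T)),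
      ∀ᵐ x ∂(bulkMeasure Ω), |a i j t x| ≤ B := by
    intro i j
    refine ⟨_, Measure.ae_ae_of_ae_prod
      (p := fun p : ℝ × Euc N => |a i j p.1 p.2| ≤ (eLpNormEssSup (fun p : ℝ × Euc N =>
        a i j p.1 p.2) ((volume.restrict (Ioo (0 : ℝ) T)).prod (bulkMeasure Ω))).toReal) ?_⟩
    have hfin := (h.bounded i j).2
    rw [eLpNorm_exponent_top] at hfin
    filter_upwards [ae_le_eLpNormEssSup (f := fun p : ℝ × Euc N => a i j p.1 p.2)
      (μ := (volume.restrict (Ioo (0 : ℝ) T)).prod (bulkMeasure Ω))] with p hp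
    have := (ENNReal.toReal_le_toReal enorm_ne_top hfin.ne).2 hp
    simpa using this
  choose B hB using h2
  filter_upwards [h1, ae_all_iff.2 fun i => ae_all_iff.2 fun j => hB i j,
    ae_all_iff.2 fun i => ae_all_iff.2 fun j => hC i j] with t ht1 ht2 ht3
  have hle : ∀ (E : Fin N → Fin N → ℝ) i j, |E i j| ≤ ∑ i, ∑ j, |E i j| := by
    intro E i j
    refine (Finset.single_le_sum (f := fun j => |E i j|) (fun j _ => abs_nonneg _)
      (Finset.mem_univ j)).trans ?_
    exact Finset.single_le_sum (f := fun i => ∑ j, |E i j|)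
      (fun i _ => Finset.sum_nonneg fun j _ => abs_nonneg _) (Finset.mem_univ i)
  have nn : ∀ E : Fin N → Fin N → ℝ, 0 ≤ ∑ i, ∑ j, |E i j| := fun E =>
    Finset.sum_nonneg fun i _ => Finset.sum_nonneg fun j _ => abs_nonneg _
  refine ⟨ht1, (∑ i, ∑ j, |B i j|) + ∑ i, ∑ j, |C i j|, fun i j => ⟨?_, ?_⟩⟩
  · filter_upwards [ht2 i j] with x hx
    linarith [hle B i j, le_abs_self (B i j), nn C]
  · filter_upwards [ht3 i j] with x hx
    linarith [hle C i j, le_abs_self (C i j), nn B]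

theorem memLp_Lp_sub {α : Type*} [MeasurableSpace α] {μ : Measure α} (f g : Lp ℝ 2 μ) :
    MemLp (fun x => f x - g x) 2 μ :=
  (Lp.memLp f).sub (Lp.memLp g)

/-- At a fixed time the parabolic inequalities become elliptic: the time derivatives, β sections and
reactions are all put into the right-hand side h. The difference of the residuals then says that h ≤
div(a ∇u_1) - div(a ∇u_2). -/
theorem ae_isStationarySubsolution {N m : ℕ} (hN : 1 ≤ N) {Ω : Set (Euc N)}
    (hΩ : IsSmoothDomain Ω) {T : ℝ} {P₁ P₂ : Problem N m} {k : Fin m}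
    (ha : IsCoefficient Ω T (P₁.coeff k)) (hcoeff : P₁.coeff k = P₂.coeff k)
    (hγ : AEOn T (surfaceMeasure Ω) fun t x => IsMonotoneGraph (P₁.γ k t x))
    {U₁ U₂ : Field Ω m} {d₁ d₂ : ComponentData Ω}
    (hc₁ : IsComponent P₁ Ω T U₁ k d₁) (hc₂ : IsComponent P₂ Ω T U₂ k d₂)
    (hr₁ : AEOn T (bulkMeasure Ω) fun t x => d₁.residual t x ≤ 0)
    (hr₂ : AEOn T (bulkMeasure Ω) fun t x => d₂.residual t x ≥ 0)
    (hg₁ : AEOn T (surfaceMeasure Ω) fun t x => -d₁.conormal (P₁.coeff k) t x ≥ d₁.g t x)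
    (hg₂ : AEOn T (surfaceMeasure Ω) fun t x => -d₂.conormal (P₂.coeff k) t x ≤ d₂.g t x)
    (A3 : (AEOn T (surfaceMeasure Ω) fun t x => P₁.γ k t x = P₂.γ k t x) ∨
      (AEOn T (surfaceMeasure Ω) fun t x => GraphsOrdered (P₁.γ k t x) (P₂.γ k t x)) ∨
      (AEOn T (surfaceMeasure Ω) fun t x => DomainsOrdered (P₁.γ k t x) (P₂.γ k t x))) :
    ∀ᵐ t ∂(volume.restrict (Ioo (0 : ℝ) T)),
      IsStationarySubsolution Ω (fun i j => P₁.coeff k i j t) (fun x => U₁ k t x - U₂ k t x)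
        (fun x => (d₁.ut t x - d₂.ut t x) + (d₁.b t x - d₂.b t x) - (d₁.f t x - d₂.f t x))
        (fun i x => d₁.Du i t x - d₂.Du i t x) (fun x => d₁.tr t x - d₂.tr t x)
        (fun i x => d₁.trD i t x - d₂.trD i t x) := by
  rw [← hcoeff] at hg₂
  obtain ⟨M₁, hM₁⟩ := hc₁.bounded
  obtain ⟨M₂, hM₂⟩ := hc₂.bounded
  obtain ⟨lam, hlam, hell⟩ := ha.elliptic
  -- Each alternative of (A3) leads to this dichotomy. If g_2 ≤ g_1, the two boundary inequalities
  -- give a conormal derivative of the difference of at most g_2 - g_1 ≤ 0.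
  have hsign : AEOn T (surfaceMeasure Ω) fun t x => d₁.tr t x - d₂.tr t x ≤ 0 ∨
      d₂.g t x ≤ d₁.g t x := by
    rcases A3 with h | h | h
    · filter_upwards [h, hγ, hc₁.g_mem, hc₂.g_mem] with t h1 h2 h3 h4
      filter_upwards [h1, h2, h3, h4] with x h1 h2 h3 h4
      rcases le_or_gt (d₁.tr t x) (d₂.tr t x) with hle | hlt
      · exact Or.inl (by linarith)
      · rw [← h1] at h4
        exact Or.inr (h2.le h3 h4 hlt)
    · filter_upwards [h, hc₁.g_mem, hc₂.g_mem] with t h1 h3 h4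
      filter_upwards [h1, h3, h4] with x h1 h3 h4
      rcases le_or_gt (d₁.tr t x) (d₂.tr t x) with hle | hlt
      · exact Or.inl (by linarith)
      · exact Or.inr (h1.le h3 h4 hlt)
    · filter_upwards [h, hc₁.g_mem, hc₂.g_mem] with t h1 h3 h4
      filter_upwards [h1, h3, h4] with x h1 h3 h4
      exact Or.inl (sub_nonpos.2 (h1 _ ⟨_, h3⟩ _ ⟨_, h4⟩))
  filter_upwards [ha.ae_slice, ae_all_iff.2 fun i => ae_all_iff.2 fun j => ha.boundary_value i j,
    hell, hM₁, hM₂, ae_all_iff.2 hc₁.space.2.2.1, ae_all_iff.2 hc₂.space.2.2.1, hc₁.divergence,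
    hc₂.divergence, hc₁.trace, hc₂.trace, ae_all_iff.2 hc₁.trace_grad,
    ae_all_iff.2 hc₂.trace_grad, hr₁, hr₂, hg₁, hg₂, hsign] with t hsl hbv hel hM₁ hM₂ hw₁ hw₂
    hdv₁ hdv₂ htr₁ htr₂ htg₁ htg₂ hr₁ hr₂ hg₁ hg₂ hsign
  have hab : ∃ C : ℝ, ∀ i j, ∀ᵐ x ∂(bulkMeasure Ω), |P₁.coeff k i j t x| ≤ C :=
    hsl.2.imp fun C hC i j => (hC i j).1
  have hh : MemLp (fun x => (d₁.ut t x - d₂.ut t x) + (d₁.b t x - d₂.b t x) -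
      (d₁.f t x - d₂.f t x)) 2 (bulkMeasure Ω) :=
    ((memLp_Lp_sub (d₁.ut t) (d₂.ut t)).add (memLp_Lp_sub (d₁.b t) (d₂.b t))).sub
      (memLp_Lp_sub (d₁.f t) (d₂.f t))
  exact
  { memLp := memLp_Lp_sub (U₁ k t) (U₂ k t)
    bounded := by
      refine ⟨M₁ + M₂, ?_⟩
      filter_upwards [hM₁, hM₂] with x h1 h2
      exact (abs_sub _ _).trans (add_le_add h1 h2)
    memLp_rhs := hh
    memLp_grad := fun i => memLp_Lp_sub (d₁.Du i t) (d₂.Du i t)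
    coeff_meas := hsl.1
    coeff_bounded := hsl.2
    weak := fun i => (hw₁ i).sub (hw₂ i) (Lp.memLp (U₁ k t)) (Lp.memLp (U₂ k t))
      (Lp.memLp (d₁.Du i t)) (Lp.memLp (d₂.Du i t))
    test := by
      intro φ hφ hφ0
      rw [← hcoeff] at hdv₂
      have h1 := integral_add_integral_le_of_hasWeakDivergence hdv₁ hdv₂
        (memLp_flux hsl.1 hab fun i => Lp.memLp (d₁.Du i t))
        (memLp_flux hsl.1 hab fun i => Lp.memLp (d₂.Du i t)) hh (by
          filter_upwards [hr₁, hr₂] with x h1 h2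
          simp only [ComponentData.residual] at h1 h2
          linarith) hφ hφ0
      simpa only [mul_sub, Finset.sum_sub_distrib] using h1
    elliptic := by
      filter_upwards [hel] with x hx
      have h1 := hx (WithLp.toLp 2 fun i => d₁.Du i t x - d₂.Du i t x)
      have h2 : 0 ≤ lam * ‖(WithLp.toLp 2 fun i => d₁.Du i t x - d₂.Du i t x : Euc N)‖ ^ 2 := by
        positivity
      refine (h2.trans h1).trans_eq ?_
      rw [Finset.sum_comm]
      simp only [Finset.sum_mul]
    trace := htr₁.sub hN hΩ htr₂ (Lp.memLp (U₁ k t)).1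
    trace_grad := fun i => (htg₁ i).sub hN hΩ (htg₂ i) (Lp.memLp (d₁.Du i t)).1
    trace_coeff := hbv
    sign := by
      filter_upwards [hg₁, hg₂, hsign] with x h1 h2 h3
      refine h3.imp_right fun h3 => ?_
      simp only [ComponentData.conormal] at h1 h2
      simp only [mul_sub, Finset.sum_sub_distrib]
      linarith }

/-! ### The energy inequality and the conclusion -/

theorem SingleValuedSC.exists_lipschitz {N m : ℕ} {Ω : Set (Euc N)} {T : ℝ} {k : Fin m}
    {F : ℝ → Euc N → Euc m → Set ℝ} (h : SingleValuedSC Ω T k F) {M : ℝ} (hM : 0 < M) :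
    ∃ (φ : ℝ → Euc N → Euc m → ℝ) (L : ℝ≥0), AEOn T (bulkMeasure Ω) fun t x =>
      (∀ U, F t x U = {φ t x U}) ∧ ∀ U V : Euc m, (∀ j, |U j| ≤ M) → (∀ j, |V j| ≤ M) →
        V k ≤ U k → φ t x U - φ t x V ≤ L * ∑ j, max (U j - V j) 0 := by
  obtain ⟨φ, h1, h2, h3⟩ := h
  have hm : (0 : ℝ) < m := by exact_mod_cast k.pos
  -- Vectors with components bounded by M have Euclidean norm at most m M.
  obtain ⟨L, hL⟩ := h3 (m * M) (by positivity)
  -- Integer radii let all balls be treated outside one null set; n + 1 makes the radius positive.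
  have h4 : ∀ n : ℕ, ∃ L : ℝ≥0, AEOn T (bulkMeasure Ω) fun t x =>
      LipschitzOnWith L (φ t x) (Metric.closedBall 0 n) := by
    intro n
    obtain ⟨L, hL⟩ := h3 (n + 1) (by positivity)
    refine ⟨L, ?_⟩
    filter_upwards [hL] with t ht
    filter_upwards [ht] with x hx
    exact hx.mono (Metric.closedBall_subset_closedBall (by linarith))
  choose L' hL' using h4
  refine ⟨φ, L, ?_⟩
  filter_upwards [h1, h2, hL, ae_all_iff.2 hL'] with t h1 h2 h5 h6
  filter_upwards [h1, h2, h5, ae_all_iff.2 h6] with x h1 h2 h5 h6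
  exact ⟨h1, fun U V hU hV hk =>
    sub_le_of_quasiMonotone (fun n => ⟨L' n, h6 n⟩) h2 h5 hU hV hk⟩

/-- The reaction terms are controlled by the positive parts of the differences. -/
theorem exists_reaction_sub_le {N m : ℕ} {Ω : Set (Euc N)} {T : ℝ} {P₁ P₂ : Problem N m}
    {k : Fin m} {U₁ U₂ : Field Ω m} {f₁ f₂ : ℝ → Lp ℝ 2 (bulkMeasure Ω)} {M : ℝ} (hM : 0 < M)
    (hU₁ : ∀ j, AEOn T (bulkMeasure Ω) fun t x => |U₁ j t x| ≤ M)
    (hU₂ : ∀ j, AEOn T (bulkMeasure Ω) fun t x => |U₂ j t x| ≤ M)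
    (hf₁ : AEOn T (bulkMeasure Ω) fun t x => f₁ t x ∈ P₁.F k t x (U₁.val t x))
    (hf₂ : AEOn T (bulkMeasure Ω) fun t x => f₂ t x ∈ P₂.F k t x (U₂.val t x))
    (hF : AEOn T (bulkMeasure Ω) fun t x => ∀ U : Euc m,
      eSup (P₁.F k t x U) ≤ eInf (P₂.F k t x U))
    (hsv : SingleValuedSC Ω T k (P₁.F k) ∨ SingleValuedSC Ω T k (P₂.F k)) :
    ∃ L : ℝ≥0, AEOn T (bulkMeasure Ω) fun t x => U₂ k t x ≤ U₁ k t x →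
      f₁ t x - f₂ t x ≤ L * ∑ j, max (U₁ j t x - U₂ j t x) 0 := by
  obtain ⟨φ, L, h⟩ : ∃ (φ : ℝ → Euc N → Euc m → ℝ) (L : ℝ≥0), AEOn T (bulkMeasure Ω) fun t x =>
      ((∀ U, P₁.F k t x U = {φ t x U}) ∨ ∀ U, P₂.F k t x U = {φ t x U}) ∧
      ∀ U V : Euc m, (∀ j, |U j| ≤ M) → (∀ j, |V j| ≤ M) →
        V k ≤ U k → φ t x U - φ t x V ≤ L * ∑ j, max (U j - V j) 0 := by
    rcases hsv with h | h <;> obtain ⟨φ, L, h⟩ := h.exists_lipschitz hM <;> refine ⟨φ, L, ?_⟩ <;>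
      filter_upwards [h] with t ht <;> filter_upwards [ht] with x hx
    · exact ⟨Or.inl hx.1, hx.2⟩
    · exact ⟨Or.inr hx.1, hx.2⟩
  refine ⟨L, ?_⟩
  filter_upwards [h, ae_all_iff.2 hU₁, ae_all_iff.2 hU₂, hf₁, hf₂, hF] with t h1 h2 h3 h4 h5 h6
  filter_upwards [h1, ae_all_iff.2 h2, ae_all_iff.2 h3, h4, h5, h6] with x h1 h2 h3 h4 h5 h6 hk
  exact (sub_le_of_singleValued h6 h1.1 h4 h5).trans (h1.2 _ _ h2 h3 hk)

/-- Where w^k > 0, the β term is non-negative and the reaction difference is at most L ∑ (w^j)⁺, so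
the difference of the time derivatives is at most h + L ∑ (w^j)⁺. Multiplied by (w^k)⁺, the part
with h integrates to at most 0 by the energy inequality. -/
theorem ae_inner_posPart_le {N m : ℕ} {Ω : Set (Euc N)} {T : ℝ} {U₁ U₂ : Field Ω m}
    {k : Fin m} {ut₁ ut₂ b₁ b₂ f₁ f₂ : ℝ → Lp ℝ 2 (bulkMeasure Ω)} {L : ℝ≥0}
    (hint : ∀ᵐ t ∂(volume.restrict (Ioo (0 : ℝ) T)),
      ∫ x in Ω, ((ut₁ t x - ut₂ t x) + (b₁ t x - b₂ t x) - (f₁ t x - f₂ t x)) *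
        max (U₁ k t x - U₂ k t x) 0 ≤ 0)
    (hb : AEOn T (bulkMeasure Ω) fun t x => U₂ k t x < U₁ k t x → b₂ t x ≤ b₁ t x)
    (hf : AEOn T (bulkMeasure Ω) fun t x => U₂ k t x ≤ U₁ k t x →
      f₁ t x - f₂ t x ≤ L * ∑ j, max (U₁ j t x - U₂ j t x) 0) :
    ∀ᵐ t ∂(volume.restrict (Ioo (0 : ℝ) T)),
      inner ℝ (ut₁ t - ut₂ t) (Lp.posPart (U₁ k t - U₂ k t)) ≤
        (L * m) * ∑ j, ‖Lp.posPart (U₁ j t - U₂ j t)‖ ^ 2 := by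
  filter_upwards [hint, hb, hf] with t hint hb hf
  set p : Fin m → Lp ℝ 2 (bulkMeasure Ω) := fun j => Lp.posPart (U₁ j t - U₂ j t) with hp
  have hpx : ∀ᵐ x ∂(bulkMeasure Ω), ∀ j, p j x = max (U₁ j t x - U₂ j t x) 0 := by
    refine ae_all_iff.2 fun j => ?_
    filter_upwards [Lp.coeFn_posPart (U₁ j t - U₂ j t), Lp.coeFn_sub (U₁ j t) (U₂ j t)]
      with x h1 h2
    rw [hp, h1, h2, Pi.sub_apply]
  set h : Lp ℝ 2 (bulkMeasure Ω) := (ut₁ t - ut₂ t) + (b₁ t - b₂ t) - (f₁ t - f₂ t) with hh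
  have hhx : ∀ᵐ x ∂(bulkMeasure Ω), h x =
      (ut₁ t x - ut₂ t x) + (b₁ t x - b₂ t x) - (f₁ t x - f₂ t x) := by
    filter_upwards [Lp.coeFn_sub (ut₁ t) (ut₂ t), Lp.coeFn_sub (b₁ t) (b₂ t),
      Lp.coeFn_sub (f₁ t) (f₂ t), Lp.coeFn_add (ut₁ t - ut₂ t) (b₁ t - b₂ t),
      Lp.coeFn_sub ((ut₁ t - ut₂ t) + (b₁ t - b₂ t)) (f₁ t - f₂ t)] with x h1 h2 h3 h4 h5
    rw [hh, h5, Pi.sub_apply, h4, Pi.add_apply, h1, h2, h3, Pi.sub_apply, Pi.sub_apply,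
      Pi.sub_apply]
  have h1 : inner ℝ h (p k) ≤ 0 := by
    rw [inner_Lp_eq_integral]
    refine le_of_eq_of_le (integral_congr_ae ?_) hint
    filter_upwards [hpx, hhx] with x h1 h2
    rw [h1, h2]
  have h2 : inner ℝ (ut₁ t - ut₂ t) (p k) ≤ inner ℝ h (p k) + L * ∑ j, inner ℝ (p j) (p k) := by
    simp only [inner_Lp_eq_integral]
    rw [← integral_finsetSum _ fun j _ => integrable_mul_Lp _ _, ← integral_const_mul,
      ← integral_add (integrable_mul_Lp _ _)
        ((integrable_finsetSum _ fun j _ => integrable_mul_Lp _ _).const_mul _)]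
    refine integral_mono_ae (integrable_mul_Lp _ _) ((integrable_mul_Lp _ _).add
      ((integrable_finsetSum _ fun j _ => integrable_mul_Lp _ _).const_mul _)) ?_
    filter_upwards [hpx, hhx, Lp.coeFn_sub (ut₁ t) (ut₂ t), hb, hf] with x h1 h2 h3 h4 h5
    simp only [h1, h2, h3, Pi.sub_apply]
    rw [← Finset.sum_mul]
    rcases le_or_gt (U₁ k t x) (U₂ k t x) with hle | hlt
    · rw [max_eq_right (sub_nonpos.2 hle)]
      simp
    · have h6 := h4 hlt
      have h7 := h5 hlt.le
      rw [← mul_assoc, ← add_mul]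
      refine mul_le_mul_of_nonneg_right ?_ (le_max_right _ _)
      linarith
  -- The factor m comes from bounding each of the m inner products by the whole sum of squares.
  have h3 : ∑ j, inner ℝ (p j) (p k) ≤ m * ∑ j, ‖p j‖ ^ 2 := by
    have h4 : ∀ j ∈ Finset.univ, inner ℝ (p j) (p k) ≤ ∑ j, ‖p j‖ ^ 2 := by
      intro j _
      have hs : ∀ i, ‖p i‖ ^ 2 ≤ ∑ j, ‖p j‖ ^ 2 := fun i =>
        Finset.single_le_sum (f := fun j => ‖p j‖ ^ 2) (fun j _ => sq_nonneg _)
          (Finset.mem_univ i)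
      have := real_inner_le_norm (p j) (p k)
      nlinarith [sq_nonneg (‖p j‖ - ‖p k‖), hs j, hs k]
    simpa using Finset.sum_le_sum h4
  have h4 := mul_le_mul_of_nonneg_left h3 L.2
  change (L : ℝ) * _ ≤ L * _ at h4
  rw [mul_assoc]
  linarith

theorem IsL2Loc.integrableOn {N : ℕ} {μ : Measure (Euc N)} {T : ℝ} {f : ℝ → Lp ℝ 2 μ}
    (hf : IsL2Loc T f) {s t : ℝ} (hs : 0 < s) (hsT : s ≤ T) (ht : t ≤ T) :
    IntegrableOn f (Icc s t) := by
  have h1 := hf (s / 2) ⟨by linarith, by linarith⟩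
  have h2 : IntegrableOn f (Ioc (s / 2) T) := h1.integrable (by norm_num)
  exact h2.mono_set fun r hr => ⟨by linarith [hr.1], hr.2.trans ht⟩

/-- A differential inequality for the squared norm of the positive part of a difference. -/
theorem norm_posPart_sq_sub_le_of_hasTimeDerivative {N : ℕ} {μ : Measure (Euc N)} {T : ℝ}
    {u₁ u₂ v₁ v₂ : ℝ → Lp ℝ 2 μ} (h₁ : HasTimeDerivative T u₁ v₁) (h₂ : HasTimeDerivative T u₂ v₂)
    (hc₁ : ContinuousOn u₁ (Icc 0 T)) (hc₂ : ContinuousOn u₂ (Icc 0 T)) {y : ℝ → ℝ}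
    (hy : ContinuousOn y (Icc 0 T)) {K : ℝ}
    (hle : ∀ᵐ t ∂(volume.restrict (Ioo (0 : ℝ) T)),
      inner ℝ (v₁ t - v₂ t) (Lp.posPart (u₁ t - u₂ t)) ≤ K * y t)
    {s t : ℝ} (hs : 0 < s) (hst : s ≤ t) (ht : t ≤ T) :
    ‖Lp.posPart (u₁ t - u₂ t)‖ ^ 2 - ‖Lp.posPart (u₁ s - u₂ s)‖ ^ 2 ≤
      2 * K * ∫ r in s..t, y r := by
  have hsub : Icc s t ⊆ Icc 0 T := Icc_subset_Icc hs.le ht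
  have i1 := h₁.2.1.integrableOn hs (hst.trans ht) ht
  have i2 := h₂.2.1.integrableOn hs (hst.trans ht) ht
  have hI : ∀ {g : ℝ → Lp ℝ 2 μ} {a b : ℝ}, IntegrableOn g (Icc s t) → s ≤ a → a ≤ b → b ≤ t →
      IntervalIntegrable g volume a b := fun hg ha hab hb =>
    (intervalIntegrable_iff_integrableOn_Icc_of_le hab).2 (hg.mono_set (Icc_subset_Icc ha hb))
  obtain ⟨j1, h⟩ := norm_posPart_sq_sub_le_integral (w := fun r => u₁ r - u₂ r)
    (v := fun r => v₁ r - v₂ r) hst ((hc₁.sub hc₂).mono hsub) (i1.sub i2) (by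
      intro a b ha hab hb
      rw [intervalIntegral.integral_sub (hI i1 ha hab hb) (hI i2 ha hab hb),
        ← h₁.2.2 a b (hs.trans_le ha) hab (hb.trans ht),
        ← h₂.2.2 a b (hs.trans_le ha) hab (hb.trans ht)]
      abel)
  refine h.trans ?_
  rw [mul_assoc, ← intervalIntegral.integral_const_mul K]
  refine mul_le_mul_of_nonneg_left ?_ (zero_le_two (α := ℝ))
  refine intervalIntegral.integral_mono_ae_restrict hst
    ((intervalIntegrable_iff_integrableOn_Icc_of_le hst).2 j1)
    ((continuousOn_const.mul (hy.mono hsub)).intervalIntegrable_of_Icc hst) ?_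
  rw [← restrict_Ioo_eq_restrict_Icc]
  exact ae_restrict_of_ae_restrict_of_subset (Ioo_subset_Ioo hs.le ht) hle

end ParabolicSystem

end

/-! ### The comparison theorem -/

theorem theorem2p1 (N m : ℕ) (hN : 1 ≤ N) (Ω : Set (Euc N)) (hΩ : IsSmoothDomain Ω)
    (T : ℝ) (hT : 0 < T) (P₁ P₂ : Problem N m)
    (hP₁ : P₁.IsAdmissible Ω T) (hP₂ : P₂.IsAdmissible Ω T)
    (hcoeff : P₁.coeff = P₂.coeff)
    (U₁ U₂ : Field Ω m)
    (hU₁ : IsSubSolution P₁ Ω T U₁) (hU₂ : IsSuperSolution P₂ Ω T U₂)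
    (A1 : ∀ k, ∀ᵐ x ∂(bulkMeasure Ω), P₁.init k x ≤ P₂.init k x)
    (A2 : ∀ k,
      (AEOn T (bulkMeasure Ω) fun t x => P₁.β k t x = P₂.β k t x) ∨
      (AEOn T (bulkMeasure Ω) fun t x => GraphsOrdered (P₁.β k t x) (P₂.β k t x)))
    (A3 : ∀ k,
      (AEOn T (surfaceMeasure Ω) fun t x => P₁.γ k t x = P₂.γ k t x) ∨
      (AEOn T (surfaceMeasure Ω) fun t x => GraphsOrdered (P₁.γ k t x) (P₂.γ k t x)) ∨
      (AEOn T (surfaceMeasure Ω) fun t x => DomainsOrdered (P₁.γ k t x) (P₂.γ k t x)))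
    (A4 : ∀ k,
      (AEOn T (bulkMeasure Ω) fun t x => ∀ U : Euc m,
        ⊥ < eSup (P₁.F k t x U) ∧ eSup (P₁.F k t x U) ≤ eInf (P₂.F k t x U) ∧
          eInf (P₂.F k t x U) < ⊤) ∧
      (SingleValuedSC Ω T k (P₁.F k) ∨ SingleValuedSC Ω T k (P₂.F k))) :
    ∀ k, ∀ t ∈ Set.Icc (0 : ℝ) T, ∀ᵐ x ∂(bulkMeasure Ω), U₁ k t x ≤ U₂ k t x := by

  choose d₁ hc₁ hr₁ hg₁ using hU₁
  choose d₂ hc₂ hr₂ hg₂ using hU₂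
  -- One bound for all components of both solutions, so that the reaction terms are Lipschitz on one
  -- fixed ball; adding 1 makes it positive even if m = 0.
  obtain ⟨M, hM, hM₁, hM₂⟩ : ∃ M : ℝ, 0 < M ∧
      (∀ j, AEOn T (bulkMeasure Ω) fun t x => |U₁ j t x| ≤ M) ∧
      ∀ j, AEOn T (bulkMeasure Ω) fun t x => |U₂ j t x| ≤ M := by
    choose M₁ h₁ using fun j => (hc₁ j).bounded
    choose M₂ h₂ using fun j => (hc₂ j).bounded
    have hle : ∀ (E : Fin m → ℝ) j, E j ≤ ∑ j, |E j| := fun E j => (le_abs_self _).trans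
      (Finset.single_le_sum (f := fun j => |E j|) (fun j _ => abs_nonneg _) (Finset.mem_univ j))
    have nn : ∀ E : Fin m → ℝ, 0 ≤ ∑ j, |E j| := fun E =>
      Finset.sum_nonneg fun j _ => abs_nonneg _
    refine ⟨1 + ∑ j, |M₁ j| + ∑ j, |M₂ j|, by linarith [nn M₁, nn M₂], fun j => ?_, fun j => ?_⟩
    · filter_upwards [h₁ j] with t ht
      filter_upwards [ht] with x hx
      linarith [hle M₁ j, nn M₂]
    · filter_upwards [h₂ j] with t ht
      filter_upwards [ht] with x hx
      linarith [hle M₂ j, nn M₁]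
  have hstat : ∀ k, ∃ L : ℝ≥0, ∀ᵐ t ∂(volume.restrict (Ioo (0 : ℝ) T)),
      inner ℝ ((d₁ k).ut t - (d₂ k).ut t) (Lp.posPart (U₁ k t - U₂ k t)) ≤
        (L * m) * ∑ j, ‖Lp.posPart (U₁ j t - U₂ j t)‖ ^ 2 := by
    intro k
    obtain ⟨L, hL⟩ := exists_reaction_sub_le hM hM₁ hM₂ (hc₁ k).f_mem (hc₂ k).f_mem (by
      filter_upwards [(A4 k).1] with t ht
      filter_upwards [ht] with x hx U using (hx U).2.1) (A4 k).2
    refine ⟨L, ae_inner_posPart_le (b₁ := (d₁ k).b) (b₂ := (d₂ k).b) ?_ ?_ hL⟩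
    · filter_upwards [ae_isStationarySubsolution hN hΩ (hP₁.coeff k) (congrFun hcoeff k)
        (hP₁.γ_mono k) (hc₁ k) (hc₂ k) (hr₁ k) (hr₂ k) (hg₁ k) (hg₂ k) (A3 k)] with t ht
      exact ht.integral_mul_posPart_le hN hΩ
    · rcases A2 k with h | h
      · filter_upwards [h, hP₁.β_mono k, (hc₁ k).b_mem, (hc₂ k).b_mem] with t h1 h2 h3 h4
        filter_upwards [h1, h2, h3, h4] with x h1 h2 h3 h4 hlt
        rw [← h1] at h4
        exact h2.le h3 h4 hlt
      · filter_upwards [h, (hc₁ k).b_mem, (hc₂ k).b_mem] with t h1 h3 h4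
        filter_upwards [h1, h3, h4] with x h1 h3 h4 hlt
        exact h1.le h3 h4 hlt
  choose L hL using hstat
  -- The reaction terms couple the components, so only the sum over all k satisfies a closed
  -- inequality.
  set y : ℝ → ℝ := fun t => ∑ k, ‖Lp.posPart (U₁ k t - U₂ k t)‖ ^ 2 with hy
  have hyc : ContinuousOn y (Icc 0 T) := continuousOn_finsetSum _ fun k _ =>
    (Lp.continuous_posPart.comp_continuousOn
      ((hc₁ k).continuous.sub (hc₂ k).continuous)).norm.pow 2
  have hy0 : y 0 = 0 := by
    refine Finset.sum_eq_zero fun k _ => ?_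
    have : Lp.posPart (U₁ k 0 - U₂ k 0) = 0 := by
      refine Lp.ext ?_
      filter_upwards [Lp.coeFn_posPart (U₁ k 0 - U₂ k 0), Lp.coeFn_sub (U₁ k 0) (U₂ k 0),
        (hc₁ k).initial, (hc₂ k).initial, A1 k, Lp.coeFn_zero ℝ 2 (bulkMeasure Ω)]
        with x h1 h2 h3 h4 h5 h6
      rw [h1, h2, Pi.sub_apply, h3, h4, max_eq_right (sub_nonpos.2 h5), h6, Pi.zero_apply]
    rw [this, norm_zero]
    ring
  -- K adds up the constants of the components; each 2 comes from differentiating the square.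
  have hzero := eq_zero_of_sub_le_integral (K := ∑ k, 2 * (L k * m)) hT.le
    (Finset.sum_nonneg fun k _ => by positivity) hyc hy0
    (fun t => Finset.sum_nonneg fun k _ => sq_nonneg _) (by
      intro s t hs hst ht
      rw [hy, ← Finset.sum_sub_distrib, Finset.sum_mul]
      exact Finset.sum_le_sum fun k _ => norm_posPart_sq_sub_le_of_hasTimeDerivative (hc₁ k).time
        (hc₂ k).time (hc₁ k).continuous (hc₂ k).continuous hyc (hL k) hs hst ht)
  intro k t ht
  have h1 := (Finset.sum_eq_zero_iff_of_nonneg fun j _ => sq_nonneg _).1 (hzero t ht) k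
    (Finset.mem_univ k)
  have h2 : Lp.posPart (U₁ k t - U₂ k t) = 0 := norm_eq_zero.1 (pow_eq_zero_iff two_ne_zero |>.1 h1)
  filter_upwards [Lp.coeFn_posPart (U₁ k t - U₂ k t), Lp.coeFn_sub (U₁ k t) (U₂ k t),
    Lp.coeFn_zero ℝ 2 (bulkMeasure Ω)] with x h3 h4 h5
  rw [h2, h5, Pi.zero_apply, h4, Pi.sub_apply] at h3
  have h6 := le_max_left (U₁ k t x - U₂ k t x) 0
  linarith
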